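/- Let $N\ge 3$ be an integer, let $2^*=\frac{2N}{N-2}$, and let $q\in\left(2+\frac4N,\,2^*\right)$. For $\mu>0$ put $$f_\mu(t)=\mu|t|^{q-2}t+|t|^{2^*-2}t,\qquad t\in\mathbb{R}.$$ Then for every $a>0$ there exists $\mu^*=\mu^*(a)>0$ (depending only on $a$, $N$ and $q$) such that for every $\mu\ge\mu^*$ there is a pair $(u_a,\lambda_a)\in H^1(\mathbb{R}^N)\times\mathbb{R}$, with $u_a$ real-valued, which is a weak solution of $$-\Delta u=\lambda u+f_\mu(u)\quad\text{in }\mathbb{R}^N,\qquad \int_{\mathbb{R}^N}|u|^2\,dx=a^2,$$ and which satisfies $\lambda_a<0$. Here, weak solution means that $\int_{\mathbb{R}^N}|u_a|^2\,dx=a^2$ and that, for every $v\in H^1(\mathbb{R}^N)$, the function $f_\mu(u_a)v$ is integrable and $$\int_{\mathbb{R}^N}\nabla u_a\cdot\nabla v\,dx=\lambda_a\int_{\mathbb{R}^N}u_a v\,dx+\int_{\mathbb{R}^N}f_\mu(u_a)\,v\,dx.$$ -/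

import Mathlib

open MeasureTheory
open scoped ContDiff

/-- `G` is the weak (distributional) gradient of the real function `u` on `ℝ^N`:
`∫ u ∂_w φ = - ∫ φ ⟨G, w⟩` for every test function `φ ∈ C_c^∞(ℝ^N)` and every direction `w`. -/
structure HasWeakGradient {N : ℕ} (u : EuclideanSpace ℝ (Fin N) → ℝ)
    (G : EuclideanSpace ℝ (Fin N) → EuclideanSpace ℝ (Fin N)) : Prop where
  locallyIntegrable : LocallyIntegrable u volume
  locallyIntegrable_gradient : LocallyIntegrable G volume
  integral_eq : ∀ φ : EuclideanSpace ℝ (Fin N) → ℝ, ContDiff ℝ ∞ φ → HasCompactSupport φ →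
    ∀ w : EuclideanSpace ℝ (Fin N),
      ∫ x, u x * fderiv ℝ φ x w = - ∫ x, φ x * inner ℝ (G x) w

/-- `u ∈ H¹(ℝ^N)` (real-valued), and `G` is its weak gradient. -/
structure IsH1WithGradient {N : ℕ} (u : EuclideanSpace ℝ (Fin N) → ℝ)
    (G : EuclideanSpace ℝ (Fin N) → EuclideanSpace ℝ (Fin N)) : Prop where
  memLp : MemLp u 2 volume
  memLp_gradient : MemLp G 2 volume
  hasWeakGradient : HasWeakGradient u G

/-- `u ∈ H¹(ℝ^N)` is a weak solution of `-Δu = lam u + f(u)` in `ℝ^N`: for every `v ∈ H¹(ℝ^N)`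
the function `f(u) v` is integrable and
`∫ ∇u · ∇v = lam ∫ u v + ∫ f(u) v`. -/
def IsWeakSolution {N : ℕ} (f : ℝ → ℝ) (u : EuclideanSpace ℝ (Fin N) → ℝ) (lam : ℝ) : Prop :=
  ∃ G : EuclideanSpace ℝ (Fin N) → EuclideanSpace ℝ (Fin N), IsH1WithGradient u G ∧
    ∀ (v : EuclideanSpace ℝ (Fin N) → ℝ)
      (V : EuclideanSpace ℝ (Fin N) → EuclideanSpace ℝ (Fin N)), IsH1WithGradient v V →
      Integrable (fun x => f (u x) * v x) volume ∧
      ∫ x, inner ℝ (G x) (V x) = lam * (∫ x, u x * v x) + ∫ x, f (u x) * v x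

/-- The critical Sobolev exponent `2^* = 2N / (N - 2)`, used for `N ≥ 3`. -/
noncomputable def criticalExponent (N : ℕ) : ℝ := 2 * (N : ℝ) / ((N : ℝ) - 2)

/-- The nonlinearity `f(t) = μ |t|^{q-2} t + |t|^{2^*-2} t`. -/
noncomputable def nonlinearity (N : ℕ) (μ q : ℝ) (t : ℝ) : ℝ :=
  μ * |t| ^ (q - 2) * t + |t| ^ (criticalExponent N - 2) * t

/-!
A normalized solution is found by direct minimization. Write `p = 2^*`, `β = N (q - 2) / 2`, so that
the mass-preserving dilation `u_t = t^{N/2} u(t ·)` multiplies `‖∇u‖²`, `‖u‖_q^q` and `‖u‖_p^p` by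
`t²`, `t^β` and `t^p`, where `2 < β < q` because `q` is mass-supercritical and Sobolev-subcritical.
Let `E` be the energy, `P` (`pohozaev`) its derivative along dilations, and `J = E - P / 2`
(`reducedEnergy`), a positive combination of `‖u‖_q^q` and `‖u‖_p^p`. The functional `J` is minimized
over nonzero `u` with `‖u‖_2 ≤ a` and `P(u) ≤ 0`.

*Existence* (`exists_minimizer`). For large `μ` the infimum `m` of `J` is below a level that depends
only on `N`; there the Sobolev inequality shows that the critical term alone cannot balance the
gradient, so `‖u_n‖_q` stays away from zero along a minimizing sequence (`exists_le_integral_rpow`).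
By Lions' vanishing lemma (`exists_integral_rpow_le_of_local_mass_le`) and Rellich's theorem, suitable
translates converge weakly and almost everywhere to some `u ≠ 0`. The Brezis-Lieb lemma splits `J`,
`P` and the mass between `u` and `u_n - u`. If `P(u) ≤ 0` then `u` is a minimizer, since `J ≥ 0`. If
`P(u) > 0` then `P(u_n - u) < 0`, so `J(u_n - u) ≥ m` and `J(u) ≤ 0`, which is absurd. No strong
convergence is needed, and the sharp Sobolev constant plays no role.

*Euler-Lagrange equation* (`firstVariation_eq`). A minimizer has `P(u) = 0`, as a dilation lowers `J`
when `P(u) < 0`. For a perturbation `u + s v` of admissible mass, some `t` near `1` makes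
`P((u + s v)_t) = 0`, so `E((u + s v)_t) ≥ E(u) ≥ E(u_t)`, the last step because `t ↦ E(u_t)` is
maximal at `1`. Dividing by `s` gives `E'(u) v ≥ 0`. Together with
`E'(u) u = μ (β / q - 1) ‖u‖_q^q < 0`, this shows that the mass constraint is active and that the
Lagrange multiplier is `E'(u) u / a² < 0`.
-/

open Filter Topology

section

variable {N : ℕ} {u v : EuclideanSpace ℝ (Fin N) → ℝ}
  {G V : EuclideanSpace ℝ (Fin N) → EuclideanSpace ℝ (Fin N)}

local notation "𝔼" => EuclideanSpace ℝ (Fin N)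

/-! ### Operations on `H¹` functions -/

theorem IsH1WithGradient.of_memLp (hu : MemLp u 2 volume) (hG : MemLp G 2 volume)
    (h : ∀ φ : 𝔼 → ℝ, ContDiff ℝ ∞ φ → HasCompactSupport φ → ∀ w : 𝔼,
      ∫ x, u x * fderiv ℝ φ x w = - ∫ x, φ x * inner ℝ (G x) w) :
    IsH1WithGradient u G :=
  ⟨hu, hG, hu.locallyIntegrable (by norm_num), hG.locallyIntegrable (by norm_num), h⟩

theorem memLp_two_fderiv_apply {φ : 𝔼 → ℝ} (hφ : ContDiff ℝ ∞ φ) (hc : HasCompactSupport φ)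
    (w : 𝔼) : MemLp (fun x => fderiv ℝ φ x w) 2 volume := by
  have h1 : Continuous (fun x => fderiv ℝ φ x w) :=
    (hφ.continuous_fderiv (by simp)).clm_apply continuous_const
  exact h1.memLp_of_hasCompactSupport (hc.fderiv_apply (𝕜 := ℝ) w)

theorem integrable_mul_fderiv_apply (hu : MemLp u 2 volume) {φ : 𝔼 → ℝ} (hφ : ContDiff ℝ ∞ φ)
    (hc : HasCompactSupport φ) (w : 𝔼) : Integrable (fun x => u x * fderiv ℝ φ x w) :=
  hu.integrable_mul (memLp_two_fderiv_apply hφ hc w)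

theorem integrable_mul_inner (hG : MemLp G 2 volume) {φ : 𝔼 → ℝ} (hφ : ContDiff ℝ ∞ φ)
    (hc : HasCompactSupport φ) (w : 𝔼) : Integrable (fun x => φ x * inner ℝ (G x) w) :=
  (hφ.continuous.memLp_of_hasCompactSupport hc : MemLp φ 2 volume).integrable_mul
    (hG.inner_const w)

theorem IsH1WithGradient.add (hu : IsH1WithGradient u G) (hv : IsH1WithGradient v V) :
    IsH1WithGradient (fun x => u x + v x) (fun x => G x + V x) := by
  refine .of_memLp (hu.memLp.add hv.memLp) (hu.memLp_gradient.add hv.memLp_gradient) ?_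
  intro φ hφ hc w
  simp only [add_mul, inner_add_left, mul_add]
  rw [integral_add (integrable_mul_fderiv_apply hu.memLp hφ hc w)
    (integrable_mul_fderiv_apply hv.memLp hφ hc w),
    integral_add (integrable_mul_inner hu.memLp_gradient hφ hc w)
    (integrable_mul_inner hv.memLp_gradient hφ hc w), hu.hasWeakGradient.integral_eq φ hφ hc w,
    hv.hasWeakGradient.integral_eq φ hφ hc w]
  ring

theorem IsH1WithGradient.const_mul (hu : IsH1WithGradient u G) (c : ℝ) :
    IsH1WithGradient (fun x => c * u x) (fun x => c • G x) := by
  refine .of_memLp (hu.memLp.const_mul c) (hu.memLp_gradient.const_smul c) ?_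
  intro φ hφ hc w
  simp only [mul_assoc, real_inner_smul_left, mul_left_comm _ c, integral_const_mul,
    hu.hasWeakGradient.integral_eq φ hφ hc w, mul_neg]

theorem IsH1WithGradient.sub (hu : IsH1WithGradient u G) (hv : IsH1WithGradient v V) :
    IsH1WithGradient (fun x => u x - v x) (fun x => G x - V x) := by
  simpa [sub_eq_add_neg] using hu.add (hv.const_mul (-1))

theorem IsH1WithGradient.comp_add_right (hu : IsH1WithGradient u G) (y : 𝔼) :
    IsH1WithGradient (fun x => u (x + y)) (fun x => G (x + y)) := by
  have hmp : MeasurePreserving (fun x : 𝔼 => x + y) volume volume :=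
    measurePreserving_add_right volume y
  refine .of_memLp (hu.memLp.comp_measurePreserving hmp)
    (hu.memLp_gradient.comp_measurePreserving hmp) ?_
  intro φ hφ hc w
  have hψ : ContDiff ℝ ∞ (fun x => φ (x - y)) := hφ.comp (contDiff_id.sub contDiff_const)
  have hψc : HasCompactSupport (fun x => φ (x - y)) :=
    hc.comp_homeomorph (Homeomorph.subRight y)
  have h := hu.hasWeakGradient.integral_eq _ hψ hψc w
  rw [← integral_add_right_eq_self _ y, ← integral_add_right_eq_self (fun x => φ (x - y) * _) y]
    at h
  simpa [fderiv_comp_sub] using h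

theorem memLp_two_comp_smul {F : Type*} [NormedAddCommGroup F] {f : 𝔼 → F}
    (hf : MemLp f 2 volume) {t : ℝ} (ht : 0 < t) : MemLp (fun x => f (t • x)) 2 volume := by
  have hm : AEStronglyMeasurable (fun x => f (t • x)) volume := hf.1.comp_quasiMeasurePreserving
    (Measure.quasiMeasurePreserving_smul (volume : Measure 𝔼) ht.ne')
  rw [memLp_two_iff_integrable_sq_norm hm]
  exact ((memLp_two_iff_integrable_sq_norm hf.1).1 hf).comp_smul ht.ne'

theorem IsH1WithGradient.comp_smul (hu : IsH1WithGradient u G) {t : ℝ} (ht : 0 < t) :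
    IsH1WithGradient (fun x => u (t • x)) (fun x => t • G (t • x)) := by
  refine .of_memLp (memLp_two_comp_smul hu.memLp ht)
    ((memLp_two_comp_smul hu.memLp_gradient ht).const_smul t) ?_
  intro φ hφ hc w
  have hψ : ContDiff ℝ ∞ (fun x : 𝔼 => φ (t⁻¹ • x)) := hφ.comp (contDiff_const_smul _)
  have hψc : HasCompactSupport (fun x : 𝔼 => φ (t⁻¹ • x)) :=
    hc.comp_smul (inv_ne_zero ht.ne')
  have h := hu.hasWeakGradient.integral_eq _ hψ hψc w
  have e1 := Measure.integral_comp_smul (volume : Measure 𝔼)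
    (fun x => u x * fderiv ℝ (fun x : 𝔼 => φ (t⁻¹ • x)) x w) t
  have e2 := Measure.integral_comp_smul (volume : Measure 𝔼)
    (fun x => φ (t⁻¹ • x) * inner ℝ (G x) w) t
  rw [h, smul_neg, ← e2] at e1
  have e3 : ∀ x : 𝔼, fderiv ℝ (fun x : 𝔼 => φ (t⁻¹ • x)) (t • x) w
      = t⁻¹ * fderiv ℝ φ x w := by
    intro x
    have := fderiv_comp_smul (𝕜 := ℝ) (f := φ) (c := t⁻¹) (x := t • x)
    rw [this]
    simp [smul_smul, ht.ne']
  simp only [e3, smul_smul, inv_mul_cancel₀ ht.ne', one_smul] at e1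
  simp only [real_inner_smul_left, mul_left_comm _ t, integral_const_mul]
  simp only [mul_left_comm _ t⁻¹, integral_const_mul] at e1
  have := congrArg (t * ·) e1
  simp only [← mul_assoc, mul_inv_cancel₀ ht.ne', one_mul] at this
  rw [this]; ring

/-- Product rule: multiplication by a smooth bounded function with bounded gradient `g`
preserves `H¹`. -/
theorem IsH1WithGradient.mul_contDiff (hu : IsH1WithGradient u G) {χ : 𝔼 → ℝ} {g : 𝔼 → 𝔼}
    (hχ : ContDiff ℝ ∞ χ) (hg : ∀ x w, fderiv ℝ χ x w = inner ℝ (g x) w) (hgc : Continuous g)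
    {C : ℝ} (hC : ∀ x, |χ x| ≤ C) (hC' : ∀ x, ‖g x‖ ≤ C) :
    IsH1WithGradient (fun x => χ x * u x) (fun x => χ x • G x + u x • g x) := by
  have h1 : MemLp (fun x => χ x * u x) 2 volume := by
    refine MemLp.of_le_mul (c := C) hu.memLp
      (hχ.continuous.aestronglyMeasurable.mul hu.memLp.1) (.of_forall fun x => ?_)
    rw [norm_mul]; exact mul_le_mul_of_nonneg_right (hC x) (norm_nonneg _)
  have h2 : MemLp (fun x => χ x • G x) 2 volume := by
    refine MemLp.of_le_mul (c := C) hu.memLp_gradient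
      (hχ.continuous.aestronglyMeasurable.smul hu.memLp_gradient.1) (.of_forall fun x => ?_)
    rw [norm_smul]; exact mul_le_mul_of_nonneg_right (hC x) (norm_nonneg _)
  have h3 : MemLp (fun x => u x • g x) 2 volume := by
    refine MemLp.of_le_mul (c := C) hu.memLp
      (hu.memLp.1.smul hgc.aestronglyMeasurable) (.of_forall fun x => ?_)
    rw [norm_smul, mul_comm]; exact mul_le_mul_of_nonneg_right (hC' x) (norm_nonneg _)
  refine .of_memLp h1 (h2.add h3) ?_
  intro φ hφ hc w
  have hψ : ContDiff ℝ ∞ (fun x => χ x * φ x) := hχ.mul hφ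
  have hψc : HasCompactSupport (fun x => χ x * φ x) := hc.mul_left
  have h := hu.hasWeakGradient.integral_eq _ hψ hψc w
  have e : ∀ x, fderiv ℝ (fun x => χ x * φ x) x w
      = χ x * fderiv ℝ φ x w + φ x * inner ℝ (g x) w := by
    intro x
    rw [fderiv_fun_mul (hχ.differentiable (by simp) x) (hφ.differentiable (by simp) x)]
    simp [hg]
  have i1 : Integrable (fun x => χ x * u x * fderiv ℝ φ x w) :=
    integrable_mul_fderiv_apply h1 hφ hc w
  have i2 : Integrable (fun x => φ x * inner ℝ (u x • g x) w) :=
    integrable_mul_inner h3 hφ hc w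
  have i3 : Integrable (fun x => φ x * inner ℝ (χ x • G x) w) :=
    integrable_mul_inner h2 hφ hc w
  simp only [inner_add_left, mul_add]
  rw [integral_add i3 i2]
  have e4 : ∫ x, u x * fderiv ℝ (fun x => χ x * φ x) x w
      = (∫ x, χ x * u x * fderiv ℝ φ x w) + ∫ x, φ x * inner ℝ (u x • g x) w := by
    rw [← integral_add i1 i2]
    congr 1; ext x
    rw [e, real_inner_smul_left]; ring
  have e5 : ∫ x, χ x * φ x * inner ℝ (G x) w = ∫ x, φ x * inner ℝ (χ x • G x) w := by
    congr 1; ext x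
    rw [real_inner_smul_left]; ring
  rw [e4, e5] at h
  linarith

/-! ### Mollification and translation estimates -/

theorem eLpNorm_two_pow_two {α F : Type*} [MeasurableSpace α] {μ : Measure α}
    [NormedAddCommGroup F] (f : α → F) : eLpNorm f 2 μ ^ 2 = ∫⁻ x, ‖f x‖ₑ ^ 2 ∂μ := by
  have := eLpNorm_nnreal_pow_eq_lintegral (f := f) (μ := μ) (p := 2) (by norm_num)
  simpa using this

/-- Jensen's inequality for the square followed by Tonelli: an average over a probability
measure of a family of functions has `L²` norm at most the quadratic mean of the `L²` norms. -/
theorem lintegral_enorm_integral_sq_le {α β F : Type*} [MeasurableSpace α] [MeasurableSpace β]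
    [NormedAddCommGroup F] [NormedSpace ℝ F] {μ : Measure α} [SFinite μ] {κ : Measure β}
    [IsProbabilityMeasure κ] {f : α → β → F}
    (hf : AEStronglyMeasurable (fun z : α × β => f z.1 z.2) (μ.prod κ)) :
    ∫⁻ x, ‖∫ y, f x y ∂κ‖ₑ ^ 2 ∂μ ≤ ∫⁻ y, ∫⁻ x, ‖f x y‖ₑ ^ 2 ∂μ ∂κ := by
  rw [← lintegral_lintegral_swap (hf.enorm.pow_const 2)]
  refine lintegral_mono_ae ?_
  filter_upwards [hf.prodMk_left] with x hx
  calc ‖∫ y, f x y ∂κ‖ₑ ^ 2 ≤ (∫⁻ y, ‖f x y‖ₑ ∂κ) ^ 2 := by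
        gcongr; exact enorm_integral_le_lintegral_enorm _
    _ = eLpNorm (f x) 1 κ ^ 2 := by rw [eLpNorm_one_eq_lintegral_enorm]
    _ ≤ eLpNorm (f x) 2 κ ^ 2 := by
        gcongr; exact eLpNorm_le_eLpNorm_of_exponent_le (by norm_num) hx
    _ = _ := eLpNorm_two_pow_two _

/-- The probability measure with density a normalized bump function; convolution with the bump
function is averaging of translates against it. -/
noncomputable def ContDiffBump.measure (ρ : ContDiffBump (0 : EuclideanSpace ℝ (Fin N))) :
    Measure 𝔼 :=
  volume.withDensity fun t => ENNReal.ofReal (ρ.normed volume t)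

theorem ContDiffBump.measurable_ofReal_normed (ρ : ContDiffBump (0 : 𝔼)) :
    Measurable fun t => ENNReal.ofReal (ρ.normed volume t) :=
  (ρ.continuous_normed (μ := volume)).measurable.ennreal_ofReal

instance (ρ : ContDiffBump (0 : EuclideanSpace ℝ (Fin N))) : IsProbabilityMeasure ρ.measure := by
  constructor
  rw [ContDiffBump.measure, withDensity_apply _ MeasurableSet.univ, Measure.restrict_univ,
    ← ofReal_integral_eq_lintegral_ofReal ρ.integrable_normed
    (.of_forall fun x => ρ.nonneg_normed x), ρ.integral_normed, ENNReal.ofReal_one]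

theorem ContDiffBump.integral_measure {F : Type*} [NormedAddCommGroup F] [NormedSpace ℝ F]
    (ρ : ContDiffBump (0 : 𝔼)) (f : 𝔼 → F) :
    ∫ t, f t ∂ρ.measure = ∫ t, ρ.normed volume t • f t := by
  rw [ContDiffBump.measure, integral_withDensity_eq_integral_toReal_smul
    ρ.measurable_ofReal_normed (by simp)]
  simp [ENNReal.toReal_ofReal (ρ.nonneg_normed _)]

theorem ContDiffBump.ae_norm_le (ρ : ContDiffBump (0 : 𝔼)) : ∀ᵐ t ∂ρ.measure, ‖t‖ ≤ ρ.rOut := by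
  rw [ContDiffBump.measure, ae_withDensity_iff ρ.measurable_ofReal_normed]
  refine .of_forall fun t ht => ?_
  have : t ∈ Function.support (ρ.normed volume) := by
    intro h; simp [h] at ht
  rw [ρ.support_normed_eq] at this
  simpa using (mem_ball_zero_iff.1 this).le

/-- Convolution of `g` with the normalized bump function `ρ`. -/
noncomputable def mollify {F : Type*} [NormedAddCommGroup F] [NormedSpace ℝ F]
    (ρ : ContDiffBump (0 : EuclideanSpace ℝ (Fin N))) (g : EuclideanSpace ℝ (Fin N) → F) :
    EuclideanSpace ℝ (Fin N) → F :=
  convolution (ρ.normed volume) g (ContinuousLinearMap.lsmul ℝ ℝ) volume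

theorem aestronglyMeasurable_comp_sub {F : Type*} [TopologicalSpace F] {g : 𝔼 → F}
    (hg : AEStronglyMeasurable g volume)
    (κ : Measure 𝔼) [SFinite κ] :
    AEStronglyMeasurable (fun z : 𝔼 × 𝔼 => g (z.1 - z.2)) (volume.prod κ) :=
  hg.comp_quasiMeasurePreserving (quasiMeasurePreserving_sub volume κ)

section
variable {F : Type*} [NormedAddCommGroup F] [NormedSpace ℝ F]

theorem mollify_eq_integral (ρ : ContDiffBump (0 : 𝔼)) (g : 𝔼 → F) (x : 𝔼) :
    mollify ρ g x = ∫ t, g (x - t) ∂ρ.measure := by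
  rw [ρ.integral_measure]; rfl

theorem lintegral_mollify_sq_le (ρ : ContDiffBump (0 : 𝔼)) {g : 𝔼 → F}
    (hg : AEStronglyMeasurable g volume) :
    ∫⁻ x, ‖mollify ρ g x‖ₑ ^ 2 ≤ ∫⁻ x, ‖g x‖ₑ ^ 2 := by
  simp only [mollify_eq_integral]
  refine (lintegral_enorm_integral_sq_le (aestronglyMeasurable_comp_sub hg ρ.measure)).trans ?_
  simp only [lintegral_sub_right_eq_self (fun x => ‖g x‖ₑ ^ 2)]
  simp

theorem eLpNorm_mollify_le (ρ : ContDiffBump (0 : 𝔼)) {g : 𝔼 → F}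
    (hg : AEStronglyMeasurable g volume) : eLpNorm (mollify ρ g) 2 volume ≤ eLpNorm g 2 volume := by
  have := lintegral_mollify_sq_le ρ hg
  rw [← eLpNorm_two_pow_two, ← eLpNorm_two_pow_two] at this
  exact (ENNReal.pow_le_pow_left_iff two_ne_zero).1 this

theorem contDiff_mollify (ρ : ContDiffBump (0 : 𝔼)) {g : 𝔼 → F} (hg : LocallyIntegrable g volume) :
    ContDiff ℝ ∞ (mollify ρ g) :=
  ρ.hasCompactSupport_normed.contDiff_convolution_left _ ρ.contDiff_normed hg

end

/-- Mollification commutes with the weak gradient. -/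
theorem HasWeakGradient.hasFDerivAt_mollify (hu : HasWeakGradient u G)
    (ρ : ContDiffBump (0 : 𝔼)) (x : 𝔼) :
    HasFDerivAt (mollify ρ u) (innerSL ℝ (mollify ρ G x)) x := by
  have h := ρ.hasCompactSupport_normed.hasFDerivAt_convolution_left
    (ContinuousLinearMap.lsmul ℝ ℝ) (ρ.contDiff_normed (μ := volume) (n := 1))
    hu.locallyIntegrable x
  refine h.congr_fderiv ?_
  ext w
  have hρ : ContDiff ℝ ∞ (ρ.normed (volume : Measure 𝔼)) := ρ.contDiff_normed
  have hρ' : ContDiff ℝ ∞ (fun y => ρ.normed volume (x - y)) :=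
    hρ.comp (contDiff_const.sub contDiff_id)
  have hc : HasCompactSupport (fun y => ρ.normed volume (x - y)) :=
    ρ.hasCompactSupport_normed.comp_homeomorph (Homeomorph.subLeft x)
  have key := hu.integral_eq _ hρ' hc w
  have e : ∀ y, fderiv ℝ (fun y => ρ.normed volume (x - y)) y w
      = - fderiv ℝ (ρ.normed volume) (x - y) w := by
    intro y
    have h1 : HasFDerivAt (fun y : 𝔼 => x - y) (-ContinuousLinearMap.id ℝ 𝔼) y := by
      simpa using (hasFDerivAt_id y).const_sub x
    have h2 := (hρ.differentiable (by simp) (x - y)).hasFDerivAt.comp y h1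
    have h3 : fderiv ℝ (fun y => ρ.normed volume (x - y)) y = _ := h2.fderiv
    rw [h3]; simp
  simp only [e, mul_neg, integral_neg, neg_inj] at key
  have i1 : ConvolutionExistsAt (fderiv ℝ (ρ.normed volume)) u x
      ((ContinuousLinearMap.lsmul ℝ ℝ).precompL 𝔼) volume :=
    (ρ.hasCompactSupport_normed.fderiv ℝ).convolutionExists_left _
      (hρ.continuous_fderiv (by simp)) hu.locallyIntegrable x
  have i2 : ConvolutionExistsAt (ρ.normed volume) G x (ContinuousLinearMap.lsmul ℝ ℝ) volume :=
    ρ.hasCompactSupport_normed.convolutionExists_left _ hρ.continuous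
      hu.locallyIntegrable_gradient x
  rw [convolution_def, ContinuousLinearMap.integral_apply i1, mollify, convolution_def,
    innerSL_apply_apply, real_inner_comm, ← integral_inner i2]
  have e1 := integral_sub_left_eq_self (fun y => u y * fderiv ℝ (ρ.normed volume) (x - y) w)
    volume x
  have e2 := integral_sub_left_eq_self (fun y => ρ.normed volume (x - y) * inner ℝ (G y) w)
    volume x
  simp only [sub_sub_cancel] at e1 e2
  rw [← e1, ← e2] at key
  refine Eq.trans ?_ (key.trans ?_)
  · congr 1; ext t; simp [ContinuousLinearMap.precompL_apply, mul_comm]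
  · congr 1; ext t; simp [real_inner_smul_right, real_inner_comm]

/-- A sequence of bump functions with supports shrinking to the origin. -/
noncomputable def bumpSeq (N n : ℕ) : ContDiffBump (0 : EuclideanSpace ℝ (Fin N)) where
  rIn := 1 / ((n : ℝ) + 1)
  rOut := 2 / ((n : ℝ) + 1)
  rIn_pos := by positivity
  rIn_lt_rOut := by gcongr; norm_num

theorem tendsto_bumpSeq_rOut : Tendsto (fun n => (bumpSeq N n).rOut) atTop (𝓝 0) := by
  have := (tendsto_one_div_add_atTop_nhds_zero_nat (𝕜 := ℝ)).const_mul 2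
  simpa [bumpSeq, div_eq_mul_inv] using this

theorem ae_tendsto_mollify {F : Type*} [NormedAddCommGroup F] [NormedSpace ℝ F] [CompleteSpace F]
    {g : 𝔼 → F} (hg : LocallyIntegrable g volume) :
    ∀ᵐ x, Tendsto (fun n => mollify (bumpSeq N n) g x) atTop (𝓝 (g x)) :=
  ContDiffBump.ae_convolution_tendsto_right_of_locallyIntegrable (K := 2) tendsto_bumpSeq_rOut
    (.of_forall fun n => by simp only [bumpSeq]; apply le_of_eq; ring) hg

/-- Fatou's lemma in the form of a bound that passes to an almost everywhere limit. -/
theorem lintegral_le_of_ae_tendsto {α : Type*} [MeasurableSpace α] {μ : Measure α}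
    {f : ℕ → α → ENNReal} {g : α → ENNReal} (hf : ∀ n, AEMeasurable (f n) μ)
    (hg : ∀ᵐ x ∂μ, Tendsto (fun n => f n x) atTop (𝓝 (g x))) {C : ENNReal}
    (hC : ∀ n, ∫⁻ x, f n x ∂μ ≤ C) : ∫⁻ x, g x ∂μ ≤ C := by
  calc ∫⁻ x, g x ∂μ = ∫⁻ x, liminf (fun n => f n x) atTop ∂μ :=
        lintegral_congr_ae (hg.mono fun x hx => hx.liminf_eq.symm)
    _ ≤ liminf (fun n => ∫⁻ x, f n x ∂μ) atTop := lintegral_liminf_le' hf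
    _ ≤ C := liminf_le_of_le (by isBoundedDefault) fun b hb => by
        obtain ⟨n, hn⟩ := hb.exists
        exact hn.trans (hC n)

/-- The `L²` modulus of continuity of an `H¹` function is controlled by its gradient. -/
theorem IsH1WithGradient.lintegral_sub_comp_sub_sq_le (hu : IsH1WithGradient u G) (h : 𝔼) :
    ∫⁻ x, ‖u x - u (x - h)‖ₑ ^ 2 ≤ ‖h‖ₑ ^ 2 * ∫⁻ x, ‖G x‖ₑ ^ 2 := by
  have hl := hu.hasWeakGradient.locallyIntegrable
  have hmp : MeasurePreserving (fun x : 𝔼 => x - h) volume volume :=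
    measurePreserving_sub_right volume h
  have hae := ae_tendsto_mollify hl
  refine lintegral_le_of_ae_tendsto
    (f := fun n x => ‖mollify (bumpSeq N n) u x - mollify (bumpSeq N n) u (x - h)‖ₑ ^ 2) ?_ ?_ ?_
  · intro n
    have hc : Continuous (mollify (bumpSeq N n) u) := (contDiff_mollify _ hl).continuous
    have : Continuous fun x =>
      mollify (bumpSeq N n) u x - mollify (bumpSeq N n) u (x - h) := by fun_prop
    exact this.measurable.enorm.pow_const 2 |>.aemeasurable
  · filter_upwards [hae, hmp.quasiMeasurePreserving.ae hae] with x h1 h2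
    exact ((ENNReal.continuous_pow 2).tendsto _).comp ((h1.sub h2).enorm)
  · intro n
    set ρ := bumpSeq N n
    have hGc : Continuous (mollify ρ G) :=
      (contDiff_mollify _ hu.hasWeakGradient.locallyIntegrable_gradient).continuous
    -- the increment is the mean of the directional derivative along the segment
    have e : ∀ x, mollify ρ u x - mollify ρ u (x - h)
        = ∫ s, inner ℝ (mollify ρ G (x - s • h)) h ∂(volume.restrict (Set.Ioc (0 : ℝ) 1)) := by
      intro x
      have hd : ∀ s ∈ Set.uIcc (0 : ℝ) 1, HasDerivAt (fun s : ℝ => -mollify ρ u (x - s • h))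
          (inner ℝ (mollify ρ G (x - s • h)) h) s := by
        intro s _
        have h1 : HasDerivAt (fun s : ℝ => x - s • h) (-h) s := by
          simpa using ((hasDerivAt_id s).smul_const h).const_sub x
        have h2 := ((hu.hasWeakGradient.hasFDerivAt_mollify ρ (x - s • h)).comp_hasDerivAt s h1).neg
        exact h2.congr_deriv (by simp)
      have hcont : Continuous fun s : ℝ => inner ℝ (mollify ρ G (x - s • h)) h := by fun_prop
      have := intervalIntegral.integral_eq_sub_of_hasDerivAt hd (hcont.intervalIntegrable 0 1)
      rw [intervalIntegral.integral_of_le zero_le_one] at this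
      rw [this]; simp [sub_eq_add_neg, add_comm]
    have : IsProbabilityMeasure (volume.restrict (Set.Ioc (0 : ℝ) 1)) := ⟨by simp⟩
    simp only [e]
    have hcont : Continuous fun z : 𝔼 × ℝ => inner ℝ (mollify ρ G (z.1 - z.2 • h)) h := by fun_prop
    refine (lintegral_enorm_integral_sq_le hcont.aestronglyMeasurable).trans ?_
    calc ∫⁻ s, (∫⁻ x, ‖inner ℝ (mollify ρ G (x - s • h)) h‖ₑ ^ 2)
          ∂(volume.restrict (Set.Ioc (0 : ℝ) 1))
        ≤ ∫⁻ _s : ℝ, (‖h‖ₑ ^ 2 * ∫⁻ x, ‖G x‖ₑ ^ 2) ∂(volume.restrict (Set.Ioc (0 : ℝ) 1)) := by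
          refine lintegral_mono fun s => ?_
          calc ∫⁻ x, ‖inner ℝ (mollify ρ G (x - s • h)) h‖ₑ ^ 2
              ≤ ∫⁻ x, ‖h‖ₑ ^ 2 * ‖mollify ρ G (x - s • h)‖ₑ ^ 2 := by
                refine lintegral_mono fun x => ?_
                rw [← mul_pow]
                gcongr
                rw [mul_comm]
                simp only [enorm_eq_nnnorm]
                exact_mod_cast nnnorm_inner_le_nnnorm _ _
            _ = ‖h‖ₑ ^ 2 * ∫⁻ x, ‖mollify ρ G x‖ₑ ^ 2 := by
                rw [lintegral_const_mul' _ _ (by simp),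
                  lintegral_sub_right_eq_self (fun x => ‖mollify ρ G x‖ₑ ^ 2)]
            _ ≤ _ := by
                exact mul_le_mul' le_rfl (lintegral_mollify_sq_le ρ hu.memLp_gradient.1)
      _ = _ := by simp

/-- Quantitative `L²` approximation of an `H¹` function by its mollification. -/
theorem IsH1WithGradient.lintegral_sub_mollify_sq_le (hu : IsH1WithGradient u G)
    (ρ : ContDiffBump (0 : 𝔼)) :
    ∫⁻ x, ‖u x - mollify ρ u x‖ₑ ^ 2 ≤ ENNReal.ofReal ρ.rOut ^ 2 * ∫⁻ x, ‖G x‖ₑ ^ 2 := by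
  have hint : ∀ x, Integrable (fun t => u (x - t)) ρ.measure := by
    intro x
    have i2 : ConvolutionExistsAt (ρ.normed volume) u x (ContinuousLinearMap.lsmul ℝ ℝ) volume :=
      ρ.hasCompactSupport_normed.convolutionExists_left _ ρ.continuous_normed
        hu.hasWeakGradient.locallyIntegrable x
    rw [ContDiffBump.measure, integrable_withDensity_iff_integrable_smul'
      ρ.measurable_ofReal_normed (by simp)]
    simp only [ENNReal.toReal_ofReal (ρ.nonneg_normed _)]
    exact i2
  have e : ∀ x, u x - mollify ρ u x = ∫ t, (u x - u (x - t)) ∂ρ.measure := by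
    intro x
    rw [integral_sub (integrable_const _) (hint x), mollify_eq_integral]
    simp
  simp only [e]
  have hm : AEStronglyMeasurable (fun z : 𝔼 × 𝔼 => u z.1 - u (z.1 - z.2))
      (volume.prod ρ.measure) :=
    hu.memLp.1.comp_fst.sub (aestronglyMeasurable_comp_sub hu.memLp.1 _)
  refine (lintegral_enorm_integral_sq_le hm).trans ?_
  calc ∫⁻ t, (∫⁻ x, ‖u x - u (x - t)‖ₑ ^ 2) ∂ρ.measure
      ≤ ∫⁻ _t : 𝔼, (ENNReal.ofReal ρ.rOut ^ 2 * ∫⁻ x, ‖G x‖ₑ ^ 2) ∂ρ.measure := by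
        refine lintegral_mono_ae ?_
        filter_upwards [ρ.ae_norm_le] with t ht
        refine (hu.lintegral_sub_comp_sub_sq_le t).trans ?_
        gcongr
        rw [← ofReal_norm]
        exact ENNReal.ofReal_le_ofReal ht
    _ = _ := by simp

/-! ### The Sobolev inequality on `H¹` -/

theorem two_lt_criticalExponent (hN : 3 ≤ N) : 2 < criticalExponent N := by
  have h : (3 : ℝ) ≤ N := by exact_mod_cast hN
  rw [criticalExponent, lt_div_iff₀ (by linarith)]
  linarith

theorem eLpNorm_le_of_ae_tendsto {F : Type*} [NormedAddCommGroup F] {α : Type*}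
    [MeasurableSpace α] {μ : Measure α} {p : ENNReal} {f : ℕ → α → F} {g : α → F}
    (hf : ∀ n, AEStronglyMeasurable (f n) μ)
    (hg : ∀ᵐ x ∂μ, Tendsto (fun n => f n x) atTop (𝓝 (g x))) {c : ℕ → ENNReal} {C : ENNReal}
    (hc : ∀ n, eLpNorm (f n) p μ ≤ c n) (hC : Tendsto c atTop (𝓝 C)) : eLpNorm g p μ ≤ C :=
  (Lp.eLpNorm_lim_le_liminf_eLpNorm hf g hg).trans
    ((liminf_le_liminf (.of_forall hc)).trans hC.liminf_eq.le)

/-- The exponent `2^*` as a nonnegative real. -/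
noncomputable def criticalExponentNNReal (N : ℕ) : NNReal := (criticalExponent N).toNNReal

theorem coe_criticalExponentNNReal (hN : 3 ≤ N) :
    (criticalExponentNNReal N : ℝ) = criticalExponent N :=
  Real.coe_toNNReal _ (by linarith [two_lt_criticalExponent hN])

/-- The constant of the Gagliardo-Nirenberg-Sobolev inequality for test functions. -/
noncomputable def sobolevConst (N : ℕ) : NNReal :=
  SNormLESNormFDerivOfEqConst ℝ (volume : Measure (EuclideanSpace ℝ (Fin N))) 2

theorem IsH1WithGradient.eLpNorm_le_of_hasCompactSupport (hN : 3 ≤ N)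
    (hu : IsH1WithGradient u G) (hc : HasCompactSupport u) :
    eLpNorm u (criticalExponentNNReal N) volume ≤ sobolevConst N * eLpNorm G 2 volume := by
  have hl := hu.hasWeakGradient.locallyIntegrable
  refine eLpNorm_le_of_ae_tendsto (f := fun n => mollify (bumpSeq N n) u)
    (fun n => (contDiff_mollify _ hl).continuous.aestronglyMeasurable) (ae_tendsto_mollify hl)
    (c := fun _ => sobolevConst N * eLpNorm G 2 volume) (fun n => ?_) tendsto_const_nhds
  have h1 := eLpNorm_le_eLpNorm_fderiv_of_eq (volume : Measure 𝔼)
    (u := mollify (bumpSeq N n) u) ((contDiff_mollify _ hl).of_le (by simp))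
    ((bumpSeq N n).hasCompactSupport_normed.convolution _ hc) (p := 2)
    (p' := criticalExponentNNReal N) (by norm_num) (by simp; omega) (by
      rw [coe_criticalExponentNNReal hN, criticalExponent]
      have h : (3 : ℝ) ≤ N := by exact_mod_cast hN
      have : (N : ℝ) - 2 ≠ 0 := by linarith
      simp
      field_simp)
  refine h1.trans ?_
  gcongr
  · exact le_rfl
  · refine le_trans (le_of_eq ?_) (eLpNorm_mollify_le (bumpSeq N n) hu.memLp_gradient.1)
    refine eLpNorm_congr_norm_ae (.of_forall fun x => ?_)
    rw [(hu.hasWeakGradient.hasFDerivAt_mollify _ x).fderiv, innerSL_apply_norm]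

theorem inner_toDual_symm_fderiv (χ : 𝔼 → ℝ) (x w : 𝔼) :
    fderiv ℝ χ x w = inner ℝ ((InnerProductSpace.toDual ℝ 𝔼).symm (fderiv ℝ χ x)) w :=
  InnerProductSpace.toDual_symm_apply.symm

theorem exists_forall_norm_fderiv_bump_le (N : ℕ) :
    ∃ (χ : EuclideanSpace ℝ (Fin N) → ℝ) (C : ℝ), ContDiff ℝ ∞ χ ∧ HasCompactSupport χ ∧
      (∀ x, ‖x‖ ≤ 1 → χ x = 1) ∧ (∀ x, |χ x| ≤ 1) ∧ 0 ≤ C ∧ ∀ x, ‖fderiv ℝ χ x‖ ≤ C := by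
  let b : ContDiffBump (0 : EuclideanSpace ℝ (Fin N)) := ⟨1, 2, one_pos, one_lt_two⟩
  obtain ⟨C, hC⟩ := (b.hasCompactSupport.fderiv ℝ).exists_bound_of_continuous
    (b.contDiff.continuous_fderiv (n := 1) (by simp))
  refine ⟨b, C, b.contDiff, b.hasCompactSupport, fun x hx => b.one_of_mem_closedBall (by simpa),
    fun x => ?_, (norm_nonneg _).trans (hC 0), hC⟩
  rw [abs_of_nonneg b.nonneg]; exact b.le_one

theorem IsH1WithGradient.eLpNorm_le (hN : 3 ≤ N) (hu : IsH1WithGradient u G) :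
    eLpNorm u (criticalExponentNNReal N) volume ≤ sobolevConst N * eLpNorm G 2 volume := by
  obtain ⟨χ, C, hχ, hχc, hχ1, hχb, hC0, hC⟩ := exists_forall_norm_fderiv_bump_le N
  let s : ℕ → ℝ := fun n => 1 / ((n : ℝ) + 1)
  have hs : Tendsto s atTop (𝓝 0) := tendsto_one_div_add_atTop_nhds_zero_nat
  have hs0 : ∀ n, 0 < s n := fun n => by positivity
  let g : ℕ → 𝔼 → 𝔼 := fun n x => s n • (InnerProductSpace.toDual ℝ 𝔼).symm (fderiv ℝ χ (s n • x))
  have hfd : ∀ n x, fderiv ℝ (fun x => χ (s n • x)) x = s n • fderiv ℝ χ (s n • x) := fun n x =>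
    fderiv_comp_smul (𝕜 := ℝ) (f := χ) (c := s n) (x := x)
  have hsm : ∀ n, ContDiff ℝ ∞ (fun x => χ (s n • x)) := fun n => hχ.comp (contDiff_const_smul _)
  have hgb : ∀ n x, ‖g n x‖ ≤ s n * C := by
    intro n x
    simp only [g, norm_smul, LinearIsometryEquiv.norm_map, Real.norm_of_nonneg (hs0 n).le]
    exact mul_le_mul_of_nonneg_left (hC _) (hs0 n).le
  have hgc : ∀ n, Continuous (g n) := by
    intro n
    have : Continuous (fderiv ℝ χ) := hχ.continuous_fderiv (by simp)
    fun_prop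
  have key : ∀ n, IsH1WithGradient (fun x => χ (s n • x) * u x)
      (fun x => χ (s n • x) • G x + u x • g n x) := by
    intro n
    refine hu.mul_contDiff (hsm n) (fun x w => ?_) (hgc n)
      (C := max 1 (s n * C)) (fun x => (hχb _).trans (le_max_left _ _))
      (fun x => (hgb n x).trans (le_max_right _ _))
    rw [hfd, _root_.smul_apply, inner_toDual_symm_fderiv, real_inner_smul_left]
    rfl
  refine eLpNorm_le_of_ae_tendsto (f := fun n x => χ (s n • x) * u x) (fun n => (key n).memLp.1)
    (c := fun n => sobolevConst N * (eLpNorm G 2 volume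
      + ENNReal.ofReal (s n * C) * eLpNorm u 2 volume)) (.of_forall fun x => ?_) (fun n => ?_) ?_
  · have h1 : ∀ᶠ n in atTop, χ (s n • x) * u x = u x := by
      have : Tendsto (fun n => s n * ‖x‖) atTop (𝓝 (0 * ‖x‖)) := hs.mul_const _
      rw [zero_mul] at this
      filter_upwards [this.eventually_le_const one_pos] with n hn
      rw [hχ1 _ (by rwa [norm_smul, Real.norm_of_nonneg (hs0 n).le]), one_mul]
    exact (tendsto_congr' h1).2 tendsto_const_nhds
  · refine ((key n).eLpNorm_le_of_hasCompactSupport hN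
      (hχc.comp_smul (hs0 n).ne').mul_right).trans ?_
    gcongr
    refine (eLpNorm_add_le ((hsm n).continuous.aestronglyMeasurable.smul hu.memLp_gradient.1)
      (hu.memLp.1.smul (hgc n).aestronglyMeasurable) (by norm_num)).trans ?_
    gcongr
    · refine eLpNorm_mono fun x => ?_
      rw [Pi.smul_apply', norm_smul]
      exact mul_le_of_le_one_left (norm_nonneg _) (hχb _)
    · refine eLpNorm_le_mul_eLpNorm_of_ae_le_mul (.of_forall fun x => ?_) 2
      rw [Pi.smul_apply', norm_smul, mul_comm]
      exact mul_le_mul_of_nonneg_right (hgb n x) (norm_nonneg _)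
  · have h1 : Tendsto (fun n => ENNReal.ofReal (s n * C)) atTop (𝓝 0) := by
      have := ENNReal.tendsto_ofReal (hs.mul_const C)
      simpa using this
    have h2 := ENNReal.Tendsto.mul_const (b := eLpNorm u 2 volume) h1
      (Or.inr hu.memLp.2.ne)
    have h3 := (tendsto_const_nhds (x := eLpNorm G 2 volume)).add h2
    have h4 := ENNReal.Tendsto.const_mul (a := (sobolevConst N : ENNReal)) h3
      (Or.inr ENNReal.coe_ne_top)
    simpa using h4

theorem IsH1WithGradient.integrable_rpow_criticalExponent (hN : 3 ≤ N)
    (hu : IsH1WithGradient u G) : Integrable (fun x => |u x| ^ criticalExponent N) := by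
  have h : MemLp u (criticalExponentNNReal N) volume :=
    ⟨hu.memLp.1, (hu.eLpNorm_le hN).trans_lt
      (ENNReal.mul_lt_top ENNReal.coe_lt_top hu.memLp_gradient.2)⟩
  have hp := two_lt_criticalExponent hN
  have := h.integrable_norm_rpow (by
    rw [Ne, ENNReal.coe_eq_zero, ← NNReal.coe_eq_zero, coe_criticalExponentNNReal hN]
    linarith) ENNReal.coe_ne_top
  simpa [coe_criticalExponentNNReal hN] using this

/-- The Sobolev inequality `‖u‖_{2^*} ≤ C ‖∇u‖_2`, raised to the power `2^*`. -/
theorem exists_sobolev (hN : 3 ≤ N) : ∃ K : ℝ, 0 < K ∧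
    ∀ (u : EuclideanSpace ℝ (Fin N) → ℝ) (G : EuclideanSpace ℝ (Fin N) → EuclideanSpace ℝ (Fin N)),
      IsH1WithGradient u G →
      ∫ x, |u x| ^ criticalExponent N ≤ K * (∫ x, ‖G x‖ ^ 2) ^ (criticalExponent N / 2) := by
  have hp := two_lt_criticalExponent hN
  have hp0 : criticalExponentNNReal N ≠ 0 := by
    rw [← NNReal.coe_ne_zero, coe_criticalExponentNNReal hN]; linarith
  refine ⟨(sobolevConst N : ℝ) ^ criticalExponent N + 1, by positivity, fun u G hu => ?_⟩
  have h := hu.eLpNorm_le hN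
  have hA : eLpNorm G 2 volume = ENNReal.ofReal ((∫ x, ‖G x‖ ^ 2) ^ (1 / 2 : ℝ)) := by
    have := eLpNorm_two_pow_two (μ := volume) G
    have h2 : ENNReal.ofReal (∫ x, ‖G x‖ ^ 2) = ∫⁻ x, ‖G x‖ₑ ^ 2 := by
      rw [ofReal_integral_eq_lintegral_ofReal
        ((memLp_two_iff_integrable_sq_norm hu.memLp_gradient.1).1 hu.memLp_gradient)
        (.of_forall fun x => by positivity)]
      simp [ENNReal.ofReal_pow]
    rw [← h2] at this
    rw [← ENNReal.ofReal_rpow_of_nonneg (integral_nonneg fun x => by positivity) (by norm_num),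
      ← this, ← ENNReal.rpow_natCast, ← ENNReal.rpow_mul]
    simp
  have hC := eLpNorm_nnreal_pow_eq_lintegral (f := u) (μ := volume) hp0
  have hC2 : ENNReal.ofReal (∫ x, |u x| ^ criticalExponent N)
      = ∫⁻ x, ‖u x‖ₑ ^ criticalExponent N := by
    rw [ofReal_integral_eq_lintegral_ofReal (hu.integrable_rpow_criticalExponent hN)
      (.of_forall fun x => by positivity)]
    congr 1; ext x
    rw [← ENNReal.ofReal_rpow_of_nonneg (abs_nonneg _) (by linarith), ← Real.norm_eq_abs,
      ofReal_norm]
  rw [coe_criticalExponentNNReal hN, ← hC2] at hC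
  have h5 : eLpNorm u (criticalExponentNNReal N) volume ^ criticalExponent N
      ≤ (sobolevConst N * eLpNorm G 2 volume) ^ criticalExponent N := by
    gcongr
  have hAnn : 0 ≤ ∫ x, ‖G x‖ ^ 2 := integral_nonneg fun x => by positivity
  rw [hC, hA, ENNReal.mul_rpow_of_nonneg _ _ (by linarith),
    ENNReal.ofReal_rpow_of_nonneg (by positivity) (by linarith), ← Real.rpow_mul hAnn,
    ← ENNReal.ofReal_coe_nnreal, ENNReal.ofReal_rpow_of_nonneg (by positivity) (by linarith),
    ← ENNReal.ofReal_mul (by positivity), ENNReal.ofReal_le_ofReal_iff (by positivity)] at h5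
  refine h5.trans ?_
  rw [show 1 / 2 * criticalExponent N = criticalExponent N / 2 by ring]
  gcongr
  linarith

/-! ### Integrals of powers: interpolation, splitting and differentiation -/

section
variable {α : Type*} [MeasurableSpace α] {μ : Measure α}

theorem integrable_rpow_of_exponent_between {f : α → ℝ} (hf : AEStronglyMeasurable f μ) {r q p : ℝ}
    (hr : 0 < r) (hrq : r ≤ q) (hqp : q ≤ p) (h2 : Integrable (fun x => |f x| ^ r) μ)
    (hp : Integrable (fun x => |f x| ^ p) μ) : Integrable (fun x => |f x| ^ q) μ := by
  refine (h2.add hp).mono' (hf.aemeasurable.norm.pow_const q).aestronglyMeasurable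
    (.of_forall fun x => ?_)
  rw [Real.norm_of_nonneg (by positivity), Pi.add_apply]
  rcases eq_or_lt_of_le (abs_nonneg (f x)) with h0 | h0
  · rw [← h0, Real.zero_rpow (by linarith), Real.zero_rpow (by linarith),
      Real.zero_rpow (by linarith)]
    simp
  · rcases le_total (|f x|) 1 with h | h
    · have := Real.rpow_le_rpow_of_exponent_ge h0 h hrq
      have : 0 ≤ |f x| ^ p := by positivity
      linarith
    · have := Real.rpow_le_rpow_of_exponent_le h hqp
      have : 0 ≤ |f x| ^ r := by positivity
      linarith

/-- Interpolation of Lebesgue norms between the exponents `2` and `p`. -/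
theorem integral_rpow_le_interpolation {f : α → ℝ} (hf : AEStronglyMeasurable f μ) {q p : ℝ}
    (hq : 2 < q) (hqp : q < p) (h2 : Integrable (fun x => |f x| ^ (2 : ℝ)) μ)
    (hp : Integrable (fun x => |f x| ^ p) μ) :
    ∫ x, |f x| ^ q ∂μ ≤ (∫ x, |f x| ^ (2 : ℝ) ∂μ) ^ ((p - q) / (p - 2))
      * (∫ x, |f x| ^ p ∂μ) ^ ((q - 2) / (p - 2)) := by
  have hp2 : 0 < p - 2 := by linarith
  have hpq : 0 < p - q := by linarith
  have hq2 : 0 < q - 2 := by linarith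
  have hconj : ((p - 2) / (p - q)).HolderConjugate ((p - 2) / (q - 2)) := by
    refine ⟨?_, by positivity, by positivity⟩
    rw [inv_div, inv_div]; field_simp; ring
  set a := 2 * ((p - q) / (p - 2)) with ha
  set b := p * ((q - 2) / (p - 2)) with hb
  have e1 : ∀ x, (|f x| ^ a) ^ ((p - 2) / (p - q)) = |f x| ^ (2 : ℝ) := fun x => by
    rw [← Real.rpow_mul (abs_nonneg _)]; congr 1; rw [ha]; field_simp
  have e2 : ∀ x, (|f x| ^ b) ^ ((p - 2) / (q - 2)) = |f x| ^ p := fun x => by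
    rw [← Real.rpow_mul (abs_nonneg _)]; congr 1; rw [hb]; field_simp
  have m1 : MemLp (fun x => |f x| ^ a) (ENNReal.ofReal ((p - 2) / (p - q))) μ := by
    have hm : AEStronglyMeasurable (fun x => |f x| ^ a) μ :=
      (hf.aemeasurable.norm.pow_const a).aestronglyMeasurable
    rw [← integrable_norm_rpow_iff hm
      (by simpa using by positivity) ENNReal.ofReal_ne_top,
      ENNReal.toReal_ofReal (by positivity)]
    simpa [e1, Real.norm_of_nonneg, Real.rpow_nonneg, abs_nonneg,
      Real.abs_rpow_of_nonneg] using h2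
  have m2 : MemLp (fun x => |f x| ^ b) (ENNReal.ofReal ((p - 2) / (q - 2))) μ := by
    have hm : AEStronglyMeasurable (fun x => |f x| ^ b) μ :=
      (hf.aemeasurable.norm.pow_const b).aestronglyMeasurable
    rw [← integrable_norm_rpow_iff hm
      (by simpa using by positivity) ENNReal.ofReal_ne_top,
      ENNReal.toReal_ofReal (by positivity)]
    simpa [e2, Real.norm_of_nonneg, Real.rpow_nonneg, abs_nonneg,
      Real.abs_rpow_of_nonneg] using hp
  have h := integral_mul_le_Lp_mul_Lq_of_nonneg hconj (.of_forall fun x => by positivity)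
    (.of_forall fun x => by positivity) m1 m2
  simp only [e1, e2, one_div_div] at h
  refine le_trans (le_of_eq ?_) h
  congr 1; ext x
  rw [← Real.rpow_add_of_nonneg (abs_nonneg _) (by positivity)
    (mul_nonneg (by linarith) (by positivity))]
  congr 1
  change q = 2 * ((p - q) / (p - 2)) + p * ((q - 2) / (p - 2))
  field_simp; ring

theorem add_rpow_le_two_rpow_mul {a b r : ℝ} (ha : 0 ≤ a) (hb : 0 ≤ b) (hr : 0 ≤ r) :
    (a + b) ^ r ≤ 2 ^ r * (a ^ r + b ^ r) := by
  have ha' : 0 ≤ a ^ r := by positivity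
  have hb' : 0 ≤ b ^ r := by positivity
  rcases le_total a b with h | h
  · calc (a + b) ^ r ≤ (2 * b) ^ r := by gcongr; linarith
      _ = 2 ^ r * b ^ r := Real.mul_rpow (by norm_num) hb
      _ ≤ _ := by gcongr; linarith
  · calc (a + b) ^ r ≤ (2 * a) ^ r := by gcongr; linarith
      _ = 2 ^ r * a ^ r := Real.mul_rpow (by norm_num) ha
      _ ≤ _ := by gcongr; linarith

theorem integrable_add_rpow {f g : α → ℝ} (hf : AEStronglyMeasurable f μ)
    (hg : AEStronglyMeasurable g μ) {r : ℝ} (hr : 0 ≤ r) (hfi : Integrable (fun x => |f x| ^ r) μ)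
    (hgi : Integrable (fun x => |g x| ^ r) μ) :
    Integrable (fun x => (|f x| + |g x|) ^ r) μ := by
  refine ((hfi.add hgi).const_mul (2 ^ r)).mono'
    ((hf.aemeasurable.norm.add hg.aemeasurable.norm).pow_const r).aestronglyMeasurable
    (.of_forall fun x => ?_)
  rw [Real.norm_of_nonneg (by positivity)]
  exact add_rpow_le_two_rpow_mul (abs_nonneg _) (abs_nonneg _) hr

/-- The elementary inequality behind the Brezis-Lieb lemma. By homogeneity it reduces to the
continuity of `b ↦ |1 + b| ^ r` at `0`. -/
theorem exists_abs_abs_add_rpow_sub_le {r : ℝ} (hr : 0 < r) {ε : ℝ} (hε : 0 < ε) :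
    ∃ C : ℝ, ∀ a b : ℝ, |(|a + b| ^ r - |a| ^ r - |b| ^ r)| ≤ ε * |a| ^ r + C * |b| ^ r := by
  have hc : Continuous fun t : ℝ => |(|1 + t| ^ r - 1 - |t| ^ r)| := by
    refine (((continuous_abs.comp (by fun_prop)).rpow_const fun _ => .inr hr.le).sub
      continuous_const |>.sub (continuous_abs.rpow_const fun _ => .inr hr.le)).abs
  have h0 : Tendsto (fun t : ℝ => |(|1 + t| ^ r - 1 - |t| ^ r)|) (𝓝 0) (𝓝 0) := by
    have := hc.tendsto 0
    simpa [Real.zero_rpow hr.ne'] using this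
  obtain ⟨δ, hδ, h⟩ := Metric.eventually_nhds_iff.1 (h0.eventually_le_const hε)
  refine ⟨(δ⁻¹ + 1) ^ r + δ⁻¹ ^ r + 1, fun a b => ?_⟩
  have hb : 0 ≤ |b| ^ r := by positivity
  by_cases hab : |b| < δ * |a|
  · have ha : a ≠ 0 := by
      rintro rfl; simp at hab; linarith [abs_nonneg b]
    have ha' : 0 < |a| := abs_pos.2 ha
    have h1 := h (y := b / a) (by
      rw [Real.dist_eq, sub_zero, abs_div, div_lt_iff₀ ha']; exact hab)
    have e : |a + b| ^ r - |a| ^ r - |b| ^ r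
        = |a| ^ r * (|1 + b / a| ^ r - 1 - |b / a| ^ r) := by
      rw [mul_sub, mul_sub, mul_one, ← Real.mul_rpow (abs_nonneg _) (abs_nonneg _),
        ← Real.mul_rpow (abs_nonneg _) (abs_nonneg _), ← abs_mul, ← abs_mul, mul_add, mul_one,
        mul_div_cancel₀ _ ha]
    rw [e, abs_mul, abs_of_nonneg (a := |a| ^ r) (by positivity)]
    have : |a| ^ r * |(|1 + b / a| ^ r - 1 - |b / a| ^ r)| ≤ |a| ^ r * ε := by gcongr
    have : 0 ≤ ((δ⁻¹ + 1) ^ r + δ⁻¹ ^ r + 1) * |b| ^ r := by positivity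
    linarith
  · have hab' : |a| ≤ δ⁻¹ * |b| := by
      rw [inv_mul_eq_div, le_div_iff₀ hδ]; linarith
    have h1 : |a + b| ^ r ≤ (δ⁻¹ + 1) ^ r * |b| ^ r := by
      rw [← Real.mul_rpow (by positivity) (abs_nonneg _)]
      gcongr
      refine (abs_add_le a b).trans ?_
      linarith
    have h2 : |a| ^ r ≤ δ⁻¹ ^ r * |b| ^ r := by
      rw [← Real.mul_rpow (by positivity) (abs_nonneg _)]
      gcongr
    have h3 : 0 ≤ |a + b| ^ r := by positivity
    have h4 : 0 ≤ |a| ^ r := by positivity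
    have h5 : 0 ≤ ε * |a| ^ r := by positivity
    have h6 : 0 ≤ (δ⁻¹ + 1) ^ r * |b| ^ r := by positivity
    rw [abs_le]
    constructor <;> nlinarith

/-- The Brezis-Lieb lemma. -/
theorem tendsto_integral_rpow_sub_integral_rpow {r : ℝ} (hr : 0 < r) {f : ℕ → α → ℝ} {g : α → ℝ}
    (hfi : ∀ n, Integrable (fun x => |f n x| ^ r) μ) (hgi : Integrable (fun x => |g x| ^ r) μ)
    (hfg : ∀ n, Integrable (fun x => |f n x - g x| ^ r) μ) {M : ℝ}
    (hM : ∀ n, ∫ x, |f n x - g x| ^ r ∂μ ≤ M)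
    (h : ∀ᵐ x ∂μ, Tendsto (fun n => f n x) atTop (𝓝 (g x))) :
    Tendsto (fun n => ∫ x, |f n x| ^ r ∂μ - ∫ x, |f n x - g x| ^ r ∂μ) atTop
      (𝓝 (∫ x, |g x| ^ r ∂μ)) := by
  have hM0 : 0 ≤ M := (integral_nonneg fun x => by positivity).trans (hM 0)
  rw [Metric.tendsto_atTop]
  intro η hη
  set ε := η / (2 * (M + 1)) with hεdef
  have hε : 0 < ε := by positivity
  obtain ⟨C, hC⟩ := exists_abs_abs_add_rpow_sub_le hr hε
  let d : ℕ → α → ℝ := fun n x => |(|f n x| ^ r - |f n x - g x| ^ r - |g x| ^ r)|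
  have hd : ∀ n, Integrable (d n) μ := fun n => (((hfi n).sub (hfg n)).sub hgi).abs
  let W : ℕ → α → ℝ := fun n x => max (d n x - ε * |f n x - g x| ^ r) 0
  have hWi : ∀ n, Integrable (W n) μ := fun n => ((hd n).sub ((hfg n).const_mul ε)).pos_part
  have hW : Tendsto (fun n => ∫ x, W n x ∂μ) atTop (𝓝 (∫ x, (0 : ℝ) ∂μ)) := by
    refine tendsto_integral_of_dominated_convergence (fun x => |C| * |g x| ^ r)
      (fun n => (hWi n).1) (hgi.const_mul _) (fun n => .of_forall fun x => ?_) ?_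
    · rw [Real.norm_of_nonneg (le_max_right _ _)]
      refine max_le ?_ (by positivity)
      have := hC (f n x - g x) (g x)
      rw [sub_add_cancel] at this
      have h2 : C * |g x| ^ r ≤ |C| * |g x| ^ r := by gcongr; exact le_abs_self C
      simp only [d]
      linarith
    · filter_upwards [h] with x hx
      have hc1 : Continuous fun t : ℝ => |t| ^ r := continuous_abs.rpow_const fun _ => .inr hr.le
      have hc : Continuous fun t : ℝ =>
          max (|(|t| ^ r - |t - g x| ^ r - |g x| ^ r)| - ε * |t - g x| ^ r) 0 := by
        have := hc1.comp (continuous_id.sub (continuous_const (y := g x)))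
        simp only [Function.comp_def] at this
        fun_prop
      have := (hc.tendsto (g x)).comp hx
      simpa [Real.zero_rpow hr.ne', Function.comp_def] using this
  rw [integral_zero] at hW
  obtain ⟨n₀, hn₀⟩ := Metric.tendsto_atTop.1 hW (η / 2) (by positivity)
  refine ⟨n₀, fun n hn => ?_⟩
  have h1 := hn₀ n hn
  rw [Real.dist_eq, sub_zero] at h1
  have h2 : ∫ x, d n x ∂μ ≤ ∫ x, W n x ∂μ + ε * ∫ x, |f n x - g x| ^ r ∂μ := by
    rw [← integral_const_mul, ← integral_add (hWi n) ((hfg n).const_mul ε)]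
    refine integral_mono (hd n) ((hWi n).add ((hfg n).const_mul ε)) fun x => ?_
    have := le_max_left (d n x - ε * |f n x - g x| ^ r) 0
    simp only [W]
    linarith
  have h3 : ε * ∫ x, |f n x - g x| ^ r ∂μ ≤ ε * M := by gcongr; exact hM n
  have h4 : ε * M < η / 2 := by
    rw [hεdef, div_mul_eq_mul_div, div_lt_div_iff₀ (by positivity) (by norm_num)]
    nlinarith
  have hsub : Integrable (fun x => |f n x| ^ r - |f n x - g x| ^ r) μ := (hfi n).sub (hfg n)
  rw [Real.dist_eq, ← integral_sub (hfi n) (hfg n), ← integral_sub hsub hgi]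
  have h5 := abs_integral_le_integral_abs (μ := μ)
    (f := fun x => |f n x| ^ r - |f n x - g x| ^ r - |g x| ^ r)
  calc _ ≤ ∫ x, d n x ∂μ := h5
    _ ≤ _ := h2
    _ < η := by linarith [le_abs_self (∫ x, W n x ∂μ)]

theorem abs_rpow_mul_le {r : ℝ} (hr : 1 < r) (a b : ℝ) :
    |(|a| ^ (r - 2) * a * b)| ≤ (|a| + |b|) ^ r := by
  rcases eq_or_ne a 0 with rfl | ha
  · simp; positivity
  have ha' : 0 < |a| := abs_pos.2 ha
  rw [abs_mul, abs_mul, abs_of_nonneg (a := |a| ^ (r - 2)) (by positivity),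
    show |a| ^ (r - 2) * |a| = |a| ^ (r - 1) by
      rw [← Real.rpow_add_one ha'.ne']; ring_nf]
  calc |a| ^ (r - 1) * |b| ≤ (|a| + |b|) ^ (r - 1) * (|a| + |b|) := by
        gcongr
        · linarith [abs_nonneg b]
        · linarith
    _ = (|a| + |b|) ^ r := by
        rw [← Real.rpow_add_one (by positivity)]; ring_nf

theorem integrable_abs_rpow_mul {f g : α → ℝ} (hf : AEStronglyMeasurable f μ)
    (hg : AEStronglyMeasurable g μ) {r : ℝ} (hr : 1 < r) (hfi : Integrable (fun x => |f x| ^ r) μ)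
    (hgi : Integrable (fun x => |g x| ^ r) μ) :
    Integrable (fun x => |f x| ^ (r - 2) * f x * g x) μ :=
  (integrable_add_rpow hf hg (by linarith) hfi hgi).mono'
    (((hf.aemeasurable.norm.pow_const (r - 2)).mul hf.aemeasurable).mul
      hg.aemeasurable).aestronglyMeasurable
    (.of_forall fun x => abs_rpow_mul_le hr _ _)

theorem hasDerivAt_integral_abs_add_mul_rpow {f g : α → ℝ} (hf : AEStronglyMeasurable f μ)
    (hg : AEStronglyMeasurable g μ) {r : ℝ} (hr : 1 < r) (hfi : Integrable (fun x => |f x| ^ r) μ)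
    (hgi : Integrable (fun x => |g x| ^ r) μ) :
    HasDerivAt (fun s : ℝ => ∫ x, |f x + s * g x| ^ r ∂μ)
      (r * ∫ x, |f x| ^ (r - 2) * f x * g x ∂μ) 0 := by
  have hm : ∀ s : ℝ, AEMeasurable (fun x => f x + s * g x) μ := fun s =>
    hf.aemeasurable.add (hg.aemeasurable.const_mul s)
  have h := hasDerivAt_integral_of_dominated_loc_of_deriv_le (μ := μ)
    (F := fun (s : ℝ) x => |f x + s * g x| ^ r)
    (F' := fun (s : ℝ) x => r * |f x + s * g x| ^ (r - 2) * (f x + s * g x) * g x) (x₀ := (0 : ℝ))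
    (bound := fun x => r * (|f x| + 2 * |g x|) ^ r)
    (Metric.ball_mem_nhds (0 : ℝ) one_pos)
    (.of_forall fun s => ((hm s).norm.pow_const r).aestronglyMeasurable) (by simpa using hfi)
    (((((hm 0).norm.pow_const (r - 2)).const_mul r).mul (hm 0)).mul
      hg.aemeasurable).aestronglyMeasurable
    (.of_forall fun x s hs => ?_) ?_ (.of_forall fun x s hs => ?_)
  · convert! h.2 using 1
    simp only [zero_mul, add_zero]
    rw [← integral_const_mul]
    congr 1; ext x; ring
  · have hs' : |s| ≤ 1 := by simpa using (mem_ball_zero_iff.1 hs).le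
    have h1 := abs_rpow_mul_le hr (f x + s * g x) (g x)
    have h2 : |f x + s * g x| ≤ |f x| + |g x| := by
      refine (abs_add_le _ _).trans ?_
      rw [abs_mul]
      have := mul_le_mul_of_nonneg_right hs' (abs_nonneg (g x))
      linarith
    rw [Real.norm_eq_abs, mul_assoc, mul_assoc, abs_mul, abs_of_pos (by linarith : 0 < r),
      ← mul_assoc]
    gcongr
    exact h1.trans (Real.rpow_le_rpow (by positivity) (by linarith) (by linarith))
  · have := integrable_add_rpow hf (hg.const_mul 2) (by linarith : 0 ≤ r) hfi (by
      simpa [abs_mul, Real.mul_rpow] using hgi.const_mul (2 ^ r))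
    simpa [abs_mul] using this.const_mul r
  · have h1 : HasDerivAt (fun s : ℝ => f x + s * g x) (g x) s := by
      simpa using ((hasDerivAt_id s).mul_const (g x)).const_add (f x)
    exact (hasDerivAt_abs_rpow _ hr).comp s h1

end

/-! ### Weak convergence in `H¹` and local compactness -/

theorem exists_weak_subseq_of_bounded {H : Type*} [NormedAddCommGroup H] [InnerProductSpace ℝ H]
    [CompleteSpace H] [TopologicalSpace.SeparableSpace H] {x : ℕ → H} {R : ℝ}
    (hx : ∀ n, ‖x n‖ ≤ R) :
    ∃ (y : H) (φ : ℕ → ℕ), StrictMono φ ∧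
      ∀ z, Tendsto (fun n => inner ℝ (x (φ n)) z) atTop (𝓝 (inner ℝ y z)) := by
  have h := WeakDual.isSeqCompact_closedBall ℝ H (0 : StrongDual ℝ H) R
  obtain ⟨a, -, φ, hφ, ha⟩ := h (x := fun n => StrongDual.toWeakDual
    (InnerProductSpace.toDual ℝ H (x n))) (fun n => by simpa using hx n)
  refine ⟨(InnerProductSpace.toDual ℝ H).symm (WeakDual.toStrongDual a), φ, hφ, fun z => ?_⟩
  rw [InnerProductSpace.toDual_symm_apply]
  exact ((WeakDual.eval_continuous z).tendsto a).comp ha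

theorem exists_weak_subseq_L2 {F : Type*} [NormedAddCommGroup F] [InnerProductSpace ℝ F]
    [CompleteSpace F] [SecondCountableTopology F] {f : ℕ → EuclideanSpace ℝ (Fin N) → F}
    (hf : ∀ n, MemLp (f n) 2 volume) {M : ℝ} (hM : ∀ n, ∫ x, ‖f n x‖ ^ 2 ≤ M) :
    ∃ (g : EuclideanSpace ℝ (Fin N) → F) (φ : ℕ → ℕ), MemLp g 2 volume ∧ StrictMono φ ∧
      ∀ h, MemLp h 2 volume →
        Tendsto (fun n => ∫ x, inner ℝ (f (φ n) x) (h x)) atTop (𝓝 (∫ x, inner ℝ (g x) (h x))) := by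
  have : Fact ((2 : ENNReal) ≠ ⊤) := ⟨by norm_num⟩
  obtain ⟨y, φ, hφ, hy⟩ := exists_weak_subseq_of_bounded (x := fun n => (hf n).toLp (f n))
    (R := √M) (fun n => by
      apply Real.le_sqrt_of_sq_le
      refine le_trans (le_of_eq ?_) (hM n)
      rw [← real_inner_self_eq_norm_sq, L2.inner_def]
      refine integral_congr_ae ?_
      filter_upwards [(hf n).coeFn_toLp] with x hx
      rw [hx, real_inner_self_eq_norm_sq])
  refine ⟨y, φ, Lp.memLp y, hφ, fun h hh => ?_⟩
  have e := hy (hh.toLp h)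
  simp only [L2.inner_def] at e
  convert! e using 1
  · ext n
    refine integral_congr_ae ?_
    filter_upwards [(hf (φ n)).coeFn_toLp, hh.coeFn_toLp] with x hx hx'
    rw [hx, hx']
  · congr 1
    refine integral_congr_ae ?_
    filter_upwards [hh.coeFn_toLp] with x hx'
    rw [hx']

/-- Weak convergence in `H¹` of functions with given gradients, tested separately on the functions
and on the gradients. -/
structure WeakTendstoH1 (un : ℕ → EuclideanSpace ℝ (Fin N) → ℝ)
    (Gn : ℕ → EuclideanSpace ℝ (Fin N) → EuclideanSpace ℝ (Fin N))
    (u : EuclideanSpace ℝ (Fin N) → ℝ)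
    (G : EuclideanSpace ℝ (Fin N) → EuclideanSpace ℝ (Fin N)) : Prop where
  tendsto_integral : ∀ f : EuclideanSpace ℝ (Fin N) → ℝ, MemLp f 2 volume →
    Tendsto (fun n => ∫ x, un n x * f x) atTop (𝓝 (∫ x, u x * f x))
  tendsto_integral_gradient : ∀ F : EuclideanSpace ℝ (Fin N) → EuclideanSpace ℝ (Fin N),
    MemLp F 2 volume →
    Tendsto (fun n => ∫ x, inner ℝ (Gn n x) (F x)) atTop (𝓝 (∫ x, inner ℝ (G x) (F x)))

theorem exists_weakTendstoH1_subseq {un : ℕ → 𝔼 → ℝ} {Gn : ℕ → 𝔼 → 𝔼}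
    (h : ∀ n, IsH1WithGradient (un n) (Gn n)) {M : ℝ} (hu : ∀ n, ∫ x, |un n x| ^ 2 ≤ M)
    (hG : ∀ n, ∫ x, ‖Gn n x‖ ^ 2 ≤ M) :
    ∃ (u : 𝔼 → ℝ) (G : 𝔼 → 𝔼) (φ : ℕ → ℕ), StrictMono φ ∧ IsH1WithGradient u G ∧
      WeakTendstoH1 (fun n => un (φ n)) (fun n => Gn (φ n)) u G := by
  obtain ⟨u, φ, hum, hφ, hu'⟩ := exists_weak_subseq_L2 (fun n => (h n).memLp) hu
  obtain ⟨G, ψ, hGm, hψ, hG'⟩ := exists_weak_subseq_L2 (fun n => (h (φ n)).memLp_gradient)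
    (fun n => hG (φ n))
  have hu2 : ∀ f : 𝔼 → ℝ, MemLp f 2 volume →
      Tendsto (fun n => ∫ x, un (φ (ψ n)) x * f x) atTop (𝓝 (∫ x, u x * f x)) := by
    intro f hf
    have := (hu' f hf).comp hψ.tendsto_atTop
    simpa [Function.comp_def, mul_comm] using this
  refine ⟨u, G, φ ∘ ψ, hφ.comp hψ, .of_memLp hum hGm ?_, hu2, hG'⟩
  intro η hη hc w
  have h1 := hu2 _ (memLp_two_fderiv_apply hη hc w)
  have hF : MemLp (fun x => η x • w) 2 volume :=
    (hη.continuous.smul continuous_const).memLp_of_hasCompactSupport hc.smul_right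
  have h2 := (hG' _ hF).neg
  simp only [real_inner_smul_right] at h2
  refine tendsto_nhds_unique h1 (h2.congr fun n => ?_)
  exact ((h (φ (ψ n))).hasWeakGradient.integral_eq η hη hc w).symm

theorem integrable_inner_of_memLp_two {F : Type*} [NormedAddCommGroup F] [InnerProductSpace ℝ F]
    {f g : 𝔼 → F} (hf : MemLp f 2 volume) (hg : MemLp g 2 volume) :
    Integrable (fun x => inner ℝ (f x) (g x)) := by
  refine (hf.norm.integrable_mul hg.norm).mono' (hf.1.inner hg.1) (.of_forall fun x => ?_)
  exact norm_inner_le_norm _ _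

theorem WeakTendstoH1.sub {un : ℕ → 𝔼 → ℝ} {Gn : ℕ → 𝔼 → 𝔼}
    (h : ∀ n, IsH1WithGradient (un n) (Gn n)) (hu : IsH1WithGradient u G)
    (hw : WeakTendstoH1 un Gn u G) :
    WeakTendstoH1 (fun n x => un n x - u x) (fun n x => Gn n x - G x) 0 0 := by
  constructor
  · intro f hf
    have := (hw.tendsto_integral f hf).sub_const (∫ x, u x * f x)
    rw [sub_self] at this
    simp only [Pi.zero_apply, zero_mul, integral_zero]
    refine this.congr fun n => ?_
    have i1 : Integrable (fun x => un n x * f x) := (h n).memLp.integrable_mul hf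
    have i2 : Integrable (fun x => u x * f x) := hu.memLp.integrable_mul hf
    rw [← integral_sub i1 i2]
    simp only [sub_mul]
  · intro F hF
    have := (hw.tendsto_integral_gradient F hF).sub_const (∫ x, inner ℝ (G x) (F x))
    rw [sub_self] at this
    simp only [Pi.zero_apply, inner_zero_left, integral_zero]
    refine this.congr fun n => ?_
    rw [← integral_sub (integrable_inner_of_memLp_two (h n).memLp_gradient hF)
      (integrable_inner_of_memLp_two hu.memLp_gradient hF)]
    simp only [inner_sub_left]

theorem IsH1WithGradient.integrable_sq (hu : IsH1WithGradient u G) :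
    Integrable (fun x => |u x| ^ 2) := by
  simpa using (memLp_two_iff_integrable_sq_norm hu.memLp.1).1 hu.memLp

theorem IsH1WithGradient.integrable_sq_gradient (hu : IsH1WithGradient u G) :
    Integrable (fun x => ‖G x‖ ^ 2) :=
  (memLp_two_iff_integrable_sq_norm hu.memLp_gradient.1).1 hu.memLp_gradient

/-- Hilbert space identity: along a weakly convergent sequence the squared norm splits. -/
theorem WeakTendstoH1.tendsto_sq {un : ℕ → 𝔼 → ℝ} {Gn : ℕ → 𝔼 → 𝔼}
    (h : ∀ n, IsH1WithGradient (un n) (Gn n)) (hu : IsH1WithGradient u G)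
    (hw : WeakTendstoH1 un Gn u G) :
    Tendsto (fun n => (∫ x, |un n x| ^ 2) - ∫ x, |un n x - u x| ^ 2) atTop (𝓝 (∫ x, |u x| ^ 2)) := by
  have h1 := ((hw.tendsto_integral u hu.memLp).const_mul 2).sub_const (∫ x, |u x| ^ 2)
  have e : ∫ x, u x * u x = ∫ x, |u x| ^ 2 := by congr 1; ext x; rw [sq_abs, sq]
  rw [e, two_mul, add_sub_cancel_right] at h1
  refine h1.congr fun n => ?_
  have i1 : Integrable (fun x => 2 * (un n x * u x)) :=
    ((h n).memLp.integrable_mul hu.memLp).const_mul 2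
  rw [← integral_const_mul, ← integral_sub i1 hu.integrable_sq,
    ← integral_sub (h n).integrable_sq ((h n).sub hu).integrable_sq]
  congr 1; ext x
  simp only [sq_abs]; ring

theorem WeakTendstoH1.tendsto_sq_gradient {un : ℕ → 𝔼 → ℝ} {Gn : ℕ → 𝔼 → 𝔼}
    (h : ∀ n, IsH1WithGradient (un n) (Gn n)) (hu : IsH1WithGradient u G)
    (hw : WeakTendstoH1 un Gn u G) :
    Tendsto (fun n => (∫ x, ‖Gn n x‖ ^ 2) - ∫ x, ‖Gn n x - G x‖ ^ 2) atTop
      (𝓝 (∫ x, ‖G x‖ ^ 2)) := by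
  have h1 := ((hw.tendsto_integral_gradient G hu.memLp_gradient).const_mul 2).sub_const
    (∫ x, ‖G x‖ ^ 2)
  have e : ∫ x, inner ℝ (G x) (G x) = ∫ x, ‖G x‖ ^ 2 := by simp only [real_inner_self_eq_norm_sq]
  rw [e, two_mul, add_sub_cancel_right] at h1
  refine h1.congr fun n => ?_
  have i1 : Integrable (fun x => 2 * inner ℝ (Gn n x) (G x)) :=
    (integrable_inner_of_memLp_two (h n).memLp_gradient hu.memLp_gradient).const_mul 2
  rw [← integral_const_mul, ← integral_sub i1 hu.integrable_sq_gradient,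
    ← integral_sub (h n).integrable_sq_gradient ((h n).sub hu).integrable_sq_gradient]
  congr 1; ext x
  rw [norm_sub_sq_real]; ring

theorem enorm_sq_le_two_mul_add (a b : ℝ) : ‖a‖ₑ ^ 2 ≤ 2 * ‖a - b‖ₑ ^ 2 + 2 * ‖b‖ₑ ^ 2 := by
  have h : ∀ t : ℝ, ‖t‖ₑ ^ 2 = ENNReal.ofReal (t ^ 2) := fun t => by
    rw [← ofReal_norm, ← ENNReal.ofReal_pow (norm_nonneg _), Real.norm_eq_abs, sq_abs]
  rw [h, h, h, ← ENNReal.ofReal_ofNat, ← ENNReal.ofReal_mul (by norm_num),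
    ← ENNReal.ofReal_mul (by norm_num), ← ENNReal.ofReal_add (by positivity) (by positivity)]
  apply ENNReal.ofReal_le_ofReal
  nlinarith [sq_nonneg (a - 2 * b)]

theorem IsH1WithGradient.ofReal_integral_sq_gradient (hu : IsH1WithGradient u G) :
    ENNReal.ofReal (∫ x, ‖G x‖ ^ 2) = ∫⁻ x, ‖G x‖ₑ ^ 2 := by
  rw [ofReal_integral_eq_lintegral_ofReal hu.integrable_sq_gradient
    (.of_forall fun x => by positivity)]
  simp only [ENNReal.ofReal_pow (norm_nonneg _), ofReal_norm]

theorem mollify_eq_integral_mul (ρ : ContDiffBump (0 : 𝔼)) (g : 𝔼 → ℝ) (x : 𝔼) :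
    mollify ρ g x = ∫ t, g t * ρ.normed volume (x - t) := by
  rw [mollify_eq_integral, ρ.integral_measure,
    ← integral_sub_left_eq_self (fun t => g t * ρ.normed volume (x - t)) volume x]
  simp [mul_comm]

/-- Rellich's theorem with a finite weight: a sequence that converges weakly to `0` in `H¹` converges
strongly to `0` in `L²(ν)`, for a finite measure `ν` below Lebesgue measure. Mollified functions
converge pointwise and boundedly, and the mollification error is controlled by the gradients. -/
theorem tendsto_lintegral_sq_of_weakTendstoH1_zero {vn : ℕ → 𝔼 → ℝ} {Vn : ℕ → 𝔼 → 𝔼}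
    (h : ∀ n, IsH1WithGradient (vn n) (Vn n)) (hw : WeakTendstoH1 vn Vn 0 0) {M : ℝ}
    (hM : ∀ n, ∫ x, |vn n x| ^ 2 ≤ M) (hM' : ∀ n, ∫ x, ‖Vn n x‖ ^ 2 ≤ M)
    {ν : Measure (EuclideanSpace ℝ (Fin N))} [IsFiniteMeasure ν] (hν : ν ≤ volume) :
    Tendsto (fun n => ∫⁻ x, ‖vn n x‖ₑ ^ 2 ∂ν) atTop (𝓝 0) := by
  rw [ENNReal.tendsto_nhds_zero]
  intro ε hε
  have hε4 : 0 < ε / 4 := ENNReal.div_pos hε.ne' (by norm_num)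
  have hlim : Tendsto (fun k => ENNReal.ofReal (bumpSeq N k).rOut ^ 2 * ENNReal.ofReal M) atTop
      (𝓝 0) := by
    have h1 : Tendsto (fun k => (bumpSeq N k).rOut ^ 2 * M) atTop (𝓝 0) := by
      simpa using (tendsto_bumpSeq_rOut (N := N)).pow 2 |>.mul_const M
    have h2 := ENNReal.tendsto_ofReal h1
    rw [ENNReal.ofReal_zero] at h2
    refine h2.congr fun k => ?_
    rw [ENNReal.ofReal_mul (by positivity), ENNReal.ofReal_pow (bumpSeq N k).rOut_pos.le]
  obtain ⟨k, hk⟩ := (hlim.eventually_le_const hε4).exists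
  set ρ := bumpSeq N k
  have hρ2 : ∀ x : 𝔼, MemLp (fun t => ρ.normed volume (x - t)) 2 volume := by
    intro x
    have hc : Continuous (fun t => ρ.normed volume (x - t)) :=
      ρ.continuous_normed.comp (continuous_const.sub continuous_id)
    exact hc.memLp_of_hasCompactSupport
      (ρ.hasCompactSupport_normed.comp_homeomorph (Homeomorph.subLeft x))
  set R := ∫ t, ρ.normed volume t ^ 2
  have hb : ∀ n x, |mollify ρ (vn n) x| ≤ M + R := by
    intro n x
    rw [mollify_eq_integral_mul]
    refine (abs_integral_le_integral_abs).trans ?_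
    have e : R = ∫ t, ρ.normed volume (x - t) ^ 2 :=
      (integral_sub_left_eq_self (fun t => ρ.normed volume t ^ 2) volume x).symm
    have i2 : Integrable (fun t => ρ.normed volume (x - t) ^ 2) := by
      simpa using (memLp_two_iff_integrable_sq_norm (hρ2 x).1).1 (hρ2 x)
    calc ∫ t, |vn n t * ρ.normed volume (x - t)|
        ≤ ∫ t, (|vn n t| ^ 2 + ρ.normed volume (x - t) ^ 2) := by
          refine integral_mono ((h n).memLp.integrable_mul (hρ2 x)).abs
            ((h n).integrable_sq.add i2) fun t => ?_
          simp only [abs_mul]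
          rw [← sq_abs (ρ.normed volume (x - t))]
          nlinarith [sq_nonneg (|vn n t| - |ρ.normed volume (x - t)|), sq_nonneg (|vn n t|),
            sq_nonneg (|ρ.normed volume (x - t)|)]
      _ = (∫ t, |vn n t| ^ 2) + R := by rw [integral_add (h n).integrable_sq i2, e]
      _ ≤ M + R := by gcongr; exact hM n
  have hpt : ∀ x, Tendsto (fun n => mollify ρ (vn n) x) atTop (𝓝 0) := by
    intro x
    have := hw.tendsto_integral _ (hρ2 x)
    simpa [mollify_eq_integral_mul] using this
  have hcont : ∀ n, Continuous (mollify ρ (vn n)) := fun n =>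
    (contDiff_mollify ρ (h n).hasWeakGradient.locallyIntegrable).continuous
  have hdct : Tendsto (fun n => ∫⁻ x, ‖mollify ρ (vn n) x‖ₑ ^ 2 ∂ν) atTop
      (𝓝 (∫⁻ _x : 𝔼, 0 ∂ν)) := by
    refine tendsto_lintegral_of_dominated_convergence (fun _ => ENNReal.ofReal (M + R) ^ 2)
      (fun n => (hcont n).measurable.enorm.pow_const 2) (fun n => .of_forall fun x => ?_) ?_
      (.of_forall fun x => ?_)
    · simp only
      gcongr
      rw [← ofReal_norm]
      exact ENNReal.ofReal_le_ofReal (hb n x)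
    · rw [lintegral_const]
      exact ENNReal.mul_ne_top (by simp) (measure_ne_top _ _)
    · have := ((ENNReal.continuous_pow 2).tendsto _).comp (hpt x).enorm
      simpa [Function.comp_def] using this
  rw [lintegral_zero] at hdct
  filter_upwards [hdct.eventually_le_const hε4] with n hn
  calc ∫⁻ x, ‖vn n x‖ₑ ^ 2 ∂ν
      ≤ ∫⁻ x, (2 * ‖vn n x - mollify ρ (vn n) x‖ₑ ^ 2 + 2 * ‖mollify ρ (vn n) x‖ₑ ^ 2) ∂ν :=
        lintegral_mono fun x => enorm_sq_le_two_mul_add _ _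
    _ = 2 * ∫⁻ x, ‖vn n x - mollify ρ (vn n) x‖ₑ ^ 2 ∂ν
        + 2 * ∫⁻ x, ‖mollify ρ (vn n) x‖ₑ ^ 2 ∂ν := by
        rw [lintegral_add_right _ (((hcont n).measurable.enorm.pow_const 2).const_mul 2),
          lintegral_const_mul' _ _ (by norm_num), lintegral_const_mul' _ _ (by norm_num)]
    _ ≤ 2 * (∫⁻ x, ‖vn n x - mollify ρ (vn n) x‖ₑ ^ 2) + 2 * (ε / 4) := by
        gcongr
    _ ≤ 2 * (ENNReal.ofReal ρ.rOut ^ 2 * ENNReal.ofReal M) + 2 * (ε / 4) := by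
        gcongr 2 * ?_ + _
        refine ((h n).lintegral_sub_mollify_sq_le ρ).trans ?_
        rw [← (h n).ofReal_integral_sq_gradient]
        gcongr
        exact hM' n
    _ ≤ 2 * (ε / 4) + 2 * (ε / 4) := by gcongr
    _ = ε := by
        rw [← mul_add, ← two_mul, ← mul_assoc, show (2 : ENNReal) * 2 = 4 by norm_num,
          ENNReal.mul_div_cancel (by norm_num) (by norm_num)]

/-! ### A decaying weight and the vanishing lemma -/

/-- A smooth positive weight whose gradient is dominated by the weight itself; it serves both as a
cutoff function and as the density of a finite measure equivalent to Lebesgue measure. -/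
noncomputable def decayWeight (N : ℕ) (x : EuclideanSpace ℝ (Fin N)) : ℝ :=
  ((1 + ‖x‖ ^ 2) ^ N)⁻¹

theorem decayWeight_pos (x : 𝔼) : 0 < decayWeight N x := by
  rw [decayWeight]; positivity

theorem decayWeight_le_one (x : 𝔼) : decayWeight N x ≤ 1 := by
  rw [decayWeight]
  apply inv_le_one_of_one_le₀
  apply one_le_pow₀
  nlinarith [sq_nonneg ‖x‖]

theorem contDiff_decayWeight : ContDiff ℝ ∞ (decayWeight N) :=
  ((contDiff_const.add (contDiff_norm_sq ℝ)).pow N).inv fun x => by positivity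

/-- The gradient of `decayWeight`. -/
noncomputable def decayWeightGradient (N : ℕ) (x : EuclideanSpace ℝ (Fin N)) :
    EuclideanSpace ℝ (Fin N) :=
  (InnerProductSpace.toDual ℝ (EuclideanSpace ℝ (Fin N))).symm (fderiv ℝ (decayWeight N) x)

theorem continuous_decayWeightGradient : Continuous (decayWeightGradient N) :=
  (LinearIsometryEquiv.continuous _).comp (contDiff_decayWeight.continuous_fderiv (by simp))

theorem norm_decayWeightGradient_le (x : 𝔼) :
    ‖decayWeightGradient N x‖ ≤ N * decayWeight N x := by
  rw [decayWeightGradient, LinearIsometryEquiv.norm_map]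
  have h1 : HasFDerivAt (fun x : 𝔼 => 1 + ‖x‖ ^ 2) (2 • innerSL ℝ x) x :=
    (hasStrictFDerivAt_norm_sq x).hasFDerivAt.const_add 1
  have h2 := (hasDerivAt_inv (x := (1 + ‖x‖ ^ 2) ^ N) (by positivity)).comp_hasFDerivAt x (h1.pow N)
  have h3 : fderiv ℝ (decayWeight N) x = _ := h2.fderiv
  rw [h3, decayWeight]
  refine ContinuousLinearMap.opNorm_le_bound _ (by positivity) fun w => ?_
  have hb : (0 : ℝ) < 1 + ‖x‖ ^ 2 := by positivity
  have hw := abs_real_inner_le_norm x w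
  have hx : 2 * ‖x‖ ≤ 1 + ‖x‖ ^ 2 := by nlinarith [sq_nonneg (‖x‖ - 1)]
  rcases Nat.eq_zero_or_pos N with hN | hN
  · simp [hN]
  simp only [neg_smul, _root_.neg_apply, _root_.smul_apply, smul_eq_mul, norm_neg, norm_mul,
    innerSL_apply_apply, nsmul_eq_mul, norm_inv, norm_pow, Real.norm_eq_abs, abs_of_pos hb,
    Nat.abs_cast, Nat.abs_ofNat, Nat.cast_ofNat]
  have e : (1 + ‖x‖ ^ 2) ^ N = (1 + ‖x‖ ^ 2) ^ (N - 1) * (1 + ‖x‖ ^ 2) := by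
    rw [← pow_succ]; congr 1; omega
  rw [e]
  set b := (1 + ‖x‖ ^ 2) ^ (N - 1)
  have hb' : 0 < b := by positivity
  calc _ ≤ ((b * (1 + ‖x‖ ^ 2)) ^ 2)⁻¹ * (N * b * (2 * (‖x‖ * ‖w‖))) := by gcongr
    _ = ((b * (1 + ‖x‖ ^ 2)) ^ 2)⁻¹ * (N * b * (2 * ‖x‖) * ‖w‖) := by ring
    _ ≤ ((b * (1 + ‖x‖ ^ 2)) ^ 2)⁻¹ * (N * b * (1 + ‖x‖ ^ 2) * ‖w‖) := by gcongr
    _ = _ := by field_simp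

theorem integrable_decayWeight_rpow {r : ℝ} (hr : 1 ≤ r) (hN : 0 < N) :
    Integrable (fun x : 𝔼 => decayWeight N x ^ r) := by
  have hN' : (0 : ℝ) < N := by exact_mod_cast hN
  have h := integrable_rpow_neg_one_add_norm_sq (E := 𝔼) (μ := volume) (r := 2 * N * r) (by
    simp only [finrank_euclideanSpace, Fintype.card_fin]
    nlinarith)
  refine h.congr (.of_forall fun x => ?_)
  simp only [decayWeight]
  rw [← Real.rpow_natCast (1 + ‖x‖ ^ 2) N, ← Real.rpow_neg (by positivity), ← Real.rpow_mul (by positivity)]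
  congr 1
  ring

theorem integral_decayWeight_rpow_pos {r : ℝ} (hr : 1 ≤ r) (hN : 0 < N) :
    0 < ∫ x : 𝔼, decayWeight N x ^ r := by
  rw [integral_pos_iff_support_of_nonneg (fun x => Real.rpow_nonneg (decayWeight_pos x).le _)
    (integrable_decayWeight_rpow hr hN)]
  have : Function.support (fun x : 𝔼 => decayWeight N x ^ r) = Set.univ := by
    ext x
    simp [(Real.rpow_pos_of_pos (decayWeight_pos x) r).ne']
  rw [this]
  exact isOpen_univ.measure_pos _ Set.univ_nonempty

/-- The finite measure with density the square of `decayWeight`. -/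
noncomputable def decayMeasure (N : ℕ) : Measure (EuclideanSpace ℝ (Fin N)) :=
  volume.withDensity fun x => ENNReal.ofReal (decayWeight N x ^ 2)

theorem measurable_decayWeight_sq :
    Measurable fun x : 𝔼 => ENNReal.ofReal (decayWeight N x ^ 2) :=
  (contDiff_decayWeight.continuous.pow 2).measurable.ennreal_ofReal

theorem isFiniteMeasure_decayMeasure (hN : 0 < N) : IsFiniteMeasure (decayMeasure N) := by
  have h := integrable_decayWeight_rpow (N := N) one_le_two hN
  simp only [Real.rpow_two] at h
  exact isFiniteMeasure_withDensity_ofReal h.2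

theorem decayMeasure_le : decayMeasure N ≤ volume := by
  conv_rhs => rw [← withDensity_one (μ := (volume : Measure 𝔼))]
  refine withDensity_mono (.of_forall fun x => ?_)
  simp only [Pi.one_apply]
  rw [ENNReal.ofReal_le_one]
  exact pow_le_one₀ (decayWeight_pos x).le (decayWeight_le_one x)

theorem absolutelyContinuous_decayMeasure : volume ≪ decayMeasure N :=
  withDensity_absolutelyContinuous' measurable_decayWeight_sq.aemeasurable
    (.of_forall fun x => by
      have := decayWeight_pos x
      simp only [ne_eq, ENNReal.ofReal_eq_zero, not_le]
      positivity)

theorem lintegral_decayMeasure (f : 𝔼 → ENNReal) :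
    ∫⁻ x, f x ∂decayMeasure N = ∫⁻ x, ENNReal.ofReal (decayWeight N x ^ 2) * f x := by
  rw [decayMeasure, lintegral_withDensity_eq_lintegral_mul_non_measurable₀ _
    measurable_decayWeight_sq.aemeasurable (by simp)]
  rfl

/-- Tonelli's theorem for the average of all translates of `f` against `k`. -/
theorem lintegral_lintegral_mul_comp_add {k f : 𝔼 → ENNReal} (hk : Measurable k)
    (hf : AEMeasurable f volume) :
    ∫⁻ y, ∫⁻ x, k x * f (x + y) = (∫⁻ x, k x) * ∫⁻ x, f x := by
  rw [lintegral_lintegral_swap]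
  · calc ∫⁻ x, ∫⁻ y, k x * f (x + y) = ∫⁻ x, k x * ∫⁻ z, f z := by
          congr 1; ext x
          have : AEMeasurable (fun y => f (x + y)) volume :=
            hf.comp_quasiMeasurePreserving
              (measurePreserving_add_left volume x).quasiMeasurePreserving
          rw [lintegral_const_mul'' _ this, lintegral_add_left_eq_self]
      _ = _ := lintegral_mul_const _ hk
  · have h1 : AEMeasurable (fun z : 𝔼 × 𝔼 => f (z.1 - z.2)) (volume.prod volume) :=
      hf.comp_quasiMeasurePreserving (quasiMeasurePreserving_sub volume volume)
    have h2 : Measure.QuasiMeasurePreserving (fun z : 𝔼 × 𝔼 => (z.2, -z.1))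
        (volume.prod volume) (volume.prod volume) := by
      have h3 : MeasurePreserving (fun z : 𝔼 × 𝔼 => (-z.1, z.2)) (volume.prod volume)
          (volume.prod volume) :=
        (Measure.measurePreserving_neg volume).prod (MeasurePreserving.id volume)
      exact (Measure.measurePreserving_swap.comp h3).quasiMeasurePreserving
    have h4 := h1.comp_quasiMeasurePreserving h2
    simp only [Function.comp_def, sub_neg_eq_add] at h4
    exact (hk.comp measurable_snd).aemeasurable.mul h4

theorem criticalExponent_div (hN : 3 ≤ N) :
    criticalExponent N / (criticalExponent N - 2) = N / 2 := by
  have h : (3 : ℝ) ≤ N := by exact_mod_cast hN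
  have h2 : (N : ℝ) - 2 ≠ 0 := by linarith
  have e : criticalExponent N - 2 = 4 / (N - 2) := by
    rw [criticalExponent]; field_simp; ring
  rw [e, criticalExponent]; field_simp; ring

theorem IsH1WithGradient.integrable_rpow (hN : 3 ≤ N) (hu : IsH1WithGradient u G) {q : ℝ}
    (hq : 2 ≤ q) (hq' : q ≤ criticalExponent N) : Integrable (fun x => |u x| ^ q) :=
  integrable_rpow_of_exponent_between hu.memLp.1 two_pos hq hq'
    (by simpa using hu.integrable_sq) (hu.integrable_rpow_criticalExponent hN)

/-- The Gagliardo-Nirenberg inequality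
`‖u‖_q^q ≤ C ‖u‖_2^{2(1-θ)} ‖∇u‖_2^{N(q-2)/2}`. -/
theorem exists_gagliardoNirenberg (hN : 3 ≤ N) {q : ℝ} (hq : 2 < q) (hq' : q < criticalExponent N) :
    ∃ K : ℝ, 0 < K ∧ ∀ (u : EuclideanSpace ℝ (Fin N) → ℝ)
      (G : EuclideanSpace ℝ (Fin N) → EuclideanSpace ℝ (Fin N)), IsH1WithGradient u G →
      ∫ x, |u x| ^ q ≤ K * (∫ x, |u x| ^ 2) ^ ((criticalExponent N - q) / (criticalExponent N - 2))
        * (∫ x, ‖G x‖ ^ 2) ^ (N * (q - 2) / 4) := by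
  obtain ⟨K, hK, h⟩ := exists_sobolev hN
  have hp := two_lt_criticalExponent hN
  refine ⟨K ^ ((q - 2) / (criticalExponent N - 2)), by positivity, fun u G hu => ?_⟩
  have hθ : 0 < (q - 2) / (criticalExponent N - 2) := div_pos (by linarith) (by linarith)
  have hD : 0 ≤ ∫ x, |u x| ^ 2 := integral_nonneg fun x => by positivity
  have hA : 0 ≤ ∫ x, ‖G x‖ ^ 2 := integral_nonneg fun x => by positivity
  have h1 := integral_rpow_le_interpolation hu.memLp.1 hq hq' (by simpa using hu.integrable_sq)
    (hu.integrable_rpow_criticalExponent hN)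
  simp only [Real.rpow_two] at h1
  refine h1.trans ?_
  have h2 : (∫ x, |u x| ^ criticalExponent N) ^ ((q - 2) / (criticalExponent N - 2))
      ≤ K ^ ((q - 2) / (criticalExponent N - 2)) * (∫ x, ‖G x‖ ^ 2) ^ (N * (q - 2) / 4) := by
    calc _ ≤ (K * (∫ x, ‖G x‖ ^ 2) ^ (criticalExponent N / 2))
          ^ ((q - 2) / (criticalExponent N - 2)) :=
          Real.rpow_le_rpow (integral_nonneg fun x => by positivity) (h u G hu) hθ.le
      _ = _ := by
          rw [Real.mul_rpow hK.le (by positivity), ← Real.rpow_mul hA]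
          congr 2
          have := criticalExponent_div hN
          calc criticalExponent N / 2 * ((q - 2) / (criticalExponent N - 2))
              = criticalExponent N / (criticalExponent N - 2) * ((q - 2) / 2) := by ring
            _ = _ := by rw [this]; ring
  calc _ ≤ (∫ x, |u x| ^ 2) ^ ((criticalExponent N - q) / (criticalExponent N - 2))
        * (K ^ ((q - 2) / (criticalExponent N - 2)) * (∫ x, ‖G x‖ ^ 2) ^ (N * (q - 2) / 4)) := by
        gcongr
    _ = _ := by ring

/-- Lions' vanishing lemma: on bounded subsets of `H¹`, the `L^q` norm is controlled by the largest
weighted local mass. The local inequalities are integrated over all translations, and the exponent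
of the gradient exceeds `2` because `q > 2 + 4 / N`. -/
theorem exists_integral_rpow_le_of_local_mass_le (hN : 3 ≤ N) {q : ℝ} (hq : 2 + 4 / (N : ℝ) < q)
    (hq' : q < criticalExponent N) (M : ℝ) :
    ∃ C : ℝ, 0 < C ∧ ∀ (u : EuclideanSpace ℝ (Fin N) → ℝ)
      (G : EuclideanSpace ℝ (Fin N) → EuclideanSpace ℝ (Fin N)), IsH1WithGradient u G →
      ∫ x, |u x| ^ 2 ≤ M → ∫ x, ‖G x‖ ^ 2 ≤ M → ∀ s : ℝ,
      (∀ y, ∫ x, |decayWeight N x * u (x + y)| ^ 2 ≤ s) →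
      ∫ x, |u x| ^ q ≤ C * s ^ ((criticalExponent N - q) / (criticalExponent N - 2)) := by
  have hN3 : (3 : ℝ) ≤ N := by exact_mod_cast hN
  have hN4 : 0 < 4 / (N : ℝ) := by positivity
  have hq2 : 2 < q := by linarith
  obtain ⟨K, hK, hGN⟩ := exists_gagliardoNirenberg hN hq2 hq'
  have hp := two_lt_criticalExponent hN
  set θ := (criticalExponent N - q) / (criticalExponent N - 2) with hθdef
  have hθ : 0 < θ := div_pos (by linarith) (by linarith)
  set κ := N * (q - 2) / 4 with hκdef
  have hκ : 1 < κ := by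
    rw [hκdef, lt_div_iff₀ (by norm_num)]
    have : 4 / (N : ℝ) < q - 2 := by linarith
    rw [div_lt_iff₀ (by linarith)] at this
    linarith
  set I2 := ∫ x : 𝔼, decayWeight N x ^ (2 : ℝ)
  set Iq := ∫ x : 𝔼, decayWeight N x ^ q
  have hI2 : 0 < I2 := integral_decayWeight_rpow_pos one_le_two (by omega)
  have hIq : 0 < Iq := integral_decayWeight_rpow_pos (by linarith) (by omega)
  set M' := |M| + |M| + 1
  refine ⟨K * (2 * (N : ℝ) ^ 2 * M') ^ κ * I2 / Iq, by positivity, fun u G hu hD hA s hs => ?_⟩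
  have hs0 : 0 ≤ s := (integral_nonneg fun x => by positivity).trans (hs 0)
  set e : 𝔼 → ℝ := fun z => ‖G z‖ ^ 2 + |u z| ^ 2
  have he : Integrable e := hu.integrable_sq_gradient.add hu.integrable_sq
  have he0 : ∀ z, 0 ≤ e z := fun z => by positivity
  set T := ∫ z, e z
  have hT : T ≤ M' := by
    simp only [T, e]
    rw [integral_add hu.integrable_sq_gradient hu.integrable_sq]
    have := le_abs_self M
    simp only [M']
    linarith
  have hT0 : 0 ≤ T := integral_nonneg he0
  have hey : ∀ y, Integrable (fun x => decayWeight N x ^ 2 * e (x + y)) := by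
    intro y
    have h1 : Integrable (fun x => e (x + y)) := he.comp_add_right y
    refine h1.mono' ((contDiff_decayWeight.continuous.pow 2).aestronglyMeasurable.mul h1.1)
      (.of_forall fun x => ?_)
    rw [Real.norm_of_nonneg (mul_nonneg (by positivity) (he0 _))]
    exact mul_le_of_le_one_left (he0 _)
      (pow_le_one₀ (decayWeight_pos x).le (decayWeight_le_one x))
  have hey0 : ∀ y, 0 ≤ ∫ x, decayWeight N x ^ 2 * e (x + y) := fun y =>
    integral_nonneg fun x => mul_nonneg (by positivity) (he0 _)
  have heyT : ∀ y, ∫ x, decayWeight N x ^ 2 * e (x + y) ≤ T := by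
    intro y
    rw [show T = ∫ x, e (x + y) from (integral_add_right_eq_self e y).symm]
    refine integral_mono (hey y) (he.comp_add_right y) fun x => ?_
    exact mul_le_of_le_one_left (he0 _)
      (pow_le_one₀ (decayWeight_pos x).le (decayWeight_le_one x))
  -- the inequality localized near `y`
  have hloc : ∀ y, ∫ x, |decayWeight N x * u (x + y)| ^ q
      ≤ K * s ^ θ * ((2 * (N : ℝ) ^ 2) ^ κ * M' ^ (κ - 1))
        * ∫ x, decayWeight N x ^ 2 * e (x + y) := by
    intro y
    have hw := (hu.comp_add_right y).mul_contDiff (contDiff_decayWeight (N := N))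
      (fun x w => inner_toDual_symm_fderiv (decayWeight N) x w) continuous_decayWeightGradient
      (C := N) (fun x => by
        rw [abs_of_pos (decayWeight_pos x)]
        exact (decayWeight_le_one x).trans (by linarith))
      (fun x => (norm_decayWeightGradient_le x).trans
        (mul_le_of_le_one_right (by positivity) (decayWeight_le_one x)))
    have hgrad : ∫ x, ‖decayWeight N x • G (x + y) + u (x + y) • decayWeightGradient N x‖ ^ 2
        ≤ 2 * (N : ℝ) ^ 2 * ∫ x, decayWeight N x ^ 2 * e (x + y) := by
      rw [← integral_const_mul]
      refine integral_mono hw.integrable_sq_gradient ((hey y).const_mul _) fun x => ?_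
      have h1 : ‖decayWeight N x • G (x + y) + u (x + y) • decayWeightGradient N x‖
          ≤ N * decayWeight N x * (‖G (x + y)‖ + |u (x + y)|) := by
        refine (norm_add_le _ _).trans ?_
        rw [norm_smul, norm_smul, Real.norm_of_nonneg (decayWeight_pos x).le, mul_add]
        have h2 := norm_decayWeightGradient_le x
        have h3 : |u (x + y)| * ‖decayWeightGradient N x‖
            ≤ |u (x + y)| * (N * decayWeight N x) := by gcongr
        have h4 : decayWeight N x * ‖G (x + y)‖ ≤ N * (decayWeight N x * ‖G (x + y)‖) :=
          le_mul_of_one_le_left (mul_nonneg (decayWeight_pos x).le (norm_nonneg _)) (by linarith)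
        rw [Real.norm_eq_abs]
        linarith
      have h5 : (‖G (x + y)‖ + |u (x + y)|) ^ 2 ≤ 2 * e (x + y) := by
        simp only [e]
        nlinarith [sq_nonneg (‖G (x + y)‖ - |u (x + y)|)]
      calc _ ≤ (N * decayWeight N x * (‖G (x + y)‖ + |u (x + y)|)) ^ 2 := by gcongr
        _ = (N : ℝ) ^ 2 * decayWeight N x ^ 2 * (‖G (x + y)‖ + |u (x + y)|) ^ 2 := by ring
        _ ≤ (N : ℝ) ^ 2 * decayWeight N x ^ 2 * (2 * e (x + y)) := by gcongr
        _ = _ := by ring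
    refine (hGN _ _ hw).trans ?_
    set E := ∫ x, decayWeight N x ^ 2 * e (x + y) with hE
    have hE0 : 0 ≤ E := hey0 y
    have hEpow : E ^ κ ≤ M' ^ (κ - 1) * E := by
      rcases eq_or_lt_of_le hE0 with h0 | h0
      · rw [← h0, Real.zero_rpow (by linarith)]; simp
      · calc E ^ κ = E ^ (κ - 1) * E := by rw [← Real.rpow_add_one h0.ne']; ring_nf
          _ ≤ M' ^ (κ - 1) * E := by
            gcongr
            exact (heyT y).trans hT
    calc _ ≤ K * s ^ θ * (2 * (N : ℝ) ^ 2 * E) ^ κ := by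
          gcongr
          · exact hs y
          · exact hgrad
      _ = K * s ^ θ * ((2 * (N : ℝ) ^ 2) ^ κ * E ^ κ) := by
          rw [Real.mul_rpow (by positivity) hE0]
      _ ≤ K * s ^ θ * ((2 * (N : ℝ) ^ 2) ^ κ * (M' ^ (κ - 1) * E)) := by gcongr
      _ = _ := by ring
  set c := K * s ^ θ * ((2 * (N : ℝ) ^ 2) ^ κ * M' ^ (κ - 1)) with hc
  have hc0 : 0 ≤ c := by positivity
  have hcont := contDiff_decayWeight (N := N) |>.continuous
  have huq : Integrable (fun x => |u x| ^ q) := hu.integrable_rpow hN hq2.le hq'.le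
  have huq0 : 0 ≤ ∫ x, |u x| ^ q := integral_nonneg fun x => by positivity
  have key : ∫⁻ y, ∫⁻ x, ENNReal.ofReal (decayWeight N x ^ q) * ENNReal.ofReal (|u (x + y)| ^ q)
      ≤ ∫⁻ y, ENNReal.ofReal c *
        ∫⁻ x, ENNReal.ofReal (decayWeight N x ^ (2 : ℝ)) * ENNReal.ofReal (e (x + y)) := by
    refine lintegral_mono fun y => ?_
    have hwi : Integrable (fun x => |decayWeight N x * u (x + y)| ^ q) := by
      have h1 : Integrable (fun x => |u (x + y)| ^ q) := huq.comp_add_right y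
      refine h1.mono' ((hcont.aestronglyMeasurable.mul
        (hu.comp_add_right y).memLp.1).aemeasurable.norm.pow_const q).aestronglyMeasurable
        (.of_forall fun x => ?_)
      rw [Real.norm_of_nonneg (by positivity)]
      refine Real.rpow_le_rpow (abs_nonneg _) ?_ (by linarith)
      rw [abs_mul, abs_of_pos (decayWeight_pos x)]
      exact mul_le_of_le_one_left (abs_nonneg _) (decayWeight_le_one x)
    have e1 : ∫⁻ x, ENNReal.ofReal (decayWeight N x ^ q) * ENNReal.ofReal (|u (x + y)| ^ q)
        = ENNReal.ofReal (∫ x, |decayWeight N x * u (x + y)| ^ q) := by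
      rw [ofReal_integral_eq_lintegral_ofReal hwi (.of_forall fun x => by positivity)]
      congr 1; ext x
      have := (decayWeight_pos x).le
      rw [abs_mul, abs_of_nonneg this, Real.mul_rpow this (abs_nonneg _),
        ENNReal.ofReal_mul (by positivity)]
    have e2 : ∫⁻ x, ENNReal.ofReal (decayWeight N x ^ (2 : ℝ)) * ENNReal.ofReal (e (x + y))
        = ENNReal.ofReal (∫ x, decayWeight N x ^ 2 * e (x + y)) := by
      rw [ofReal_integral_eq_lintegral_ofReal (hey y)
        (.of_forall fun x => mul_nonneg (by positivity) (he0 _))]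
      congr 1; ext x
      rw [ENNReal.ofReal_mul (by positivity), Real.rpow_two]
    rw [e1, e2, ← ENNReal.ofReal_mul hc0]
    exact ENNReal.ofReal_le_ofReal (hloc y)
  have hmeas : ∀ r : ℝ, 0 ≤ r → Measurable fun x : 𝔼 => ENNReal.ofReal (decayWeight N x ^ r) :=
    fun r hr => (hcont.rpow_const fun _ => .inr hr).measurable.ennreal_ofReal
  rw [lintegral_const_mul' _ _ ENNReal.ofReal_ne_top,
    lintegral_lintegral_mul_comp_add (hmeas q (by linarith)) huq.1.aemeasurable.ennreal_ofReal,
    lintegral_lintegral_mul_comp_add (hmeas 2 (by norm_num)) he.1.aemeasurable.ennreal_ofReal,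
    ← ofReal_integral_eq_lintegral_ofReal huq (.of_forall fun x => by positivity),
    ← ofReal_integral_eq_lintegral_ofReal he (.of_forall he0),
    ← ofReal_integral_eq_lintegral_ofReal (integrable_decayWeight_rpow (by linarith) (by omega))
      (.of_forall fun x => Real.rpow_nonneg (decayWeight_pos x).le _),
    ← ofReal_integral_eq_lintegral_ofReal (integrable_decayWeight_rpow one_le_two (by omega))
      (.of_forall fun x => Real.rpow_nonneg (decayWeight_pos x).le _),
    ← ENNReal.ofReal_mul hIq.le, ← ENNReal.ofReal_mul hI2.le, ← ENNReal.ofReal_mul hc0,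
    ENNReal.ofReal_le_ofReal_iff (mul_nonneg hc0 (mul_nonneg hI2.le hT0))] at key
  have hfin : c * (I2 * T) ≤ K * (2 * (N : ℝ) ^ 2 * M') ^ κ * I2 * s ^ θ := by
    have hM' : 0 < M' := by positivity
    calc c * (I2 * T) ≤ c * (I2 * M') := by gcongr
      _ = K * ((2 * (N : ℝ) ^ 2) ^ κ * (M' ^ (κ - 1) * M')) * I2 * s ^ θ := by rw [hc]; ring
      _ = _ := by
        rw [← Real.rpow_add_one hM'.ne', sub_add_cancel, ← Real.mul_rpow (by positivity) hM'.le]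
  rw [div_mul_eq_mul_div, le_div_iff₀ hIq]
  calc _ = Iq * ∫ x, |u x| ^ q := mul_comm _ _
    _ ≤ _ := key
    _ ≤ _ := hfin

/-! ### Mass-preserving dilations and the Pohozaev functional -/

/-- The mass-preserving dilation `t^{N/2} u(t x)`. -/
noncomputable def dilate (t : ℝ) (u : EuclideanSpace ℝ (Fin N) → ℝ) :
    EuclideanSpace ℝ (Fin N) → ℝ :=
  fun x => t ^ ((N : ℝ) / 2) * u (t • x)

/-- The gradient of `dilate t u` in terms of the gradient `G` of `u`. -/
noncomputable def dilateGradient (t : ℝ) (G : EuclideanSpace ℝ (Fin N) → EuclideanSpace ℝ (Fin N)) :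
    EuclideanSpace ℝ (Fin N) → EuclideanSpace ℝ (Fin N) :=
  fun x => t ^ ((N : ℝ) / 2) • t • G (t • x)

theorem IsH1WithGradient.dilate (hu : IsH1WithGradient u G) {t : ℝ} (ht : 0 < t) :
    IsH1WithGradient (dilate t u) (dilateGradient t G) :=
  (hu.comp_smul ht).const_mul _

theorem integral_abs_dilate_rpow (u : 𝔼 → ℝ) {t : ℝ} (ht : 0 < t) (r : ℝ) :
    ∫ x, |dilate t u x| ^ r = t ^ (N * (r - 2) / 2) * ∫ x, |u x| ^ r := by
  have h1 : ∀ x, |dilate t u x| ^ r = (t ^ ((N : ℝ) / 2)) ^ r * |u (t • x)| ^ r := fun x => by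
    rw [dilate, abs_mul, abs_of_pos (Real.rpow_pos_of_pos ht _),
      Real.mul_rpow (by positivity) (abs_nonneg _)]
  simp only [h1]
  rw [integral_const_mul, Measure.integral_comp_smul volume (fun x => |u x| ^ r) t, smul_eq_mul,
    ← mul_assoc]
  congr 1
  rw [finrank_euclideanSpace, Fintype.card_fin, abs_of_pos (by positivity), ← Real.rpow_mul ht.le,
    ← Real.rpow_natCast, ← Real.rpow_neg ht.le, ← Real.rpow_add ht]
  congr 1; ring

theorem integral_abs_dilate_sq (u : 𝔼 → ℝ) {t : ℝ} (ht : 0 < t) :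
    ∫ x, |dilate t u x| ^ 2 = ∫ x, |u x| ^ 2 := by
  have := integral_abs_dilate_rpow u ht 2
  simpa using this

theorem integral_norm_dilateGradient_sq (G : 𝔼 → 𝔼) {t : ℝ} (ht : 0 < t) :
    ∫ x, ‖dilateGradient t G x‖ ^ 2 = t ^ 2 * ∫ x, ‖G x‖ ^ 2 := by
  have h1 : ∀ x, ‖dilateGradient t G x‖ ^ 2
      = (t ^ ((N : ℝ) / 2)) ^ 2 * t ^ 2 * ‖G (t • x)‖ ^ 2 := fun x => by
    rw [dilateGradient, norm_smul, norm_smul, Real.norm_of_nonneg (by positivity),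
      Real.norm_of_nonneg ht.le]
    ring
  simp only [h1]
  rw [integral_const_mul, Measure.integral_comp_smul volume (fun x => ‖G x‖ ^ 2) t, smul_eq_mul,
    ← mul_assoc]
  congr 1
  rw [finrank_euclideanSpace, Fintype.card_fin, abs_of_pos (by positivity), ← Real.rpow_mul_natCast
    ht.le]
  norm_num
  field_simp

/-- The Pohozaev functional `‖∇u‖² - μ γ_q ‖u‖_q^q - ‖u‖_{2^*}^{2^*}` with `γ_q = N (q - 2) / (2 q)`.
It is the derivative of the energy along the mass-preserving dilations of `u`. -/
noncomputable def pohozaev (μ q : ℝ) (u : EuclideanSpace ℝ (Fin N) → ℝ)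
    (G : EuclideanSpace ℝ (Fin N) → EuclideanSpace ℝ (Fin N)) : ℝ :=
  (∫ x, ‖G x‖ ^ 2) - μ * (N * (q - 2) / 2 / q) * (∫ x, |u x| ^ q)
    - ∫ x, |u x| ^ criticalExponent N

/-- The energy minus half of the Pohozaev functional. It coincides with the energy where the
Pohozaev functional vanishes, and all of its coefficients are positive. -/
noncomputable def reducedEnergy (μ q : ℝ) (u : EuclideanSpace ℝ (Fin N) → ℝ) : ℝ :=
  μ * ((N * (q - 2) / 2 - 2) / (2 * q)) * (∫ x, |u x| ^ q)
    + (1 / 2 - 1 / criticalExponent N) * ∫ x, |u x| ^ criticalExponent N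

theorem two_lt_dilation_exponent (hN : 3 ≤ N) {q : ℝ} (hq : 2 + 4 / (N : ℝ) < q) :
    2 < N * (q - 2) / 2 := by
  have hN3 : (3 : ℝ) ≤ N := by exact_mod_cast hN
  have : 4 / (N : ℝ) < q - 2 := by linarith
  rw [div_lt_iff₀ (by linarith)] at this
  linarith

theorem two_lt_of_mass_supercritical (hN : 3 ≤ N) {q : ℝ} (hq : 2 + 4 / (N : ℝ) < q) : 2 < q := by
  have hN3 : (3 : ℝ) ≤ N := by exact_mod_cast hN
  have : 0 < 4 / (N : ℝ) := by positivity
  linarith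

theorem dilation_exponent_criticalExponent (hN : 3 ≤ N) :
    N * (criticalExponent N - 2) / 2 = criticalExponent N := by
  have h := criticalExponent_div hN
  have hp := two_lt_criticalExponent hN
  rw [div_eq_iff (by linarith)] at h
  linarith

theorem dilation_exponent_lt (hN : 3 ≤ N) {q : ℝ} (hq : q < criticalExponent N) :
    N * (q - 2) / 2 < q := by
  have h := dilation_exponent_criticalExponent hN
  have hN3 : (3 : ℝ) ≤ N := by exact_mod_cast hN
  nlinarith

theorem half_sub_inv_criticalExponent_pos (hN : 3 ≤ N) :
    0 < 1 / 2 - 1 / criticalExponent N := by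
  have := one_div_lt_one_div_of_lt two_pos (two_lt_criticalExponent hN)
  linarith

theorem reducedEnergy_coeff_pos (hN : 3 ≤ N) {q : ℝ} (hq : 2 + 4 / (N : ℝ) < q) {μ : ℝ}
    (hμ : 0 < μ) : 0 < μ * ((N * (q - 2) / 2 - 2) / (2 * q)) := by
  have h1 := two_lt_dilation_exponent hN hq
  have h2 := two_lt_of_mass_supercritical hN hq
  exact mul_pos hμ (div_pos (by linarith) (by linarith))

theorem pohozaev_coeff_pos (hN : 3 ≤ N) {q : ℝ} (hq : 2 + 4 / (N : ℝ) < q) {μ : ℝ}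
    (hμ : 0 < μ) : 0 < μ * (N * (q - 2) / 2 / q) := by
  have h1 := two_lt_dilation_exponent hN hq
  have h2 := two_lt_of_mass_supercritical hN hq
  exact mul_pos hμ (div_pos (by linarith) (by linarith))

theorem reducedEnergy_nonneg (hN : 3 ≤ N) {q : ℝ} (hq : 2 + 4 / (N : ℝ) < q) {μ : ℝ}
    (hμ : 0 < μ) (u : 𝔼 → ℝ) : 0 ≤ reducedEnergy μ q u := by
  have h1 := reducedEnergy_coeff_pos hN hq hμ
  have h2 := half_sub_inv_criticalExponent_pos hN
  have h3 : 0 ≤ ∫ x, |u x| ^ q := integral_nonneg fun x => by positivity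
  have h4 : 0 ≤ ∫ x, |u x| ^ criticalExponent N := integral_nonneg fun x => by positivity
  rw [reducedEnergy]; positivity

theorem pohozaev_dilate (hN : 3 ≤ N) (μ q : ℝ) (u : 𝔼 → ℝ) (G : 𝔼 → 𝔼) {t : ℝ} (ht : 0 < t) :
    pohozaev μ q (dilate t u) (dilateGradient t G) = t ^ 2 * (∫ x, ‖G x‖ ^ 2)
      - μ * (N * (q - 2) / 2 / q) * (t ^ (N * (q - 2) / 2) * ∫ x, |u x| ^ q)
      - t ^ criticalExponent N * ∫ x, |u x| ^ criticalExponent N := by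
  rw [pohozaev, integral_norm_dilateGradient_sq G ht, integral_abs_dilate_rpow u ht,
    integral_abs_dilate_rpow u ht, dilation_exponent_criticalExponent hN]

theorem reducedEnergy_dilate (hN : 3 ≤ N) (μ q : ℝ) (u : 𝔼 → ℝ) {t : ℝ} (ht : 0 < t) :
    reducedEnergy μ q (dilate t u) =
      μ * ((N * (q - 2) / 2 - 2) / (2 * q)) * (t ^ (N * (q - 2) / 2) * ∫ x, |u x| ^ q)
      + (1 / 2 - 1 / criticalExponent N) *
        (t ^ criticalExponent N * ∫ x, |u x| ^ criticalExponent N) := by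
  rw [reducedEnergy, integral_abs_dilate_rpow u ht,
    integral_abs_dilate_rpow u ht, dilation_exponent_criticalExponent hN]

theorem IsH1WithGradient.integral_rpow_pos (hN : 3 ≤ N) (hu : IsH1WithGradient u G)
    (hm : 0 < ∫ x, |u x| ^ 2) {r : ℝ} (hr : 2 ≤ r) (hr' : r ≤ criticalExponent N) :
    0 < ∫ x, |u x| ^ r := by
  have h0 : 0 ≤ ∫ x, |u x| ^ r := integral_nonneg fun x => by positivity
  refine lt_of_le_of_ne h0 fun h => hm.ne' ?_
  rw [eq_comm, integral_eq_zero_iff_of_nonneg (fun x => by positivity)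
    (hu.integrable_rpow hN hr hr')] at h
  refine integral_eq_zero_of_ae (h.mono fun x hx => ?_)
  simp only [Pi.zero_apply] at hx ⊢
  rw [Real.rpow_eq_zero_iff_of_nonneg (abs_nonneg _)] at hx
  rw [hx.1]; simp

/-- If the mass vanishes, so do all the other Lebesgue norms. -/
theorem IsH1WithGradient.integral_rpow_eq_zero (hu : IsH1WithGradient u G)
    (hm : ∫ x, |u x| ^ 2 = 0) {r : ℝ} (hr : r ≠ 0) : ∫ x, |u x| ^ r = 0 := by
  rw [integral_eq_zero_iff_of_nonneg (fun x => by positivity) hu.integrable_sq] at hm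
  refine integral_eq_zero_of_ae (hm.mono fun x hx => ?_)
  simp only [Pi.zero_apply] at hx ⊢
  rw [pow_eq_zero_iff two_ne_zero] at hx
  rw [hx, Real.zero_rpow hr]

/-- The class over which the reduced energy is minimized: nonzero functions in the `L²` ball of
radius `a` whose Pohozaev functional is nonpositive. -/
structure IsAdmissible (μ q a : ℝ) (u : EuclideanSpace ℝ (Fin N) → ℝ)
    (G : EuclideanSpace ℝ (Fin N) → EuclideanSpace ℝ (Fin N)) : Prop where
  isH1 : IsH1WithGradient u G
  mass_pos : 0 < ∫ x, |u x| ^ 2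
  mass_le : ∫ x, |u x| ^ 2 ≤ a ^ 2
  pohozaev_nonpos : pohozaev μ q u G ≤ 0

theorem IsH1WithGradient.reducedEnergy_pos (hN : 3 ≤ N) {q : ℝ} (hq : 2 + 4 / (N : ℝ) < q)
    {μ : ℝ} (hμ : 0 < μ) (hu : IsH1WithGradient u G) (hm : 0 < ∫ x, |u x| ^ 2) :
    0 < reducedEnergy μ q u := by
  have h1 := reducedEnergy_coeff_pos hN hq hμ
  have h2 := half_sub_inv_criticalExponent_pos hN
  have h3 : 0 ≤ ∫ x, |u x| ^ q := integral_nonneg fun x => by positivity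
  have h4 := hu.integral_rpow_pos hN hm (two_lt_criticalExponent hN).le le_rfl
  rw [reducedEnergy]; positivity

/-- The gradient norm is controlled by the reduced energy on the admissible class. -/
theorem exists_integral_gradient_le (hN : 3 ≤ N) {q : ℝ} (hq : 2 + 4 / (N : ℝ) < q)
    {μ : ℝ} (hμ : 0 < μ) : ∃ c : ℝ, 0 < c ∧ ∀ (u : EuclideanSpace ℝ (Fin N) → ℝ)
      (G : EuclideanSpace ℝ (Fin N) → EuclideanSpace ℝ (Fin N)), pohozaev μ q u G ≤ 0 →
      ∫ x, ‖G x‖ ^ 2 ≤ c * reducedEnergy μ q u := by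
  have h1 := reducedEnergy_coeff_pos hN hq hμ
  have h2 := half_sub_inv_criticalExponent_pos hN
  have h3 := pohozaev_coeff_pos hN hq hμ
  set α := μ * ((N * (q - 2) / 2 - 2) / (2 * q)) with hα
  set β := 1 / 2 - 1 / criticalExponent N with hβ
  set γ := μ * (N * (q - 2) / 2 / q) with hγ
  refine ⟨γ / α + 1 / β, by positivity, fun u G h => ?_⟩
  rw [pohozaev, ← hγ] at h
  have h5 : 0 ≤ ∫ x, |u x| ^ q := integral_nonneg fun x => by positivity
  have h6 : 0 ≤ ∫ x, |u x| ^ criticalExponent N := integral_nonneg fun x => by positivity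
  rw [reducedEnergy, ← hα, ← hβ]
  set B := ∫ x, |u x| ^ q
  set C := ∫ x, |u x| ^ criticalExponent N
  have e : (γ / α + 1 / β) * (α * B + β * C) = γ * B + C + (γ / α * β * C + 1 / β * α * B) := by
    field_simp; ring
  have : 0 ≤ γ / α * β * C + 1 / β * α * B := by positivity
  rw [e]; linarith

/-- The gradient norm is bounded below on the admissible class, since `q` is mass-supercritical. -/
theorem exists_le_integral_gradient (hN : 3 ≤ N) {q : ℝ} (hq : 2 + 4 / (N : ℝ) < q)
    (hq' : q < criticalExponent N) {μ : ℝ} (hμ : 0 < μ) (a : ℝ) :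
    ∃ δ : ℝ, 0 < δ ∧ ∀ (u : EuclideanSpace ℝ (Fin N) → ℝ)
      (G : EuclideanSpace ℝ (Fin N) → EuclideanSpace ℝ (Fin N)), IsAdmissible μ q a u G →
      δ ≤ ∫ x, ‖G x‖ ^ 2 := by
  have hq2 := two_lt_of_mass_supercritical hN hq
  have hp := two_lt_criticalExponent hN
  obtain ⟨K, hK, hS⟩ := exists_sobolev hN
  obtain ⟨K', hK', hGN⟩ := exists_gagliardoNirenberg hN hq2 hq'
  have hγ := pohozaev_coeff_pos hN hq hμ
  have hβ := two_lt_dilation_exponent hN hq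
  set γ := μ * (N * (q - 2) / 2 / q)
  set θ := (criticalExponent N - q) / (criticalExponent N - 2)
  have hθ : 0 < θ := div_pos (by linarith) (by linarith)
  set κ := (N : ℝ) * (q - 2) / 4 with hκdef
  have hκ : 1 < κ := by rw [hκdef]; linarith
  set c := γ * (K' * (a ^ 2) ^ θ) with hc
  have hc0 : 0 ≤ c := by positivity
  -- near zero the superlinear terms are at most half of the linear one
  have ht : Tendsto (fun A : ℝ => c * A ^ (κ - 1) + K * A ^ (criticalExponent N / 2 - 1))
      (𝓝 0) (𝓝 0) := by
    have h1 : Continuous fun A : ℝ => c * A ^ (κ - 1) + K * A ^ (criticalExponent N / 2 - 1) :=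
      (continuous_const.mul (Real.continuous_rpow_const (by linarith))).add
        (continuous_const.mul (Real.continuous_rpow_const (by linarith)))
    have := h1.tendsto 0
    rwa [Real.zero_rpow (by linarith), Real.zero_rpow (by linarith), mul_zero, mul_zero,
      add_zero] at this
  obtain ⟨δ, hδ, h⟩ := Metric.eventually_nhds_iff.1 (ht.eventually_le_const
    (show (0 : ℝ) < 1 / 2 by norm_num))
  refine ⟨δ, hδ, fun u G hu => ?_⟩
  have hC := hu.isH1.integral_rpow_pos hN hu.mass_pos hp.le le_rfl
  have hSu := hS u G hu.isH1
  have hA0 : 0 ≤ ∫ x, ‖G x‖ ^ 2 := integral_nonneg fun x => by positivity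
  set A := ∫ x, ‖G x‖ ^ 2
  have hA : 0 < A := by
    refine lt_of_le_of_ne hA0 fun h0 => ?_
    rw [← h0, Real.zero_rpow (by linarith), mul_zero] at hSu
    linarith
  by_contra! hlt
  have h1 := h (y := A) (by rwa [Real.dist_eq, sub_zero, abs_of_pos hA])
  have h2 := hu.pohozaev_nonpos
  rw [pohozaev] at h2
  have h3 : ∫ x, |u x| ^ q ≤ K' * (a ^ 2) ^ θ * A ^ κ := by
    refine (hGN u G hu.isH1).trans ?_
    gcongr
    exact hu.mass_le
  have h4 : A ≤ c * A ^ κ + K * A ^ (criticalExponent N / 2) := by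
    have : γ * ∫ x, |u x| ^ q ≤ γ * (K' * (a ^ 2) ^ θ * A ^ κ) := by gcongr
    have e : γ * (K' * (a ^ 2) ^ θ * A ^ κ) = c * A ^ κ := by rw [hc]; ring
    linarith
  have h5 : c * A ^ κ + K * A ^ (criticalExponent N / 2)
      = (c * A ^ (κ - 1) + K * A ^ (criticalExponent N / 2 - 1)) * A := by
    rw [add_mul, mul_assoc c, mul_assoc K, ← Real.rpow_add_one hA.ne', ← Real.rpow_add_one hA.ne',
      sub_add_cancel, sub_add_cancel]
  have h6 : (c * A ^ (κ - 1) + K * A ^ (criticalExponent N / 2 - 1)) * A ≤ 1 / 2 * A := by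
    gcongr
  linarith

/-- Below a level depending only on the dimension, the critical term is too small to balance the
gradient, so admissible functions have a nontrivial `L^q` norm. -/
theorem exists_le_integral_rpow (N : ℕ) (hN : 3 ≤ N) :
    ∃ c₁ : ℝ, 0 < c₁ ∧ ∀ {q : ℝ}, 2 + 4 / (N : ℝ) < q → q < criticalExponent N →
      ∀ {μ : ℝ}, 0 < μ → ∀ a : ℝ, ∃ b : ℝ, 0 < b ∧ ∀ (u : EuclideanSpace ℝ (Fin N) → ℝ)
      (G : EuclideanSpace ℝ (Fin N) → EuclideanSpace ℝ (Fin N)), IsAdmissible μ q a u G →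
      ∫ x, |u x| ^ criticalExponent N ≤ c₁ → b ≤ ∫ x, |u x| ^ q := by
  have hp := two_lt_criticalExponent hN
  obtain ⟨K, hK, hS⟩ := exists_sobolev hN
  have ht : Tendsto (fun A : ℝ => K * A ^ (criticalExponent N / 2 - 1)) (𝓝 0) (𝓝 0) := by
    have h1 : Continuous fun A : ℝ => K * A ^ (criticalExponent N / 2 - 1) :=
      continuous_const.mul (Real.continuous_rpow_const (by linarith))
    have := h1.tendsto 0
    rwa [Real.zero_rpow (by linarith), mul_zero] at this
  obtain ⟨r, hr, h⟩ := Metric.eventually_nhds_iff.1 (ht.eventually_le_const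
    (show (0 : ℝ) < 1 / 2 by norm_num))
  refine ⟨r / 4, by positivity, fun {q} hq hq' {μ} hμ a => ?_⟩
  obtain ⟨δ, hδ, hA⟩ := exists_le_integral_gradient hN hq hq' hμ a
  have hγ := pohozaev_coeff_pos hN hq hμ
  set γ := μ * (N * (q - 2) / 2 / q) with hγdef
  refine ⟨min (δ / 2) (r / 4) / γ, by positivity, fun u G hu hC => ?_⟩
  rw [div_le_iff₀ hγ]
  by_contra! hlt
  have h1 := lt_of_lt_of_le hlt (min_le_left _ _)
  have h2 := lt_of_lt_of_le hlt (min_le_right _ _)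
  have h3 := hu.pohozaev_nonpos
  rw [pohozaev, ← hγdef] at h3
  have h4 := hA u G hu
  have h5 := hS u G hu.isH1
  set A := ∫ x, ‖G x‖ ^ 2
  have hA0 : 0 < A := by linarith
  have h6 := h (y := A) (by rw [Real.dist_eq, sub_zero, abs_of_pos hA0]; linarith)
  have h7 : K * A ^ (criticalExponent N / 2) ≤ 1 / 2 * A := by
    calc _ = K * A ^ (criticalExponent N / 2 - 1) * A := by
          rw [mul_assoc, ← Real.rpow_add_one hA0.ne', sub_add_cancel]
      _ ≤ _ := by gcongr
  linarith

/-- A dilation of a function with negative Pohozaev functional lowers the reduced energy. -/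
theorem IsAdmissible.exists_reducedEnergy_lt (hN : 3 ≤ N) {q : ℝ} (hq : 2 + 4 / (N : ℝ) < q)
    {μ a : ℝ} (hμ : 0 < μ) (hu : IsAdmissible μ q a u G) (hP : pohozaev μ q u G < 0) :
    ∃ (v : 𝔼 → ℝ) (V : 𝔼 → 𝔼), IsAdmissible μ q a v V ∧
      reducedEnergy μ q v < reducedEnergy μ q u := by
  have hp := two_lt_criticalExponent hN
  have hβ := two_lt_dilation_exponent hN hq
  have hc : Continuous fun t : ℝ => t ^ 2 * (∫ x, ‖G x‖ ^ 2)
      - μ * (N * (q - 2) / 2 / q) * (t ^ (N * (q - 2) / 2) * ∫ x, |u x| ^ q)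
      - t ^ criticalExponent N * ∫ x, |u x| ^ criticalExponent N :=
    (((continuous_id.pow 2).mul continuous_const).sub (continuous_const.mul
      ((Real.continuous_rpow_const (by linarith)).mul continuous_const))).sub
      ((Real.continuous_rpow_const (by linarith)).mul continuous_const)
  have h1 := hc.tendsto 1
  simp only [one_pow, one_mul, Real.one_rpow] at h1
  have h2 := (h1.mono_left (nhdsWithin_le_nhds (s := Set.Iio 1))).eventually_lt_const hP
  have h3 : ∀ᶠ t : ℝ in 𝓝[<] 1, 0 < t := nhdsWithin_le_nhds (lt_mem_nhds one_pos)
  obtain ⟨t, ht1, ht2, ht3⟩ := (h2.and (h3.and self_mem_nhdsWithin)).exists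
  refine ⟨dilate t u, dilateGradient t G, ⟨hu.isH1.dilate ht2, ?_, ?_, ?_⟩, ?_⟩
  · rw [integral_abs_dilate_sq u ht2]; exact hu.mass_pos
  · rw [integral_abs_dilate_sq u ht2]; exact hu.mass_le
  · rw [pohozaev_dilate hN μ q u G ht2]; exact ht1.le
  · rw [reducedEnergy_dilate hN μ q u ht2, reducedEnergy]
    have i1 := reducedEnergy_coeff_pos hN hq hμ
    have i2 := half_sub_inv_criticalExponent_pos hN
    have i3 : 0 ≤ ∫ x, |u x| ^ q := integral_nonneg fun x => by positivity
    have i4 := hu.isH1.integral_rpow_pos hN hu.mass_pos hp.le le_rfl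
    have i5 : t ^ (N * (q - 2) / 2) ≤ 1 := Real.rpow_le_one ht2.le (le_of_lt ht3) (by linarith)
    have i6 : t ^ criticalExponent N < 1 := Real.rpow_lt_one ht2.le ht3 (by linarith)
    have i7 : t ^ (N * (q - 2) / 2) * ∫ x, |u x| ^ q ≤ ∫ x, |u x| ^ q :=
      mul_le_of_le_one_left i3 i5
    have i8 : t ^ criticalExponent N * ∫ x, |u x| ^ criticalExponent N
        < ∫ x, |u x| ^ criticalExponent N := mul_lt_of_lt_one_left i4 i6
    refine add_lt_add_of_le_of_lt ?_ ?_
    · gcongr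
    · gcongr

theorem exists_isH1WithGradient_mass_eq (hN : 0 < N) {a : ℝ} (ha : 0 < a) :
    ∃ (u : EuclideanSpace ℝ (Fin N) → ℝ) (G : EuclideanSpace ℝ (Fin N) → EuclideanSpace ℝ (Fin N)),
      IsH1WithGradient u G ∧ ∫ x, |u x| ^ 2 = a ^ 2 := by
  have hint := integrable_decayWeight_rpow (N := N) one_le_two hN
  have hpos := integral_decayWeight_rpow_pos (N := N) one_le_two hN
  simp only [Real.rpow_two] at hint hpos
  have hm : MemLp (decayWeight N) 2 volume := by
    rw [memLp_two_iff_integrable_sq contDiff_decayWeight.continuous.aestronglyMeasurable]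
    exact hint
  have h : IsH1WithGradient (decayWeight N) (decayWeightGradient N) := by
    refine .of_memLp hm (hm.of_le_mul (c := N)
      continuous_decayWeightGradient.aestronglyMeasurable (.of_forall fun x => ?_)) ?_
    · rw [Real.norm_of_nonneg (decayWeight_pos x).le]
      exact norm_decayWeightGradient_le x
    · intro φ hφ hc w
      have h1 : Integrable fun x => decayWeight N x * fderiv ℝ φ x w :=
        integrable_mul_fderiv_apply hm hφ hc w
      have hd : Continuous fun x => fderiv ℝ (decayWeight N) x w :=
        (contDiff_decayWeight.continuous_fderiv (by simp)).clm_apply continuous_const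
      have h2 : Integrable fun x => fderiv ℝ (decayWeight N) x w * φ x :=
        (hd.mul hφ.continuous).integrable_of_hasCompactSupport hc.mul_left
      have h3 : Integrable fun x => decayWeight N x * φ x :=
        (contDiff_decayWeight.continuous.mul hφ.continuous).integrable_of_hasCompactSupport
          hc.mul_left
      rw [integral_mul_fderiv_eq_neg_fderiv_mul_of_integrable h2 h1 h3
        (fun x _ => contDiff_decayWeight.differentiable (by simp) x)
        (fun x _ => hφ.differentiable (by simp) x)]
      congr 2; ext x
      rw [inner_toDual_symm_fderiv, mul_comm]; rfl
  refine ⟨_, _, h.const_mul (a / √(∫ x : 𝔼, decayWeight N x ^ 2)), ?_⟩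
  simp only [abs_mul, mul_pow, sq_abs, integral_const_mul, div_pow, Real.sq_sqrt hpos.le]
  field_simp

/-- For large `μ` there are admissible functions with arbitrarily small reduced energy. The test
function is a dilation of a fixed profile for which the gradient balances the subcritical term. -/
theorem exists_isAdmissible_reducedEnergy_lt (hN : 3 ≤ N) {q : ℝ} (hq : 2 + 4 / (N : ℝ) < q)
    (hq' : q < criticalExponent N) {a : ℝ} (ha : 0 < a) {c : ℝ} (hc : 0 < c) :
    ∃ μstar : ℝ, 0 < μstar ∧ ∀ μ : ℝ, μstar ≤ μ →
      ∃ (u : EuclideanSpace ℝ (Fin N) → ℝ) (G : EuclideanSpace ℝ (Fin N) → EuclideanSpace ℝ (Fin N)),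
        IsAdmissible μ q a u G ∧ reducedEnergy μ q u < c := by
  obtain ⟨u, G, hu, hm⟩ := exists_isH1WithGradient_mass_eq (N := N) (by omega) ha
  have hm0 : 0 < ∫ x, |u x| ^ 2 := by rw [hm]; positivity
  have hp := two_lt_criticalExponent hN
  have hq2 := two_lt_of_mass_supercritical hN hq
  have hβ := two_lt_dilation_exponent hN hq
  have hB := hu.integral_rpow_pos hN hm0 hq2.le hq'.le
  have hC := hu.integral_rpow_pos hN hm0 hp.le le_rfl
  have hcoef := half_sub_inv_criticalExponent_pos hN
  obtain ⟨K, hK, hS⟩ := exists_sobolev hN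
  have hA : 0 < ∫ x, ‖G x‖ ^ 2 := by
    refine lt_of_le_of_ne (integral_nonneg fun x => by positivity) fun h0 => ?_
    have := hS u G hu
    rw [← h0, Real.zero_rpow (by linarith), mul_zero] at this
    linarith
  set β := (N : ℝ) * (q - 2) / 2 with hβdef
  set A := ∫ x, ‖G x‖ ^ 2
  set B := ∫ x, |u x| ^ q
  set C := ∫ x, |u x| ^ criticalExponent N
  set κ := 1 / 2 - 1 / criticalExponent N
  have hcont : Continuous fun t : ℝ =>
      (β - 2) / (2 * β) * (t ^ 2 * A) + κ * (t ^ criticalExponent N * C) :=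
    (continuous_const.mul ((continuous_id.pow 2).mul continuous_const)).add
      (continuous_const.mul ((Real.continuous_rpow_const (by linarith)).mul continuous_const))
  have hlim := hcont.tendsto 0
  simp only [ne_eq, OfNat.ofNat_ne_zero, not_false_eq_true, zero_pow, zero_mul, mul_zero, zero_add,
    Real.zero_rpow (show criticalExponent N ≠ 0 by linarith)] at hlim
  obtain ⟨r, hr, h⟩ := Metric.eventually_nhds_iff.1 (hlim.eventually_lt_const hc)
  have hr2 : 0 < (r / 2) ^ (β - 2) := by positivity
  refine ⟨A / (β / q * B * (r / 2) ^ (β - 2)), by positivity, fun μ hμ => ?_⟩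
  have hμ0 : 0 < μ := lt_of_lt_of_le (by positivity) hμ
  set y := A / (μ * (β / q) * B) with hy
  have hy0 : 0 < y := by positivity
  set t := y ^ (β - 2)⁻¹ with ht
  have ht0 : 0 < t := by positivity
  have hty : t ^ (β - 2) = y := by
    rw [ht, ← Real.rpow_mul hy0.le, inv_mul_cancel₀ (by linarith), Real.rpow_one]
  have htr : t ≤ r / 2 := by
    rw [← Real.rpow_le_rpow_iff ht0.le (by positivity) (show 0 < β - 2 by linarith), hty, hy,
      div_le_iff₀ (by positivity)]
    rw [div_le_iff₀ (by positivity)] at hμ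
    calc A ≤ _ := hμ
      _ = _ := by ring
  have hbal : μ * (β / q) * (t ^ β * B) = t ^ 2 * A := by
    have : t ^ β = t ^ 2 * y := by
      rw [← hty, ← Real.rpow_natCast t 2, ← Real.rpow_add ht0]
      congr 1; push_cast; ring
    rw [this, hy]; field_simp
  refine ⟨dilate t u, dilateGradient t G, ⟨hu.dilate ht0, ?_, ?_, ?_⟩, ?_⟩
  · rw [integral_abs_dilate_sq u ht0]; exact hm0
  · rw [integral_abs_dilate_sq u ht0]; exact hm.le
  · rw [pohozaev_dilate hN μ q u G ht0, ← hβdef, hbal, sub_self, zero_sub, neg_nonpos]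
    positivity
  · rw [reducedEnergy_dilate hN μ q u ht0, ← hβdef]
    have h1 := h (y := t) (by
      rw [Real.dist_eq, sub_zero, abs_of_pos ht0]; linarith)
    refine lt_of_eq_of_lt ?_ h1
    congr 1
    rw [← hbal]; field_simp; rfl

/-! ### Existence of a minimizer -/

theorem IsAdmissible.comp_add_right {μ q a : ℝ} (hu : IsAdmissible μ q a u G) (y : 𝔼) :
    IsAdmissible μ q a (fun x => u (x + y)) (fun x => G (x + y)) where
  isH1 := hu.isH1.comp_add_right y
  mass_pos := by
    rw [integral_add_right_eq_self (fun x => |u x| ^ 2) y]; exact hu.mass_pos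
  mass_le := by
    rw [integral_add_right_eq_self (fun x => |u x| ^ 2) y]; exact hu.mass_le
  pohozaev_nonpos := by
    have := hu.pohozaev_nonpos
    rwa [pohozaev, ← integral_add_right_eq_self (fun x => |u x| ^ q) y,
      ← integral_add_right_eq_self (fun x => |u x| ^ criticalExponent N) y,
      ← integral_add_right_eq_self (fun x => ‖G x‖ ^ 2) y] at this

theorem reducedEnergy_comp_add_right (μ q : ℝ) (u : 𝔼 → ℝ) (y : 𝔼) :
    reducedEnergy μ q (fun x => u (x + y)) = reducedEnergy μ q u := by
  rw [reducedEnergy, integral_add_right_eq_self (fun x => |u x| ^ q) y,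
    integral_add_right_eq_self (fun x => |u x| ^ criticalExponent N) y]
  rfl

theorem WeakTendstoH1.comp_strictMono {un : ℕ → 𝔼 → ℝ} {Gn : ℕ → 𝔼 → 𝔼}
    (hw : WeakTendstoH1 un Gn u G) {φ : ℕ → ℕ} (hφ : StrictMono φ) :
    WeakTendstoH1 (fun n => un (φ n)) (fun n => Gn (φ n)) u G :=
  ⟨fun f hf => (hw.tendsto_integral f hf).comp hφ.tendsto_atTop,
    fun F hF => (hw.tendsto_integral_gradient F hF).comp hφ.tendsto_atTop⟩

theorem WeakTendstoH1.exists_bound_sub {un : ℕ → 𝔼 → ℝ} {Gn : ℕ → 𝔼 → 𝔼}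
    (h : ∀ n, IsH1WithGradient (un n) (Gn n)) (hu : IsH1WithGradient u G)
    (hw : WeakTendstoH1 un Gn u G) {M : ℝ} (hM : ∀ n, ∫ x, |un n x| ^ 2 ≤ M)
    (hM' : ∀ n, ∫ x, ‖Gn n x‖ ^ 2 ≤ M) :
    ∃ M', (∀ n, ∫ x, |un n x - u x| ^ 2 ≤ M') ∧ ∀ n, ∫ x, ‖Gn n x - G x‖ ^ 2 ≤ M' := by
  obtain ⟨c, hc⟩ := (hw.tendsto_sq h hu).bddBelow_range
  obtain ⟨c', hc'⟩ := (hw.tendsto_sq_gradient h hu).bddBelow_range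
  refine ⟨max (M - c) (M - c'), fun n => ?_, fun n => ?_⟩
  · refine le_trans ?_ (le_max_left _ _)
    have := hc ⟨n, rfl⟩
    simp only at this
    linarith [hM n]
  · refine le_trans ?_ (le_max_right _ _)
    have := hc' ⟨n, rfl⟩
    simp only at this
    linarith [hM' n]

/-- A bounded sequence in `H¹` whose weighted mass does not vanish has a subsequence converging
weakly and almost everywhere to a nonzero limit. -/
theorem exists_nonzero_weak_limit (hN : 0 < N) {un : ℕ → 𝔼 → ℝ} {Gn : ℕ → 𝔼 → 𝔼}
    (h : ∀ n, IsH1WithGradient (un n) (Gn n)) {M : ℝ} (hM : ∀ n, ∫ x, |un n x| ^ 2 ≤ M)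
    (hM' : ∀ n, ∫ x, ‖Gn n x‖ ^ 2 ≤ M) {s : ℝ} (hs : 0 < s)
    (hmass : ∀ n, s ≤ ∫ x, |decayWeight N x * un n x| ^ 2) :
    ∃ (u : 𝔼 → ℝ) (G : 𝔼 → 𝔼) (φ : ℕ → ℕ), StrictMono φ ∧ IsH1WithGradient u G ∧
      WeakTendstoH1 (fun n => un (φ n)) (fun n => Gn (φ n)) u G ∧
      (∀ᵐ x, Tendsto (fun n => un (φ n) x) atTop (𝓝 (u x))) ∧ 0 < ∫ x, |u x| ^ 2 := by
  obtain ⟨u, G, φ, hφ, hu, hw⟩ := exists_weakTendstoH1_subseq h hM hM'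
  have hv := fun n => (h (φ n)).sub hu
  have hfin := isFiniteMeasure_decayMeasure hN
  obtain ⟨M₂, hM₂, hM₂'⟩ := hw.exists_bound_sub (fun n => h (φ n)) hu (fun n => hM (φ n))
    (fun n => hM' (φ n))
  have hloc := tendsto_lintegral_sq_of_weakTendstoH1_zero hv (hw.sub (fun n => h (φ n)) hu)
    hM₂ hM₂' (decayMeasure_le (N := N))
  have hae : ∃ ψ : ℕ → ℕ, StrictMono ψ ∧
      ∀ᵐ x ∂decayMeasure N, Tendsto (fun n => un (φ (ψ n)) x) atTop (𝓝 (u x)) := by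
    have hmeas : ∀ f : 𝔼 → ℝ, AEStronglyMeasurable f volume →
        AEStronglyMeasurable f (decayMeasure N) := fun f hf =>
      hf.mono_measure decayMeasure_le
    refine (tendstoInMeasure_of_tendsto_eLpNorm (p := 2) (by norm_num)
      (fun n => hmeas _ (h (φ n)).memLp.1) (hmeas _ hu.memLp.1) ?_).exists_seq_tendsto_ae
    have h2 : Tendsto (fun n => eLpNorm (fun x => un (φ n) x - u x) 2 (decayMeasure N) ^ 2) atTop
        (𝓝 0) := by simpa only [eLpNorm_two_pow_two] using hloc
    have h3 := (ENNReal.continuous_rpow_const (y := 1 / 2)).tendsto 0 |>.comp h2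
    rw [ENNReal.zero_rpow_of_pos (by norm_num)] at h3
    refine h3.congr fun n => ?_
    simp only [Function.comp_apply]
    rw [← ENNReal.rpow_natCast, ← ENNReal.rpow_mul]
    norm_num
    rfl
  obtain ⟨ψ, hψ, hae⟩ := hae
  refine ⟨u, G, φ ∘ ψ, hφ.comp hψ, hu, hw.comp_strictMono hψ,
    absolutelyContinuous_decayMeasure.ae_le hae, ?_⟩
  refine lt_of_le_of_ne (integral_nonneg fun x => by positivity) fun h0 => ?_
  rw [eq_comm, integral_eq_zero_iff_of_nonneg (fun x => by positivity) hu.integrable_sq] at h0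
  have h1 : ∀ᵐ x ∂decayMeasure N, u x = 0 := by
    refine (withDensity_absolutelyContinuous _ _).ae_le (h0.mono fun x hx => ?_)
    simpa using hx
  have h2 : ∀ n, ENNReal.ofReal s ≤ ∫⁻ x, ‖un (φ n) x - u x‖ₑ ^ 2 ∂decayMeasure N := by
    intro n
    calc ENNReal.ofReal s ≤ ENNReal.ofReal (∫ x, |decayWeight N x * un (φ n) x| ^ 2) :=
          ENNReal.ofReal_le_ofReal (hmass _)
      _ = ∫⁻ x, ‖un (φ n) x‖ₑ ^ 2 ∂decayMeasure N := by
          rw [lintegral_decayMeasure, ofReal_integral_eq_lintegral_ofReal _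
            (.of_forall fun x => by positivity)]
          · congr 1; ext x
            rw [sq_abs, mul_pow, ENNReal.ofReal_mul (by positivity), ← sq_abs (un _ x),
              ENNReal.ofReal_pow (abs_nonneg _), ← Real.norm_eq_abs, ofReal_norm]
          · have hb : MemLp (fun x => decayWeight N x * un (φ n) x) 2 volume := by
              refine (h (φ n)).memLp.of_le (contDiff_decayWeight.continuous.aestronglyMeasurable.mul
                (h (φ n)).memLp.1) (.of_forall fun x => ?_)
              rw [norm_mul, Real.norm_of_nonneg (decayWeight_pos x).le]
              exact mul_le_of_le_one_left (norm_nonneg _) (decayWeight_le_one x)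
            simpa using (memLp_two_iff_integrable_sq_norm hb.1).1 hb
      _ = _ := lintegral_congr_ae (h1.mono fun x hx => by simp only [hx, sub_zero])
  have h3 := ge_of_tendsto' hloc h2
  rw [nonpos_iff_eq_zero, ENNReal.ofReal_eq_zero] at h3
  linarith

/-- Splitting of the reduced energy and of the Pohozaev functional along a weakly and almost
everywhere convergent sequence, a consequence of the Brezis-Lieb lemma. -/
theorem WeakTendstoH1.tendsto_functionals (hN : 3 ≤ N) {q : ℝ} (hq : 2 < q)
    (hq' : q < criticalExponent N) (μ : ℝ) {un : ℕ → 𝔼 → ℝ} {Gn : ℕ → 𝔼 → 𝔼}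
    (h : ∀ n, IsH1WithGradient (un n) (Gn n)) (hu : IsH1WithGradient u G)
    (hw : WeakTendstoH1 un Gn u G) (hae : ∀ᵐ x, Tendsto (fun n => un n x) atTop (𝓝 (u x)))
    {M : ℝ} (hM : ∀ n, ∫ x, |un n x| ^ 2 ≤ M) (hM' : ∀ n, ∫ x, ‖Gn n x‖ ^ 2 ≤ M) :
    Tendsto (fun n => reducedEnergy μ q (un n) - reducedEnergy μ q (fun x => un n x - u x)) atTop
      (𝓝 (reducedEnergy μ q u)) ∧
    Tendsto (fun n => pohozaev μ q (un n) (Gn n)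
      - pohozaev μ q (fun x => un n x - u x) (fun x => Gn n x - G x)) atTop
      (𝓝 (pohozaev μ q u G)) := by
  have hp := two_lt_criticalExponent hN
  have hv := fun n => (h n).sub hu
  obtain ⟨M₂, hM₂, hM₂'⟩ := hw.exists_bound_sub h hu hM hM'
  obtain ⟨K, hK, hS⟩ := exists_sobolev hN
  obtain ⟨K', hK', hGN⟩ := exists_gagliardoNirenberg hN hq hq'
  have hθ : 0 < (criticalExponent N - q) / (criticalExponent N - 2) :=
    div_pos (by linarith) (by linarith)
  have hN3 : (3 : ℝ) ≤ N := by exact_mod_cast hN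
  have hκ : 0 < N * (q - 2) / 4 := by
    have : 0 < N * (q - 2) := mul_pos (by linarith) (by linarith)
    positivity
  have hM₂0 : 0 ≤ M₂ := (integral_nonneg fun x => by positivity).trans (hM₂ 0)
  have hB := tendsto_integral_rpow_sub_integral_rpow (r := q) (by linarith)
    (fun n => (h n).integrable_rpow hN hq.le hq'.le) (hu.integrable_rpow hN hq.le hq'.le)
    (fun n => (hv n).integrable_rpow hN hq.le hq'.le) (fun n => (hGN _ _ (hv n)).trans
      (show _ ≤ K' * M₂ ^ ((criticalExponent N - q) / (criticalExponent N - 2))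
        * M₂ ^ (N * (q - 2) / 4) by
        have h1 := Real.rpow_le_rpow (integral_nonneg fun x => by positivity) (hM₂ n) hθ.le
        have h2 := Real.rpow_le_rpow (integral_nonneg fun x => by positivity) (hM₂' n) hκ.le
        gcongr)) hae
  have hC := tendsto_integral_rpow_sub_integral_rpow (r := criticalExponent N) (by linarith)
    (fun n => (h n).integrable_rpow hN hp.le le_rfl) (hu.integrable_rpow hN hp.le le_rfl)
    (fun n => (hv n).integrable_rpow hN hp.le le_rfl) (fun n => (hS _ _ (hv n)).trans
      (show _ ≤ K * M₂ ^ (criticalExponent N / 2) by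
        have h2 := Real.rpow_le_rpow (integral_nonneg fun x => by positivity) (hM₂' n)
          (show 0 ≤ criticalExponent N / 2 by linarith)
        gcongr)) hae
  have hA := hw.tendsto_sq_gradient h hu
  constructor
  · refine ((hB.const_mul (μ * ((N * (q - 2) / 2 - 2) / (2 * q)))).add
      (hC.const_mul (1 / 2 - 1 / criticalExponent N))).congr fun n => ?_
    simp only [reducedEnergy]; ring
  · refine ((hA.sub (hB.const_mul (μ * (N * (q - 2) / 2 / q)))).sub hC).congr fun n => ?_
    simp only [pohozaev]; ring

/-- The reduced energy attains its minimum over the admissible class, and the Pohozaev functional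
vanishes at the minimizer. By the vanishing lemma, translates of a minimizing sequence have a
nonzero weak limit `u`. If `u` were not admissible then the remainders `u_n - u` would be, and would
carry all of the infimum, leaving no reduced energy for `u`. -/
theorem exists_minimizer (hN : 3 ≤ N) {q : ℝ} (hq : 2 + 4 / (N : ℝ) < q)
    (hq' : q < criticalExponent N) {μ : ℝ} (hμ : 0 < μ) {a b c : ℝ} (hb : 0 < b)
    (hlow : ∀ (u : EuclideanSpace ℝ (Fin N) → ℝ)
      (G : EuclideanSpace ℝ (Fin N) → EuclideanSpace ℝ (Fin N)), IsAdmissible μ q a u G →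
      reducedEnergy μ q u < c → b ≤ ∫ x, |u x| ^ q)
    (hex : ∃ (u : EuclideanSpace ℝ (Fin N) → ℝ)
      (G : EuclideanSpace ℝ (Fin N) → EuclideanSpace ℝ (Fin N)), IsAdmissible μ q a u G ∧
      reducedEnergy μ q u < c) :
    ∃ (u : EuclideanSpace ℝ (Fin N) → ℝ) (G : EuclideanSpace ℝ (Fin N) → EuclideanSpace ℝ (Fin N)),
      IsAdmissible μ q a u G ∧ pohozaev μ q u G = 0 ∧
      ∀ (v : EuclideanSpace ℝ (Fin N) → ℝ) (V : EuclideanSpace ℝ (Fin N) → EuclideanSpace ℝ (Fin N)),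
        IsAdmissible μ q a v V → reducedEnergy μ q u ≤ reducedEnergy μ q v := by
  have hq2 := two_lt_of_mass_supercritical hN hq
  have hp := two_lt_criticalExponent hN
  set S : Set ℝ := {m | ∃ (u : 𝔼 → ℝ) (G : 𝔼 → 𝔼), IsAdmissible μ q a u G ∧
    reducedEnergy μ q u = m}
  have hSb : BddBelow S := ⟨0, by
    rintro m ⟨u, G, -, rfl⟩; exact reducedEnergy_nonneg hN hq hμ u⟩
  have hSn : S.Nonempty := by
    obtain ⟨u, G, hu, -⟩ := hex; exact ⟨_, u, G, hu, rfl⟩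
  set m := sInf S
  have hmle : ∀ (v : 𝔼 → ℝ) (V : 𝔼 → 𝔼), IsAdmissible μ q a v V → m ≤ reducedEnergy μ q v := fun v V hv =>
    csInf_le hSb ⟨v, V, hv, rfl⟩
  have hmc : m < c := by
    obtain ⟨u, G, hu, huc⟩ := hex; exact (hmle u G hu).trans_lt huc
  obtain ⟨k, hk, hGk⟩ := exists_integral_gradient_le hN hq hμ
  set M := max (a ^ 2) (k * c)
  obtain ⟨C, hC, hL⟩ := exists_integral_rpow_le_of_local_mass_le hN hq hq' M
  set θ := (criticalExponent N - q) / (criticalExponent N - 2)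
  have hθ : 0 < θ := div_pos (by linarith) (by linarith)
  obtain ⟨s, hs, hsb⟩ : ∃ s : ℝ, 0 < s ∧ C * s ^ θ < b := by
    have h1 := ((Real.continuous_rpow_const hθ.le).tendsto 0).const_mul C
    rw [Real.zero_rpow hθ.ne', mul_zero] at h1
    have h2 := (h1.mono_left (nhdsWithin_le_nhds (s := Set.Ioi 0))).eventually_lt_const hb
    obtain ⟨s, h3, h4⟩ := (h2.and self_mem_nhdsWithin).exists
    exact ⟨s, h4, h3⟩
  have hadm : ∀ (u : 𝔼 → ℝ) (G : 𝔼 → 𝔼), IsAdmissible μ q a u G → reducedEnergy μ q u < c →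
      ∫ x, |u x| ^ 2 ≤ M ∧ ∫ x, ‖G x‖ ^ 2 ≤ M := fun u G hu huc =>
    ⟨hu.mass_le.trans (le_max_left _ _), ((hGk u G hu.pohozaev_nonpos).trans
      (mul_le_mul_of_nonneg_left huc.le hk.le)).trans (le_max_right _ _)⟩
  -- a minimizing sequence, translated so that its mass near the origin does not vanish
  have hseq : ∀ n : ℕ, ∃ (u : 𝔼 → ℝ) (G : 𝔼 → 𝔼), IsAdmissible μ q a u G ∧
      reducedEnergy μ q u < c ∧ reducedEnergy μ q u < m + 1 / ((n : ℝ) + 1) ∧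
      s ≤ ∫ x, |decayWeight N x * u x| ^ 2 := by
    intro n
    have hlt : m < min c (m + 1 / ((n : ℝ) + 1)) :=
      lt_min hmc (lt_add_of_pos_right _ (by positivity))
    obtain ⟨_, ⟨u, G, hu, rfl⟩, huc⟩ := exists_lt_of_csInf_lt hSn hlt
    have huc1 := huc.trans_le (min_le_left _ _)
    obtain ⟨y, hy⟩ : ∃ y, s < ∫ x, |decayWeight N x * u (x + y)| ^ 2 := by
      by_contra! hcon
      have h1 := hL u G hu.isH1 (hadm u G hu huc1).1 (hadm u G hu huc1).2 s hcon
      have h2 := hlow u G hu huc1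
      linarith
    refine ⟨_, _, hu.comp_add_right y, ?_, ?_, hy.le⟩
    · rwa [reducedEnergy_comp_add_right]
    · rw [reducedEnergy_comp_add_right]
      exact huc.trans_le (min_le_right _ _)
  choose un' Gn' hn' hnc' hnm' hns' using hseq
  obtain ⟨u, G, φ, hφ, hu, hw, hae, hupos⟩ := exists_nonzero_weak_limit (by omega)
    (fun n => (hn' n).isH1) (fun n => (hadm _ _ (hn' n) (hnc' n)).1)
    (fun n => (hadm _ _ (hn' n) (hnc' n)).2) hs hns'
  set un := fun n => un' (φ n)
  set Gn := fun n => Gn' (φ n)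
  have hn : ∀ n, IsAdmissible μ q a (un n) (Gn n) := fun n => hn' (φ n)
  have hv := fun n => (hn n).isH1.sub hu
  have hJ : Tendsto (fun n => reducedEnergy μ q (un n)) atTop (𝓝 m) := by
    have h1 : Tendsto (fun n : ℕ => m + 1 / ((n : ℝ) + 1)) atTop (𝓝 m) := by
      simpa using tendsto_one_div_add_atTop_nhds_zero_nat.const_add m
    exact (tendsto_of_tendsto_of_tendsto_of_le_of_le tendsto_const_nhds h1
      (fun n => hmle _ _ (hn' n)) (fun n => (hnm' n).le)).comp hφ.tendsto_atTop
  obtain ⟨hJs, hPs⟩ := hw.tendsto_functionals hN hq2 hq' μ (fun n => (hn n).isH1) hu hae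
    (fun n => (hadm _ _ (hn' (φ n)) (hnc' (φ n))).1)
    (fun n => (hadm _ _ (hn' (φ n)) (hnc' (φ n))).2)
  have hDs := hw.tendsto_sq (fun n => (hn n).isH1) hu
  have hua : ∫ x, |u x| ^ 2 ≤ a ^ 2 := le_of_tendsto' hDs fun n => by
    have h1 := (hn n).mass_le
    have h2 : 0 ≤ ∫ x, |un n x - u x| ^ 2 := integral_nonneg fun x => by positivity
    simp only [un] at h1 h2 ⊢
    linarith
  have hJv : Tendsto (fun n => reducedEnergy μ q (fun x => un n x - u x)) atTop
      (𝓝 (m - reducedEnergy μ q u)) := by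
    refine (hJ.sub hJs).congr fun n => ?_
    ring
  rcases le_or_gt (pohozaev μ q u G) 0 with hP | hP
  · have hadmu : IsAdmissible μ q a u G := ⟨hu, hupos, hua, hP⟩
    have hum : reducedEnergy μ q u = m := by
      refine le_antisymm ?_ (hmle u G hadmu)
      have := ge_of_tendsto' hJv fun n => reducedEnergy_nonneg hN hq hμ _
      linarith
    refine ⟨u, G, hadmu, ?_, fun v V hv => hum ▸ hmle v V hv⟩
    by_contra hne
    obtain ⟨v, V, hv, hlt⟩ := hadmu.exists_reducedEnergy_lt hN hq hμ (lt_of_le_of_ne hP hne)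
    have := hmle v V hv
    linarith
  · exfalso
    have hPv : ∀ᶠ n in atTop, pohozaev μ q (fun x => un n x - u x) (fun x => Gn n x - G x) < 0 := by
      filter_upwards [hPs.eventually_const_lt hP] with n h1
      have h2 := (hn n).pohozaev_nonpos
      simp only [un, Gn] at h1 h2 ⊢
      linarith
    have hDv : ∀ᶠ n in atTop, ∫ x, |un n x - u x| ^ 2 ≤ a ^ 2 := by
      filter_upwards [hDs.eventually_const_lt hupos] with n h1
      have h2 := (hn n).mass_le
      simp only [un] at h1 h2 ⊢
      linarith
    have hadmv : ∀ᶠ n in atTop, m ≤ reducedEnergy μ q (fun x => un n x - u x) := by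
      filter_upwards [hPv, hDv] with n h1 h2
      refine hmle _ _ ⟨hv n, ?_, h2, h1.le⟩
      refine lt_of_le_of_ne (integral_nonneg fun x => by positivity) fun h0 => ?_
      rw [pohozaev, (hv n).integral_rpow_eq_zero h0.symm (by linarith),
        (hv n).integral_rpow_eq_zero h0.symm (by linarith), mul_zero, sub_zero, sub_zero] at h1
      exact h1.not_ge (integral_nonneg fun x => by positivity)
    have h1 := ge_of_tendsto hJv hadmv
    have h2 := hu.reducedEnergy_pos hN hq hμ hupos
    linarith

/-! ### The Euler-Lagrange equation -/

theorem sq_sub_one_div_two_le {t r : ℝ} (ht : 0 < t) (hr : 2 ≤ r) :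
    (t ^ 2 - 1) / 2 ≤ (t ^ r - 1) / r := by
  have h := one_add_mul_self_le_rpow_one_add (s := t ^ 2 - 1) (by nlinarith [sq_nonneg t])
    (p := r / 2) (by linarith)
  rw [add_sub_cancel, ← Real.rpow_natCast, ← Real.rpow_mul ht.le] at h
  have e : ((2 : ℕ) : ℝ) * (r / 2) = r := by push_cast; ring
  rw [e, Real.rpow_natCast] at h
  rw [div_le_div_iff₀ two_pos (by linarith)]
  linarith

/-- Where the Pohozaev functional vanishes, the energy is maximal along the dilations: this is the
fiber map inequality `E(t) ≤ E(1)` in terms of the three integrals. -/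
theorem fiber_energy_le {A B C γ β p t : ℝ} (hB : 0 ≤ B) (hC : 0 ≤ C) (hγ : 0 ≤ γ) (hβ : 2 ≤ β)
    (hp : 2 ≤ p) (ht : 0 < t) (h : A = γ * B + C) :
    t ^ 2 / 2 * A - γ / β * t ^ β * B - t ^ p / p * C ≤ 1 / 2 * A - γ / β * B - 1 / p * C := by
  have h1 := mul_le_mul_of_nonneg_left (sq_sub_one_div_two_le ht hβ) (mul_nonneg hγ hB)
  have h2 := mul_le_mul_of_nonneg_left (sq_sub_one_div_two_le ht hp) hC
  have e1 : γ * B * ((t ^ β - 1) / β) = γ / β * t ^ β * B - γ / β * B := by ring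
  have e2 : C * ((t ^ p - 1) / p) = t ^ p / p * C - 1 / p * C := by ring
  rw [e1] at h1
  rw [e2] at h2
  rw [h]
  linarith

theorem hasDerivAt_integral_norm_add_smul_sq (hG : MemLp G 2 volume) (hV : MemLp V 2 volume) :
    HasDerivAt (fun s : ℝ => ∫ x, ‖G x + s • V x‖ ^ 2) (2 * ∫ x, inner ℝ (G x) (V x)) 0 := by
  have hG2 := (memLp_two_iff_integrable_sq_norm hG.1).1 hG
  have hV2 := (memLp_two_iff_integrable_sq_norm hV.1).1 hV
  have hGV := integrable_inner_of_memLp_two hG hV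
  have e : (fun s : ℝ => ∫ x, ‖G x + s • V x‖ ^ 2) = fun s : ℝ =>
      (∫ x, ‖G x‖ ^ 2) + s * (2 * ∫ x, inner ℝ (G x) (V x)) + s ^ 2 * ∫ x, ‖V x‖ ^ 2 := by
    ext s
    have i1 : Integrable fun x => s * (2 * inner ℝ (G x) (V x)) := (hGV.const_mul 2).const_mul s
    have i2 : Integrable fun x => s ^ 2 * ‖V x‖ ^ 2 := hV2.const_mul _
    have i3 : Integrable fun x => ‖G x‖ ^ 2 + s * (2 * inner ℝ (G x) (V x)) := hG2.add i1
    rw [← integral_const_mul 2, ← integral_const_mul s, ← integral_const_mul (s ^ 2),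
      ← integral_add hG2 i1, ← integral_add i3 i2]
    congr 1; ext x
    rw [norm_add_sq_real, real_inner_smul_right, norm_smul, mul_pow, Real.norm_eq_abs, sq_abs]
    ring
  rw [e]
  have h1 := ((hasDerivAt_id (0 : ℝ)).mul_const (2 * ∫ x, inner ℝ (G x) (V x))).const_add
    (∫ x, ‖G x‖ ^ 2)
  have h2 := ((hasDerivAt_id (0 : ℝ)).pow 2).mul_const (∫ x, ‖V x‖ ^ 2)
  exact (h1.add h2).congr_deriv (by simp)

/-- The first variation of the energy at `u` in the direction `v`. -/
noncomputable def firstVariation (μ q : ℝ) (u : EuclideanSpace ℝ (Fin N) → ℝ)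
    (G : EuclideanSpace ℝ (Fin N) → EuclideanSpace ℝ (Fin N)) (v : EuclideanSpace ℝ (Fin N) → ℝ)
    (V : EuclideanSpace ℝ (Fin N) → EuclideanSpace ℝ (Fin N)) : ℝ :=
  (∫ x, inner ℝ (G x) (V x)) - μ * (∫ x, |u x| ^ (q - 2) * u x * v x)
    - ∫ x, |u x| ^ (criticalExponent N - 2) * u x * v x

theorem tendsto_slope_nhdsGT {f : ℝ → ℝ} {f' : ℝ} (h : HasDerivAt f f' 0) :
    Tendsto (fun s => s⁻¹ * (f s - f 0)) (𝓝[>] 0) (𝓝 f') := by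
  have := h.tendsto_slope_zero_right
  simpa using this

/-- At a minimizer, the energy does not decrease to first order in directions that keep the mass
below the bound. The perturbation `u + s v` is brought back to the zero set of the Pohozaev
functional by a dilation with parameter close to `1`; at `u` itself the same dilation does not
increase the energy, so the increment of the energy at fixed dilation parameter is nonnegative. -/
theorem firstVariation_nonneg (hN : 3 ≤ N) {q : ℝ} (hq : 2 + 4 / (N : ℝ) < q)
    (hq' : q < criticalExponent N) {μ a : ℝ} (hμ : 0 < μ) (hu : IsAdmissible μ q a u G)
    (hP : pohozaev μ q u G = 0) (hmin : ∀ (v : 𝔼 → ℝ) (V : 𝔼 → 𝔼), IsAdmissible μ q a v V →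
      reducedEnergy μ q u ≤ reducedEnergy μ q v) (hv : IsH1WithGradient v V)
    (hmass : ∀ᶠ s : ℝ in 𝓝[>] 0, ∫ x, |u x + s * v x| ^ 2 ≤ a ^ 2) :
    0 ≤ firstVariation μ q u G v V := by
  have hq2 := two_lt_of_mass_supercritical hN hq
  have hp := two_lt_criticalExponent hN
  have hβ := two_lt_dilation_exponent hN hq
  have hγ := pohozaev_coeff_pos hN hq hμ
  have hB := hu.isH1.integral_rpow_pos hN hu.mass_pos hq2.le hq'.le
  have hC := hu.isH1.integral_rpow_pos hN hu.mass_pos hp.le le_rfl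
  have dA := hasDerivAt_integral_norm_add_smul_sq hu.isH1.memLp_gradient hv.memLp_gradient
  have dB := hasDerivAt_integral_abs_add_mul_rpow hu.isH1.memLp.1 hv.memLp.1 (r := q)
    (by linarith) (hu.isH1.integrable_rpow hN hq2.le hq'.le)
    (hv.integrable_rpow hN hq2.le hq'.le)
  have dC := hasDerivAt_integral_abs_add_mul_rpow hu.isH1.memLp.1 hv.memLp.1
    (r := criticalExponent N) (by linarith) (hu.isH1.integrable_rpow hN hp.le le_rfl)
    (hv.integrable_rpow hN hp.le le_rfl)
  have dD := hasDerivAt_integral_abs_add_mul_rpow hu.isH1.memLp.1 hv.memLp.1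
    (r := 2) (by norm_num) (hu.isH1.integrable_rpow hN le_rfl hp.le)
    (hv.integrable_rpow hN le_rfl hp.le)
  have e0 : reducedEnergy μ q u = μ * ((N * (q - 2) / 2 - 2) / (2 * q)) * (∫ x, |u x| ^ q)
    + (1 / 2 - 1 / criticalExponent N) * ∫ x, |u x| ^ criticalExponent N := rfl
  rw [pohozaev] at hP
  rw [firstVariation]
  set p := criticalExponent N
  set β := (N : ℝ) * (q - 2) / 2 with hβdef
  set γ := μ * (β / q) with hγdef
  have hα : μ * ((β - 2) / (2 * q)) = γ / 2 - γ / β := by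
    rw [hγdef]; field_simp
  have hγβ : γ / β = μ / q := by rw [hγdef]; field_simp
  set A := fun s : ℝ => ∫ x, ‖G x + s • V x‖ ^ 2 with hAdef
  set B := fun s : ℝ => ∫ x, |u x + s * v x| ^ q with hBdef
  set C := fun s : ℝ => ∫ x, |u x + s * v x| ^ p with hCdef
  have hA0 : A 0 = ∫ x, ‖G x‖ ^ 2 := by simp [hAdef]
  have hB0 : B 0 = ∫ x, |u x| ^ q := by simp [hBdef]
  have hC0 : C 0 = ∫ x, |u x| ^ p := by simp [hCdef]
  rw [← hB0, ← hC0, hα] at e0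
  rw [← hA0, ← hB0, ← hC0] at hP
  rw [← hB0] at hB
  rw [← hC0] at hC
  by_contra! hneg
  -- the difference quotients of the energy at a fixed dilation parameter
  have hQ : Tendsto (fun z : ℝ × ℝ => z.2 ^ 2 / 2 * (z.1⁻¹ * (A z.1 - A 0))
      - γ / β * z.2 ^ β * (z.1⁻¹ * (B z.1 - B 0)) - z.2 ^ p / p * (z.1⁻¹ * (C z.1 - C 0)))
      (𝓝[>] 0 ×ˢ 𝓝 1) (𝓝 ((∫ x, inner ℝ (G x) (V x)) - μ * (∫ x, |u x| ^ (q - 2) * u x * v x)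
        - ∫ x, |u x| ^ (p - 2) * u x * v x)) := by
    have c1 : Tendsto (fun z : ℝ × ℝ => z.2 ^ 2 / 2) (𝓝[>] 0 ×ˢ 𝓝 1) (𝓝 (1 ^ 2 / 2)) :=
      ((tendsto_snd (f := 𝓝[>] (0 : ℝ)) (g := 𝓝 (1 : ℝ))).pow 2).div_const 2
    have c2 : Tendsto (fun z : ℝ × ℝ => γ / β * z.2 ^ β) (𝓝[>] 0 ×ˢ 𝓝 1)
        (𝓝 (γ / β * 1 ^ β)) :=
      ((tendsto_snd (f := 𝓝[>] (0 : ℝ)) (g := 𝓝 (1 : ℝ))).rpow_const (.inl one_ne_zero)).const_mul _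
    have c3 : Tendsto (fun z : ℝ × ℝ => z.2 ^ p / p) (𝓝[>] 0 ×ˢ 𝓝 1) (𝓝 (1 ^ p / p)) :=
      ((tendsto_snd (f := 𝓝[>] (0 : ℝ)) (g := 𝓝 (1 : ℝ))).rpow_const
        (.inl one_ne_zero)).div_const p
    have d1 := (tendsto_slope_nhdsGT dA).comp (tendsto_fst (f := 𝓝[>] (0 : ℝ)) (g := 𝓝 (1 : ℝ)))
    have d2 := (tendsto_slope_nhdsGT dB).comp (tendsto_fst (f := 𝓝[>] (0 : ℝ)) (g := 𝓝 (1 : ℝ)))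
    have d3 := (tendsto_slope_nhdsGT dC).comp (tendsto_fst (f := 𝓝[>] (0 : ℝ)) (g := 𝓝 (1 : ℝ)))
    have := ((c1.mul d1).sub (c2.mul d2)).sub (c3.mul d3)
    simp only [Real.one_rpow, one_pow, mul_one] at this
    convert! this using 2
    rw [hγβ]
    field_simp
  obtain ⟨pa, hpa, pb, hpb, hlt⟩ := eventually_prod_iff.1 (hQ.eventually_lt_const hneg)
  obtain ⟨r', hr', hball⟩ := Metric.eventually_nhds_iff.1 hpb
  set r := min r' 1 / 2
  have hr0 : 0 < r := by positivity
  have hr1 : r < 1 := by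
    have := min_le_right r' 1
    simp only [r]; linarith
  have hrr : r < r' := by
    have := min_le_left r' 1
    simp only [r]; linarith
  -- the Pohozaev functional of the dilated perturbation changes sign near `t = 1`
  have hF : ∀ t : ℝ, Tendsto (fun s => t ^ 2 * A s - γ * (t ^ β * B s) - t ^ p * C s) (𝓝[>] 0)
      (𝓝 (γ * B 0 * (t ^ 2 - t ^ β) + C 0 * (t ^ 2 - t ^ p))) := by
    intro t
    have h1 := ((dA.continuousAt.tendsto.const_mul (t ^ 2)).sub
      ((dB.continuousAt.tendsto.const_mul (t ^ β)).const_mul γ)).sub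
      (dC.continuousAt.tendsto.const_mul (t ^ p))
    have e : t ^ 2 * A 0 - γ * (t ^ β * B 0) - t ^ p * C 0
        = γ * B 0 * (t ^ 2 - t ^ β) + C 0 * (t ^ 2 - t ^ p) := by
      have : A 0 = γ * B 0 + C 0 := by linarith
      rw [this]; ring
    rw [← e]
    exact h1.mono_left nhdsWithin_le_nhds
  have hγB : 0 < γ * B 0 := mul_pos hγ hB
  have hlow : ∀ᶠ s in 𝓝[>] (0 : ℝ),
      0 < (1 - r) ^ 2 * A s - γ * ((1 - r) ^ β * B s) - (1 - r) ^ p * C s := by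
    refine (hF (1 - r)).eventually_const_lt ?_
    have h1 : (1 - r) ^ β < (1 - r) ^ 2 := by
      rw [← Real.rpow_natCast _ 2]
      exact Real.rpow_lt_rpow_of_exponent_gt (by linarith) (by linarith) (by exact_mod_cast hβ)
    have h2 : (1 - r) ^ p < (1 - r) ^ 2 := by
      rw [← Real.rpow_natCast _ 2]
      exact Real.rpow_lt_rpow_of_exponent_gt (by linarith) (by linarith) (by exact_mod_cast hp)
    exact add_pos (mul_pos hγB (sub_pos.2 h1)) (mul_pos hC (sub_pos.2 h2))
  have hupp : ∀ᶠ s in 𝓝[>] (0 : ℝ),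
      (1 + r) ^ 2 * A s - γ * ((1 + r) ^ β * B s) - (1 + r) ^ p * C s < 0 := by
    refine (hF (1 + r)).eventually_lt_const ?_
    have h1 : (1 + r) ^ 2 < (1 + r) ^ β := by
      rw [← Real.rpow_natCast _ 2]
      exact Real.rpow_lt_rpow_of_exponent_lt (by linarith) (by exact_mod_cast hβ)
    have h2 : (1 + r) ^ 2 < (1 + r) ^ p := by
      rw [← Real.rpow_natCast _ 2]
      exact Real.rpow_lt_rpow_of_exponent_lt (by linarith) (by exact_mod_cast hp)
    exact add_neg (mul_neg_of_pos_of_neg hγB (sub_neg.2 h1))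
      (mul_neg_of_pos_of_neg hC (sub_neg.2 h2))
  have hmpos : ∀ᶠ s in 𝓝[>] (0 : ℝ), 0 < ∫ x, |u x + s * v x| ^ 2 := by
    have h1 := dD.continuousAt.tendsto
    simp only [Real.rpow_two, zero_mul, add_zero] at h1
    exact (h1.mono_left nhdsWithin_le_nhds).eventually_const_lt hu.mass_pos
  obtain ⟨s, hs1, hs2, hs3, hs4, hs5, hs6⟩ := (hpa.and (hlow.and (hupp.and (hmpos.and
    (hmass.and self_mem_nhdsWithin))))).exists
  have hs0 : 0 < s := hs6
  have hcont : Continuous fun t : ℝ => t ^ 2 * A s - γ * (t ^ β * B s) - t ^ p * C s :=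
    (((continuous_id.pow 2).mul continuous_const).sub (continuous_const.mul
      ((Real.continuous_rpow_const (by linarith)).mul continuous_const))).sub
      ((Real.continuous_rpow_const (by linarith)).mul continuous_const)
  obtain ⟨t, ⟨ht1, ht2⟩, ht⟩ := intermediate_value_Icc' (show 1 - r ≤ 1 + r by linarith)
    hcont.continuousOn ⟨hs3.le, hs2.le⟩
  simp only at ht
  have ht0 : 0 < t := by linarith
  have hQt := hlt hs1 (hball (y := t) (by rw [Real.dist_eq, abs_lt]; constructor <;> linarith))
  have hw : IsH1WithGradient (fun x => u x + s * v x) (fun x => G x + s • V x) :=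
    hu.isH1.add (hv.const_mul s)
  have hadm : IsAdmissible μ q a (dilate t fun x => u x + s * v x)
      (dilateGradient t fun x => G x + s • V x) := by
    refine ⟨hw.dilate ht0, ?_, ?_, ?_⟩
    · rw [integral_abs_dilate_sq _ ht0]; exact hs4
    · rw [integral_abs_dilate_sq _ ht0]; exact hs5
    · rw [pohozaev_dilate hN μ q _ _ ht0]; exact ht.le
  have h1 := hmin _ _ hadm
  rw [reducedEnergy_dilate hN μ q _ ht0, ← hβdef, hα, e0] at h1
  change _ ≤ (γ / 2 - γ / β) * (t ^ β * B s) + (1 / 2 - 1 / p) * (t ^ p * C s) at h1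
  have h2 := fiber_energy_le (A := A 0) (t := t) hB.le hC.le hγ.le hβ.le hp.le ht0 (by linarith)
  -- `s` times the difference quotient is the increment of the energy from `u` to `u + s v`
  have h3 : s * (t ^ 2 / 2 * (s⁻¹ * (A s - A 0)) - γ / β * t ^ β * (s⁻¹ * (B s - B 0))
      - t ^ p / p * (s⁻¹ * (C s - C 0)))
      = (t ^ 2 / 2 * A s - γ / β * t ^ β * B s - t ^ p / p * C s)
        - (t ^ 2 / 2 * A 0 - γ / β * t ^ β * B 0 - t ^ p / p * C 0) := by
    have : s * s⁻¹ = 1 := mul_inv_cancel₀ hs0.ne'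
    linear_combination (t ^ 2 / 2 * (A s - A 0) - γ / β * t ^ β * (B s - B 0)
      - t ^ p / p * (C s - C 0)) * this
  have h4 := mul_neg_of_pos_of_neg hs0 hQt
  rw [h3] at h4
  have h5 : t ^ 2 / 2 * A s - γ / β * t ^ β * B s - t ^ p / p * C s
      = (γ / 2 - γ / β) * (t ^ β * B s) + (1 / 2 - 1 / p) * (t ^ p * C s) := by
    linear_combination (1 / 2) * ht
  have h6 : (γ / 2 - γ / β) * B 0 + (1 / 2 - 1 / p) * C 0
      = 1 / 2 * A 0 - γ / β * B 0 - 1 / p * C 0 := by linear_combination (-1 / 2) * hP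
  linarith

theorem firstVariation_add_const_mul (hN : 3 ≤ N) {q : ℝ} (hq : 2 < q)
    (hq' : q < criticalExponent N) (μ : ℝ) (hu : IsH1WithGradient u G) (hv : IsH1WithGradient v V)
    {w : 𝔼 → ℝ} {W : 𝔼 → 𝔼} (hw : IsH1WithGradient w W) (c d : ℝ) :
    firstVariation μ q u G (fun x => c * v x + d * w x) (fun x => c • V x + d • W x)
      = c * firstVariation μ q u G v V + d * firstVariation μ q u G w W := by
  have hp := two_lt_criticalExponent hN
  have hr : ∀ r : ℝ, 2 ≤ r → r ≤ criticalExponent N →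
      ∫ x, |u x| ^ (r - 2) * u x * (c * v x + d * w x)
        = c * (∫ x, |u x| ^ (r - 2) * u x * v x) + d * ∫ x, |u x| ^ (r - 2) * u x * w x := by
    intro r h2 hr
    have i1 := integrable_abs_rpow_mul hu.memLp.1 hv.memLp.1 (by linarith)
      (hu.integrable_rpow hN h2 hr) (hv.integrable_rpow hN h2 hr)
    have i2 := integrable_abs_rpow_mul hu.memLp.1 hw.memLp.1 (by linarith)
      (hu.integrable_rpow hN h2 hr) (hw.integrable_rpow hN h2 hr)
    rw [← integral_const_mul, ← integral_const_mul,
      ← integral_add (i1.const_mul c) (i2.const_mul d)]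
    congr 1; ext x; ring
  have hg : ∫ x, inner ℝ (G x) (c • V x + d • W x)
      = c * (∫ x, inner ℝ (G x) (V x)) + d * ∫ x, inner ℝ (G x) (W x) := by
    rw [← integral_const_mul, ← integral_const_mul, ← integral_add
      ((integrable_inner_of_memLp_two hu.memLp_gradient hv.memLp_gradient).const_mul c)
      ((integrable_inner_of_memLp_two hu.memLp_gradient hw.memLp_gradient).const_mul d)]
    simp only [inner_add_right, real_inner_smul_right]
  simp only [firstVariation]
  rw [hg, hr q hq.le hq'.le, hr _ hp.le le_rfl]
  ring

/-- Testing the first variation with `u` itself gives a negative number, because the Pohozaev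
coefficient `N (q - 2) / (2 q)` is smaller than `1`. -/
theorem firstVariation_self_neg (hN : 3 ≤ N) {q : ℝ} (hq : 2 + 4 / (N : ℝ) < q)
    (hq' : q < criticalExponent N) {μ : ℝ} (hμ : 0 < μ) (hu : IsH1WithGradient u G)
    (hm : 0 < ∫ x, |u x| ^ 2) (hP : pohozaev μ q u G = 0) : firstVariation μ q u G u G < 0 := by
  have hq2 := two_lt_of_mass_supercritical hN hq
  have hp := two_lt_criticalExponent hN
  have hB := hu.integral_rpow_pos hN hm hq2.le hq'.le
  have e : ∀ r : ℝ, 2 < r → ∀ x, |u x| ^ (r - 2) * u x * u x = |u x| ^ r := by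
    intro r hr x
    rw [mul_assoc, ← abs_mul_abs_self (u x), ← sq, ← Real.rpow_natCast,
      ← Real.rpow_add_of_nonneg (abs_nonneg _) (by linarith) (by norm_num)]
    congr 1; push_cast; ring
  rw [pohozaev] at hP
  simp only [firstVariation, e q hq2, e _ hp, real_inner_self_eq_norm_sq]
  have h1 := dilation_exponent_lt hN hq'
  have h2 : N * (q - 2) / 2 / q < 1 := by rwa [div_lt_one (by linarith)]
  have h3 : μ * (N * (q - 2) / 2 / q) * (∫ x, |u x| ^ q) < μ * 1 * ∫ x, |u x| ^ q := by gcongr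
  linarith

theorem integral_abs_add_mul_sq (hu : IsH1WithGradient u G) (hv : IsH1WithGradient v V) (s : ℝ) :
    ∫ x, |u x + s * v x| ^ 2
      = (∫ x, |u x| ^ 2) + s * (2 * (∫ x, u x * v x) + s * ∫ x, |v x| ^ 2) := by
  have i1 : Integrable fun x => u x * v x := hu.memLp.integrable_mul hv.memLp
  have i2 : Integrable fun x => 2 * (u x * v x) + s * |v x| ^ 2 :=
    (i1.const_mul 2).add (hv.integrable_sq.const_mul s)
  rw [← integral_const_mul, ← integral_const_mul s, ← integral_add (i1.const_mul 2)
    (hv.integrable_sq.const_mul s), ← integral_const_mul,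
    ← integral_add hu.integrable_sq (i2.const_mul s)]
  congr 1; ext x
  simp only [sq_abs]; ring

/-- At a minimizer, the mass constraint is active: otherwise `u` could be varied freely, also in the
direction `u`, which lowers the energy. -/
theorem IsAdmissible.mass_eq (hN : 3 ≤ N) {q : ℝ} (hq : 2 + 4 / (N : ℝ) < q)
    (hq' : q < criticalExponent N) {μ a : ℝ} (hμ : 0 < μ) (hu : IsAdmissible μ q a u G)
    (hP : pohozaev μ q u G = 0) (hmin : ∀ (v : 𝔼 → ℝ) (V : 𝔼 → 𝔼), IsAdmissible μ q a v V →
      reducedEnergy μ q u ≤ reducedEnergy μ q v) : ∫ x, |u x| ^ 2 = a ^ 2 := by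
  refine le_antisymm hu.mass_le ?_
  by_contra! hlt
  have hneg := firstVariation_self_neg hN hq hq' hμ hu.isH1 hu.mass_pos hP
  refine hneg.not_ge (firstVariation_nonneg hN hq hq' hμ hu hP hmin hu.isH1 ?_)
  simp only [integral_abs_add_mul_sq hu.isH1 hu.isH1]
  have hc : Continuous fun s : ℝ =>
    (∫ x, |u x| ^ 2) + s * (2 * (∫ x, u x * u x) + s * ∫ x, |u x| ^ 2) := by fun_prop
  have h1 := hc.tendsto 0
  simp only [zero_mul, add_zero] at h1
  exact (h1.mono_left nhdsWithin_le_nhds).eventually_le_const hlt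

/-- The Euler-Lagrange equation of the minimizer with its Lagrange multiplier. -/
theorem firstVariation_eq (hN : 3 ≤ N) {q : ℝ} (hq : 2 + 4 / (N : ℝ) < q)
    (hq' : q < criticalExponent N) {μ a : ℝ} (hμ : 0 < μ) (hu : IsAdmissible μ q a u G)
    (hP : pohozaev μ q u G = 0) (hmin : ∀ (v : 𝔼 → ℝ) (V : 𝔼 → 𝔼), IsAdmissible μ q a v V →
      reducedEnergy μ q u ≤ reducedEnergy μ q v) (hv : IsH1WithGradient v V) :
    firstVariation μ q u G v V
      = firstVariation μ q u G u G / (∫ x, |u x| ^ 2) * ∫ x, u x * v x := by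
  have hq2 := two_lt_of_mass_supercritical hN hq
  have hD := hu.mass_pos
  set D := ∫ x, |u x| ^ 2 with hDdef
  -- subtracting slightly more than the projection on `u` gives a direction that lowers the mass
  have key : ∀ (w : 𝔼 → ℝ) (W : 𝔼 → 𝔼), IsH1WithGradient w W →
      (∫ x, u x * w x) / D * firstVariation μ q u G u G ≤ firstVariation μ q u G w W := by
    intro w W hw
    have hε : ∀ ε : ℝ, 0 < ε → ((∫ x, u x * w x) / D + ε) * firstVariation μ q u G u G
        ≤ firstVariation μ q u G w W := by
      intro ε hε
      set d := (∫ x, u x * w x) / D + ε with hd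
      have hz : IsH1WithGradient (fun x => 1 * w x + (-d) * u x)
          (fun x => (1 : ℝ) • W x + (-d) • G x) := (hw.const_mul 1).add (hu.isH1.const_mul (-d))
      have hneg : ∫ x, u x * (1 * w x + (-d) * u x) < 0 := by
        have i1 : Integrable fun x => u x * w x := hu.isH1.memLp.integrable_mul hw.memLp
        have e : ∫ x, u x * (1 * w x + (-d) * u x) = (∫ x, u x * w x) + (-d) * D := by
          rw [hDdef, ← integral_const_mul, ← integral_add i1 (hu.isH1.integrable_sq.const_mul _)]
          congr 1; ext x
          rw [sq_abs]; ring
        rw [e, hd]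
        have : (∫ x, u x * w x) / D * D = ∫ x, u x * w x := div_mul_cancel₀ _ hD.ne'
        nlinarith
      have h := firstVariation_nonneg hN hq hq' hμ hu hP hmin hz ?_
      · rw [firstVariation_add_const_mul hN hq2 hq' μ hu.isH1 hw hu.isH1] at h
        linarith
      · have hc : Continuous fun s : ℝ => 2 * (∫ x, u x * (1 * w x + (-d) * u x))
            + s * ∫ x, |1 * w x + (-d) * u x| ^ 2 := by fun_prop
        have h1 := hc.tendsto 0
        simp only [zero_mul, add_zero] at h1
        filter_upwards [(h1.mono_left nhdsWithin_le_nhds).eventually_lt_const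
          (show 2 * (∫ x, u x * (1 * w x + (-d) * u x)) < 0 by linarith),
          self_mem_nhdsWithin] with s hs hs0
        rw [integral_abs_add_mul_sq hu.isH1 hz]
        have := mul_neg_of_pos_of_neg (Set.mem_Ioi.1 hs0) hs
        have := hu.mass_le
        linarith
    have hc : Continuous fun ε : ℝ =>
      ((∫ x, u x * w x) / D + ε) * firstVariation μ q u G u G := by fun_prop
    have h1 := hc.tendsto 0
    rw [add_zero] at h1
    exact le_of_tendsto (h1.mono_left (nhdsWithin_le_nhds (s := Set.Ioi 0)))
      (eventually_mem_nhdsWithin.mono fun ε h => hε ε h)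
  have h1 := key v V hv
  have h2 := key _ _ ((hv.const_mul (-1)).add (hu.isH1.const_mul 0))
  rw [firstVariation_add_const_mul hN hq2 hq' μ hu.isH1 hv hu.isH1] at h2
  have e : ∫ x, u x * (-1 * v x + 0 * u x) = -∫ x, u x * v x := by
    rw [← integral_neg]; congr 1; ext x; ring
  rw [e, neg_div] at h2
  have e2 : firstVariation μ q u G u G / D * ∫ x, u x * v x
      = (∫ x, u x * v x) / D * firstVariation μ q u G u G := by ring
  rw [e2]
  refine le_antisymm ?_ h1
  linarith

end

theorem theorem1p1 (N : ℕ) (hN : 3 ≤ N) (q : ℝ) (hq : 2 + 4 / (N : ℝ) < q)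
    (hq' : q < criticalExponent N) (a : ℝ) (ha : 0 < a) :
    ∃ μstar : ℝ, 0 < μstar ∧ ∀ μ : ℝ, μstar ≤ μ →
      ∃ (u : EuclideanSpace ℝ (Fin N) → ℝ) (lam : ℝ),
        IsWeakSolution (nonlinearity N μ q) u lam ∧
        (∫ x, |u x| ^ 2) = a ^ 2 ∧
        lam < 0 := by
  have hq2 := two_lt_of_mass_supercritical hN hq
  have hp := two_lt_criticalExponent hN
  have hκ := half_sub_inv_criticalExponent_pos hN
  obtain ⟨c₁, hc₁, hlow⟩ := exists_le_integral_rpow N hN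
  obtain ⟨μstar, hμstar, hex⟩ := exists_isAdmissible_reducedEnergy_lt hN hq hq' ha
    (c := (1 / 2 - 1 / criticalExponent N) * c₁) (by positivity)
  refine ⟨μstar, hμstar, fun μ hμ => ?_⟩
  have hμ0 : 0 < μ := hμstar.trans_le hμ
  obtain ⟨b, hb, hlow⟩ := hlow hq hq' hμ0 a
  obtain ⟨u, G, hu, hP, hmin⟩ := exists_minimizer hN hq hq' hμ0 hb (fun u G hu huc => by
    refine hlow u G hu (le_of_mul_le_mul_left ?_ hκ)
    have h1 := reducedEnergy_coeff_pos hN hq hμ0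
    have h2 : 0 ≤ ∫ x, |u x| ^ q := integral_nonneg fun x => by positivity
    have h3 := mul_nonneg h1.le h2
    rw [reducedEnergy] at huc
    linarith) (hex μ hμ)
  refine ⟨u, firstVariation μ q u G u G / ∫ x, |u x| ^ 2, ⟨G, hu.isH1, fun v V hv => ?_⟩,
    hu.mass_eq hN hq hq' hμ0 hP hmin,
    div_neg_of_neg_of_pos (firstVariation_self_neg hN hq hq' hμ0 hu.isH1 hu.mass_pos hP)
      hu.mass_pos⟩
  have i1 := (integrable_abs_rpow_mul hu.isH1.memLp.1 hv.memLp.1 (by linarith)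
    (hu.isH1.integrable_rpow hN hq2.le hq'.le) (hv.integrable_rpow hN hq2.le hq'.le)).const_mul μ
  have i2 := integrable_abs_rpow_mul hu.isH1.memLp.1 hv.memLp.1 (by linarith)
    (hu.isH1.integrable_rpow hN hp.le le_rfl) (hv.integrable_rpow hN hp.le le_rfl)
  have e : (fun x => nonlinearity N μ q (u x) * v x) = fun x =>
      μ * (|u x| ^ (q - 2) * u x * v x) + |u x| ^ (criticalExponent N - 2) * u x * v x := by
    ext x; rw [nonlinearity]; ring
  have h := firstVariation_eq hN hq hq' hμ0 hu hP hmin hv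
  rw [e]
  refine ⟨i1.add i2, ?_⟩
  rw [integral_add i1 i2, integral_const_mul, ← h, firstVariation]
  ring
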